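/- \textbf{Setting.} Let $\mathbb K=\mathbb R$ or $\mathbb C$, let $M$ be a smooth compact manifold, and let $U,V$ be ($\mathbb Z$-graded, finite rank) smooth $\mathbb K$-vector bundles over $M$ with spaces of smooth sections $\mathcal U,\mathcal V$ ($C^\infty$-topology). For a graded space, $(\Sigma\mathcal E)^i=\mathcal E^{i+1}$. A local operator $\mathcal E_1\otimes\cdots\otimes\mathcal E_l\to\mathcal F$ is a finite sum of maps $(s_1,\dots,s_l)\mapsto (D_1s_1\cdots D_ls_l)\,s$ with differential operators $D_i$ valued in functions and $s\in\mathcal F$; a local distribution is a finite sum of functionals $(s_1,\dots,s_l)\mapsto\int_M D_1s_1\cdots D_ls_l\,d\rho$ with smooth densities $\rho$. Suppose that $\mathcal U$ is a local algebra (an associative product $\mathcal U\otimes\mathcal U\to\mathcal U$ that is a local operator of degree $0$) and that $\mathcal V$ is a twisted local $\mathcal U$-bimodule (left and right actions of $\mathcal U$ on $\mathcal V$ by local operators of degree $0$ satisfying the usual associativity constraints, and a local operator $d:\mathcal U\to\mathcal V$ of degree $0$ with $d(ab)=(da)b+a(db)$). \textbf{Functionals.} For a graded space of sections $\mathcal E$,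 let $\mathrm{Ham}(\mathcal E)=\prod_{l\ge0}[(\mathcal E^\dagger)^{\otimes l}]_{\mathrm{cyc}}$ be the space of sequences $h=(h_l)$ of continuous multilinear functionals in $l$ arguments, taken modulo cyclic permutations with Koszul signs. Let $h_l\,\mathrm{cycsum}_l$ be the sum of all $l$ signed cyclic permutations of $h_l$. A vector field on $\mathcal E$ is a sequence $X=(X_k)_{k\ge0}$ of continuous multilinear maps $X_k:\mathcal E^{\otimes k}\to\mathcal E$. It acts on $\mathrm{Ham}(\mathcal E)$ by $Xh=\sum_{l\ge1,k\ge0}(h_l\,\mathrm{cycsum}_l)\circ(\mathbf 1^{\otimes l-1}\otimes X_k)$. The functional $h$ is local if each $h_l$ is represented by a local distribution. \textbf{Gauge data.} On $\mathcal X=\mathcal U\oplus\Sigma^{-1}\mathcal V$ let $m(u_1,u_2)=u_1u_2$, $m(u,v)=(-1)^{|u|}uv$, $m(v,u)=vu$, $m(v_1,v_2)=0$, let $d$ be extended by $0$ on $\Sigma^{-1}\mathcal V$, and let $X^{\mathrm{gauge}}$ be the vector field on $\Sigma\mathcal X=\Sigma\mathcal U\oplus\mathcal V$ with components $X^{\mathrm{gauge}}_1=\Sigma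 d\Sigma^{-1}$, $X^{\mathrm{gauge}}_2=\Sigma m(\Sigma^{-1}\otimes\Sigma^{-1})$ and no others. Put $W=\Sigma U\oplus V$, $W^!=\mathrm{Hom}(W,\mathrm{Den}_M\otimes\mathbb K)$ and $E=W\oplus\Sigma^{-1}W^!=\Sigma U\oplus V\oplus\Sigma^{-1}V^!\oplus\Sigma^{-2}U^!$, with sections $\mathcal E$ and the skew-symmetric pairing of degree $-1$ on $\mathcal E$ for which $\langle f,w\rangle=\int_M f(w)$ for sections $f$ of $W^!$ and $w$ of $W$. Let $S^{\mathrm{gauge}}\in\mathrm{Ham}(\mathcal E)$ be the functional $S^{\mathrm{gauge}}(x_1,\dots,x_k,y)=\langle X^{\mathrm{gauge}}_k(x_1,\dots,x_k),y\rangle$ for sections $x_i$ of $\Sigma U\oplus V$ and $y$ of $\Sigma^{-1}V^!\oplus\Sigma^{-2}U^!$, extended by zero. A functional $S\in\mathrm{Ham}(\mathcal E)$ of degree $0$ satisfies the classical master equation if there is a vector field $X^S$ with $(S_l\,\mathrm{cycsum}_l)(s_1,\dots,s_l)=\langle X^S_{l-1}(s_1,\dots,s_{l-1}),s_l\rangle$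 for all $l\ge1$, and $\{S,S\}=X^S(S)=0$. \textbf{Proposition.} Let $S^{\mathcal V}\in\mathrm{Ham}(\mathcal V)$ be a local functional of degree $0$, regarded also as a functional on $\Sigma\mathcal U\oplus\mathcal V$ and on $\mathcal E$ through the projections onto $\mathcal V$, and put $S=S^{\mathrm{gauge}}+S^{\mathcal V}\in\mathrm{Ham}(\mathcal E)$. Then: \begin{enumerate} \item $S^{\mathcal V}$ satisfies the classical master equation. \item $S$ satisfies the classical master equation if and only if $X^{\mathrm{gauge}}S^{\mathcal V}=0$. The latter holds if and only if, for all $l\ge1$ and all homogeneous $a\in\mathcal U$ and $v_1,\dots,v_l\in\mathcal V$, one has $S^{\mathcal V}_1(da)=0$ and \[ S^{\mathcal V}_{l+1}\mathrm{cycsum}_{l+1}(da,v_1,\dots,v_l)=S^{\mathcal V}_l\mathrm{cycsum}_l(av_1,v_2,\dots,v_l)-(-1)^pS^{\mathcal V}_l\mathrm{cycsum}_l(v_1,\dots,v_{l-1},v_la), \] where $p=|a|(|v_1|+\cdots+|v_l|)$. \item If $S$ satisfies the classical master equation, then $S^{\mathcal V}$ is invariant under the action of $\mathcal U$: for every homogeneous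 $a\in\mathcal U$, the vector field $-da+[a,-]$ on $\mathcal V$, with $[a,v]=av-(-1)^{|a||v|}va$, satisfies $(-da+[a,-])S^{\mathcal V}=0$. \end{enumerate} -/

import Mathlib

open scoped Manifold ContDiff Topology

set_option linter.unusedSectionVars false

namespace NCBV

open Bundle MeasureTheory

section Functions

variable (n : ℕ) (𝕂 M : Type*) [RCLike 𝕂] [TopologicalSpace M]
  [ChartedSpace (EuclideanSpace ℝ (Fin n)) M]

/-- The algebra `C^∞(M, 𝕂)` of smooth `𝕂`-valued functions. -/
def SmoothFn : Subalgebra 𝕂 (M → 𝕂) where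
  carrier := {f | ContMDiff (𝓡 n) 𝓘(ℝ, 𝕂) ∞ f}
  mul_mem' hf hg := contDiff_mul.contMDiff.comp (hf.prodMk_space hg)
  add_mem' hf hg := hf.add hg
  algebraMap_mem' _ := contMDiff_const

variable {n 𝕂 M}

/-- Smooth functions as continuous functions. -/
def toContinuous (f : SmoothFn n 𝕂 M) : C(M, 𝕂) := ⟨f, ContMDiff.continuous f.2⟩

/-- The differential of a smooth function. -/
noncomputable def diffAt (f : SmoothFn n 𝕂 M) (x : M) (v : TangentSpace (𝓡 n) x) : 𝕂 :=
  mfderiv (𝓡 n) 𝓘(ℝ, 𝕂) (f : M → 𝕂) x v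

theorem hasMFDerivAt_diffAt (f : SmoothFn n 𝕂 M) (x : M) :
    HasMFDerivAt (𝓡 n) 𝓘(ℝ, 𝕂) (f : M → 𝕂) x (mfderiv (𝓡 n) 𝓘(ℝ, 𝕂) (f : M → 𝕂) x) :=
  (ContMDiff.mdifferentiable f.2 (by simp) x).hasMFDerivAt

theorem diffAt_add (f g : SmoothFn n 𝕂 M) (x : M) (v : TangentSpace (𝓡 n) x) :
    diffAt (f + g) x v = diffAt f x v + diffAt g x v :=
  congrArg (fun T : TangentSpace (𝓡 n) x →L[ℝ] 𝕂 => T v)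
    ((hasMFDerivAt_diffAt f x).add (hasMFDerivAt_diffAt g x)).mfderiv

theorem diffAt_mul (f g : SmoothFn n 𝕂 M) (x : M) (v : TangentSpace (𝓡 n) x) :
    diffAt (f * g) x v = diffAt f x v * (g : M → 𝕂) x + (f : M → 𝕂) x * diffAt g x v := by
  have h := congrArg (fun T : TangentSpace (𝓡 n) x →L[ℝ] 𝕂 => T v)
    ((hasMFDerivAt_diffAt f x).mul (hasMFDerivAt_diffAt g x)).mfderiv
  refine h.trans ?_
  rw [add_comm, mul_comm (diffAt f x v)]
  rfl

theorem diffAt_smul (c : 𝕂) (f : SmoothFn n 𝕂 M) (x : M) (v : TangentSpace (𝓡 n) x) :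
    diffAt (c • f) x v = c * diffAt f x v := by
  have h0 : diffAt (algebraMap 𝕂 (SmoothFn n 𝕂 M) c) x v = 0 :=
    congrArg (fun T : TangentSpace (𝓡 n) x →L[ℝ] 𝕂 => T v)
      (hasMFDerivAt_const (I := 𝓡 n) (I' := 𝓘(ℝ, 𝕂)) c x).mfderiv
  rw [Algebra.smul_def, diffAt_mul, h0, zero_mul, zero_add]
  rfl

variable [IsManifold (𝓡 n) ∞ M]

variable (n M) in
/-- Smooth vector fields on `M`. -/
abbrev SmoothField : Type _ :=
  ContMDiffSection (𝓡 n) (EuclideanSpace ℝ (Fin n)) ∞ (TangentSpace (𝓡 n) : M → Type _)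

/-- The derivative `Z f` of a smooth function along a vector field. -/
noncomputable def fieldDeriv (Z : SmoothField n M) :
    SmoothFn n 𝕂 M →ₗ[𝕂] SmoothFn n 𝕂 M where
  toFun f := ⟨fun x => diffAt f x (Z x), by
    have h1 := (ContMDiff.contMDiff_tangentMap f.2 (m := ∞) (by simp)).comp Z.contMDiff
    exact (contMDiff_snd_tangentBundle_modelSpace 𝕂 𝓘(ℝ, 𝕂)).comp h1⟩
  map_add' f g := Subtype.ext (funext fun x => diffAt_add f g x (Z x))
  map_smul' c f := Subtype.ext (funext fun x => diffAt_smul c f x (Z x))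

theorem fieldDeriv_mul (Z : SmoothField n M) (f g : SmoothFn n 𝕂 M) :
    fieldDeriv Z (f * g) = fieldDeriv Z f * g + f * fieldDeriv Z g :=
  Subtype.ext (funext fun x => diffAt_mul f g x (Z x))

end Functions

section Densities

variable {n : ℕ} {𝕂 M : Type*} [RCLike 𝕂] [TopologicalSpace M]
  [ChartedSpace (EuclideanSpace ℝ (Fin n)) M] [CompactSpace M]

theorem integrableOn_chart (e : OpenPartialHomeomorph M (EuclideanSpace ℝ (Fin n)))
    (f : SmoothFn n 𝕂 M) (hf : tsupport (f : M → 𝕂) ⊆ e.source)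
    {r : EuclideanSpace ℝ (Fin n) → 𝕂} (hr : ContinuousOn r e.target) :
    IntegrableOn (fun y => (f : M → 𝕂) (e.symm y) * r y) e.target := by
  have hK : IsCompact (e '' tsupport (f : M → 𝕂)) :=
    (isClosed_tsupport _).isCompact.image_of_continuousOn (e.continuousOn.mono hf)
  have hKt : e '' tsupport (f : M → 𝕂) ⊆ e.target := by
    rintro _ ⟨x, hx, rfl⟩
    exact e.map_source (hf hx)
  have hc : ContinuousOn (fun y => (f : M → 𝕂) (e.symm y) * r y) e.target :=
    ((ContMDiff.continuous f.2).comp_continuousOn e.continuousOn_symm).mul hr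
  refine ((hc.mono hKt).integrableOn_compact hK).of_forall_sdiff_eq_zero
    e.open_target.measurableSet ?_
  rintro y ⟨hy, hyK⟩
  have : e.symm y ∉ tsupport (f : M → 𝕂) := fun h => hyK ⟨_, h, e.right_inv hy⟩
  rw [image_eq_zero_of_notMem_tsupport this, zero_mul]

variable (n 𝕂 M) in
/-- A smooth `𝕂`-valued density on the compact manifold `M`, i.e. a smooth section of
`Den_M ⊗ 𝕂`, given as the `𝕂`-valued measure it defines: a linear functional
`f ↦ ∫_M f dρ` on smooth functions which, in every chart, is integration against a smooth
multiple of Lebesgue measure. -/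
def densities : Submodule 𝕂 (SmoothFn n 𝕂 M →ₗ[𝕂] 𝕂) where
  carrier := {ρ | ∀ e ∈ atlas (EuclideanSpace ℝ (Fin n)) M,
    ∃ r : EuclideanSpace ℝ (Fin n) → 𝕂, ContDiffOn ℝ ∞ r e.target ∧
      ∀ f : SmoothFn n 𝕂 M, tsupport (f : M → 𝕂) ⊆ e.source →
        ρ f = ∫ y in e.target, (f : M → 𝕂) (e.symm y) * r y}
  zero_mem' e _ := ⟨0, contDiffOn_const, fun f _ => by simp⟩
  add_mem' {ρ σ} hρ hσ e he := by
    obtain ⟨r, hr, hrf⟩ := hρ e he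
    obtain ⟨s, hs, hsf⟩ := hσ e he
    refine ⟨r + s, hr.add hs, fun f hf => ?_⟩
    rw [LinearMap.add_apply, hrf f hf, hsf f hf, ← integral_add
      (integrableOn_chart e f hf hr.continuousOn) (integrableOn_chart e f hf hs.continuousOn)]
    simp [mul_add]
  smul_mem' c ρ hρ e he := by
    obtain ⟨r, hr, hrf⟩ := hρ e he
    refine ⟨c • r, contDiffOn_const.smul hr, fun f hf => ?_⟩
    rw [LinearMap.smul_apply, hrf f hf, ← integral_smul]
    simp [mul_left_comm]

variable (n 𝕂 M) in
/-- The space of smooth `𝕂`-valued densities. -/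
def Density : Type _ := densities n 𝕂 M

noncomputable instance : AddCommGroup (Density n 𝕂 M) :=
  inferInstanceAs (AddCommGroup (densities n 𝕂 M))

noncomputable instance : Module 𝕂 (Density n 𝕂 M) :=
  inferInstanceAs (Module 𝕂 (densities n 𝕂 M))

/-- `ρ.integral f = ∫_M f dρ`. -/
def Density.integral (ρ : Density n 𝕂 M) : SmoothFn n 𝕂 M →ₗ[𝕂] 𝕂 := ρ.1

theorem Density.ext {ρ σ : Density n 𝕂 M} (h : ∀ f, ρ.integral f = σ.integral f) : ρ = σ :=
  Subtype.ext (LinearMap.ext h)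

variable [IsManifold (𝓡 n) ∞ M]

/-- The product `g ρ` of a density with a smooth function: `∫ f d(g ρ) = ∫ g f dρ`. -/
noncomputable instance : Module (SmoothFn n 𝕂 M) (Density n 𝕂 M) where
  smul g ρ := ⟨ρ.integral ∘ₗ LinearMap.mulLeft 𝕂 g, fun e he => by
    obtain ⟨r, hr, hrf⟩ := ρ.2 e he
    refine ⟨fun y => (g : M → 𝕂) (e.symm y) * r y, ?_, fun f hf => ?_⟩
    · refine ContDiffOn.mul ?_ hr
      have h1 := ContMDiff.comp_contMDiffOn g.2
        (contMDiffOn_symm_of_mem_maximalAtlas (IsManifold.subset_maximalAtlas (I := 𝓡 n) he))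
      exact h1.contDiffOn
    · refine (hrf (g * f) ((tsupport_mul_subset_right).trans hf)).trans ?_
      refine integral_congr_ae (Filter.Eventually.of_forall fun y => ?_)
      change ((g : M → 𝕂) (e.symm y) * (f : M → 𝕂) (e.symm y)) * r y = _
      ring⟩
  one_smul ρ := Density.ext fun f => congrArg ρ.integral (one_mul f)
  mul_smul g h ρ := Density.ext fun f => congrArg ρ.integral (by
    change (g * h) * f = h * (g * f); ring)
  smul_zero g := Density.ext fun f => rfl
  smul_add g ρ σ := Density.ext fun f => rfl
  add_smul g h ρ := Density.ext fun f =>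
    (congrArg ρ.integral (add_mul g h f)).trans (map_add ρ.integral _ _)
  zero_smul ρ := Density.ext fun f =>
    (congrArg ρ.integral (zero_mul f)).trans (map_zero ρ.integral)

theorem Density.smul_integral (g f : SmoothFn n 𝕂 M) (ρ : Density n 𝕂 M) :
    (g • ρ).integral f = ρ.integral (g * f) := rfl

instance : IsScalarTower 𝕂 (SmoothFn n 𝕂 M) (Density n 𝕂 M) where
  smul_assoc c g ρ := Density.ext fun f => by
    refine (congrArg ρ.integral (smul_mul_assoc c g f)).trans (map_smul ρ.integral c _)

theorem contDiff_det (n : ℕ) : ContDiff ℝ ∞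
    (fun T : EuclideanSpace ℝ (Fin n) →L[ℝ] EuclideanSpace ℝ (Fin n) => T.det) := by
  have h : (fun T : EuclideanSpace ℝ (Fin n) →L[ℝ] EuclideanSpace ℝ (Fin n) => T.det) =
      fun T => ∑ σ : Equiv.Perm (Fin n), (Equiv.Perm.sign σ : ℤ) •
        ∏ i, T (EuclideanSpace.basisFun (Fin n) ℝ i) (σ i) := by
    funext T
    rw [ContinuousLinearMap.det,
      ← LinearMap.det_toMatrix (EuclideanSpace.basisFun (Fin n) ℝ).toBasis, Matrix.det_apply]
    refine Finset.sum_congr rfl fun σ _ => ?_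
    simp [LinearMap.toMatrix_apply, Units.smul_def]
  rw [h]
  refine ContDiff.sum fun σ _ => ContDiff.const_smul _ (contDiff_prod fun i _ => ?_)
  exact ((EuclideanSpace.proj (𝕜 := ℝ) (σ i)).comp (ContinuousLinearMap.apply ℝ
    (EuclideanSpace ℝ (Fin n)) (EuclideanSpace.basisFun (Fin n) ℝ i))).contDiff

theorem contDiff_ofReal : ContDiff ℝ ∞ (fun r : ℝ => (r : 𝕂)) :=
  (RCLike.ofRealCLM (K := 𝕂)).contDiff

theorem contDiff_conj : ContDiff ℝ ∞ (fun z : 𝕂 => (starRingEnd 𝕂) z) :=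
  (RCLike.conjCLE (K := 𝕂)).contDiff

theorem cutoff_isDensity (c : SmoothFn n 𝕂 M)
    {e₀ : OpenPartialHomeomorph M (EuclideanSpace ℝ (Fin n))}
    (he₀ : e₀ ∈ atlas (EuclideanSpace ℝ (Fin n)) M) (hc : tsupport (c : M → 𝕂) ⊆ e₀.source)
    {e : OpenPartialHomeomorph M (EuclideanSpace ℝ (Fin n))}
    (he : e ∈ atlas (EuclideanSpace ℝ (Fin n)) M) :
    ContDiffOn ℝ ∞ (fun z => (c : M → 𝕂) (e.symm z) *
        ((|(fderiv ℝ (e₀ ∘ e.symm) z).det| : ℝ) : 𝕂)) e.target ∧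
      (∀ f : SmoothFn n 𝕂 M, tsupport (f : M → 𝕂) ⊆ e.source →
        ∫ y in e₀.target, ((c * f : SmoothFn n 𝕂 M) : M → 𝕂) (e₀.symm y) =
          ∫ z in e.target, (f : M → 𝕂) (e.symm z) * ((c : M → 𝕂) (e.symm z) *
            ((|(fderiv ℝ (e₀ ∘ e.symm) z).det| : ℝ) : 𝕂))) ∧
      ∀ z ∈ e.target, e.symm z ∈ e₀.source → (fderiv ℝ (e₀ ∘ e.symm) z).det ≠ 0 := by
  set S := (e.symm.trans e₀).source with hS
  have hSo : IsOpen S := (e.symm.trans e₀).open_source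
  have hmem : ∀ {e' : OpenPartialHomeomorph M (EuclideanSpace ℝ (Fin n))},
      e' ∈ atlas (EuclideanSpace ℝ (Fin n)) M → e' ∈ IsManifold.maximalAtlas (𝓡 n) ∞ M :=
    fun h => IsManifold.subset_maximalAtlas (I := 𝓡 n) h
  have hST : ∀ z, z ∈ S ↔ z ∈ e.target ∧ e.symm z ∈ e₀.source := fun z => by
    simp [hS]
  have htau : ContDiffOn ℝ ∞ (e₀ ∘ e.symm) S := by
    refine ContMDiffOn.contDiffOn ?_
    refine (contMDiffOn_of_mem_maximalAtlas (hmem he₀)).comp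
      ((contMDiffOn_symm_of_mem_maximalAtlas (hmem he)).mono fun z hz => ((hST z).1 hz).1) ?_
    exact fun z hz => ((hST z).1 hz).2
  have htau' : ContDiffOn ℝ ∞ (e ∘ e₀.symm) (e.symm.trans e₀).target := by
    have h : ∀ y, y ∈ (e.symm.trans e₀).target → y ∈ e₀.target ∧ e₀.symm y ∈ e.source :=
      fun y hy => by simpa [OpenPartialHomeomorph.trans_target] using hy
    refine ContMDiffOn.contDiffOn ?_
    refine (contMDiffOn_of_mem_maximalAtlas (hmem he)).comp
      ((contMDiffOn_symm_of_mem_maximalAtlas (hmem he₀)).mono fun z hz => (h z hz).1) ?_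
    exact fun z hz => (h z hz).2
  have hdiff : ∀ z ∈ S, DifferentiableAt ℝ (e₀ ∘ e.symm) z := fun z hz =>
    (htau.contDiffAt (hSo.mem_nhds hz)).differentiableAt (by simp)
  have hdet : ∀ z ∈ S, (fderiv ℝ (e₀ ∘ e.symm) z).det ≠ 0 := by
    intro z hz
    have hy : (e.symm.trans e₀) z ∈ (e.symm.trans e₀).target := (e.symm.trans e₀).map_source hz
    have hd : DifferentiableAt ℝ (e ∘ e₀.symm) ((e₀ ∘ e.symm) z) :=
      (htau'.contDiffAt ((e.symm.trans e₀).open_target.mem_nhds hy)).differentiableAt (by simp)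
    have hcomp : (e ∘ e₀.symm) ∘ (e₀ ∘ e.symm) =ᶠ[𝓝 z] id := by
      filter_upwards [hSo.mem_nhds hz] with w hw
      have := (e.symm.trans e₀).left_inv hw
      simpa using this
    have h1 := hcomp.fderiv_eq (𝕜 := ℝ)
    rw [fderiv_comp z hd (hdiff z hz), fderiv_id] at h1
    have h2 := congrArg ContinuousLinearMap.det h1
    intro h0
    have h3 : ((fderiv ℝ (e ∘ e₀.symm) ((e₀ ∘ e.symm) z)).comp
        (fderiv ℝ (e₀ ∘ e.symm) z)).det =
        (fderiv ℝ (e ∘ e₀.symm) ((e₀ ∘ e.symm) z)).det * (fderiv ℝ (e₀ ∘ e.symm) z).det :=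
      LinearMap.det_comp _ _
    rw [h3, h0, mul_zero] at h2
    have h4 : (ContinuousLinearMap.id ℝ (EuclideanSpace ℝ (Fin n))).det = 1 := LinearMap.det_id
    rw [h4] at h2
    exact zero_ne_one h2
  have hcz : ∀ z, z ∈ e.target → z ∉ S → (c : M → 𝕂) (e.symm z) = 0 := fun z hz hzS =>
    image_eq_zero_of_notMem_tsupport fun h => hzS ((hST z).2 ⟨hz, hc h⟩)
  refine ⟨?_, fun f hf => ?_, fun z hz hz' => hdet z ((hST z).2 ⟨hz, hz'⟩)⟩
  · intro z hz
    refine ContDiffAt.contDiffWithinAt ?_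
    have hcs : ContDiffOn ℝ ∞ (fun z => (c : M → 𝕂) (e.symm z)) e.target :=
      (ContMDiff.comp_contMDiffOn c.2
        (contMDiffOn_symm_of_mem_maximalAtlas (hmem he))).contDiffOn
    by_cases hzs : e.symm z ∈ tsupport (c : M → 𝕂)
    · have hzS : z ∈ S := (hST z).2 ⟨hz, hc hzs⟩
      refine (hcs.contDiffAt (e.open_target.mem_nhds hz)).mul ?_
      have h1 : ContDiffAt ℝ ∞ (fun z => fderiv ℝ (e₀ ∘ e.symm) z) z :=
        (htau.contDiffAt (hSo.mem_nhds hzS)).fderiv_right (m := ∞) (by simp)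
      have h2 : ContDiff ℝ ∞ (fun T : EuclideanSpace ℝ (Fin n) →L[ℝ] EuclideanSpace ℝ (Fin n) =>
          T.det) := contDiff_det n
      have h3 : ContDiffAt ℝ ∞ (fun z => (fderiv ℝ (e₀ ∘ e.symm) z).det) z :=
        h2.contDiffAt.comp z h1
      exact contDiff_ofReal.contDiffAt.comp z (h3.abs (hdet z hzS))
    · have : (fun z => (c : M → 𝕂) (e.symm z) *
          ((|(fderiv ℝ (e₀ ∘ e.symm) z).det| : ℝ) : 𝕂)) =ᶠ[𝓝 z] fun _ => 0 := by
        have hU : IsOpen (e.target ∩ e.symm ⁻¹' (tsupport (c : M → 𝕂))ᶜ) :=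
          e.symm.isOpen_inter_preimage (isClosed_tsupport _).isOpen_compl
        filter_upwards [hU.mem_nhds ⟨hz, hzs⟩] with w hw
        rw [image_eq_zero_of_notMem_tsupport hw.2, zero_mul]
      exact contDiffAt_const.congr_of_eventuallyEq this
  · have himg : (e₀ ∘ e.symm) '' S ⊆ e₀.target := by
      rintro _ ⟨z, hz, rfl⟩
      exact e₀.map_source ((hST z).1 hz).2
    rw [setIntegral_eq_of_subset_of_forall_sdiff_eq_zero
      e₀.open_target.measurableSet himg (fun y hy => ?_),
      integral_image_eq_integral_abs_det_fderiv_smul volume hSo.measurableSet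
        (fun z hz => (hdiff z hz).hasFDerivAt.hasFDerivWithinAt) ?_,
      setIntegral_eq_of_subset_of_forall_sdiff_eq_zero (t := e.target) (s := S)
        e.open_target.measurableSet (fun z hz => ((hST z).1 hz).1) (fun z hz => ?_)]
    · refine setIntegral_congr_fun hSo.measurableSet fun z hz => ?_
      have h1 : e₀.symm ((e₀ ∘ e.symm) z) = e.symm z := e₀.left_inv ((hST z).1 hz).2
      simp only [h1]
      change _ • ((c : M → 𝕂) (e.symm z) * (f : M → 𝕂) (e.symm z)) = _
      rw [RCLike.real_smul_eq_coe_mul]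
      ring
    · rw [hcz z hz.1 hz.2, zero_mul, mul_zero]
    · exact (e.symm.trans e₀).injOn
    · have hfy : e₀.symm y ∉ e.source := by
        intro h
        refine hy.2 ⟨e (e₀.symm y), (hST _).2 ⟨e.map_source h, ?_⟩, ?_⟩
        · rw [e.left_inv h]; exact e₀.map_target hy.1
        · simp [e.left_inv h, e₀.right_inv hy.1]
      have : (f : M → 𝕂) (e₀.symm y) = 0 :=
        image_eq_zero_of_notMem_tsupport fun h => hfy (hf h)
      change (c : M → 𝕂) _ * (f : M → 𝕂) _ = 0
      rw [this, mul_zero]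

variable [T2Space M]

variable (n 𝕂 M) in
/-- There is a nowhere vanishing smooth density; it trivializes the line bundle of densities, and
integration against it is continuous in the supremum norm. -/
theorem exists_reference_density : ∃ ρ₀ : Density n 𝕂 M,
    (∀ ρ : Density n 𝕂 M, ∃ g : SmoothFn n 𝕂 M, ρ = g • ρ₀) ∧
    (∀ g : SmoothFn n 𝕂 M, g • ρ₀ = 0 → g = 0) ∧
    ∃ C : ℝ, ∀ f : SmoothFn n 𝕂 M, ‖ρ₀.integral f‖ ≤ C * ‖toContinuous f‖ := by
  classical
  obtain ⟨χ, hχ⟩ := SmoothPartitionOfUnity.exists_isSubordinate_chartAt_source (𝓡 n) M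
  let J : Finset M := (χ.locallyFinite.finite_nonempty_of_compact).toFinset
  have hJ : ∀ x i, χ i x ≠ 0 → i ∈ J := fun x i h => by
    simp only [J, Set.Finite.mem_toFinset, Set.mem_ofPred_eq]
    exact ⟨x, h⟩
  let c : M → SmoothFn n 𝕂 M := fun i =>
    ⟨fun x => ((χ i x : ℝ) : 𝕂), contDiff_ofReal.contMDiff.comp (χ i).contMDiff⟩
  have hcs : ∀ i, tsupport (c i : M → 𝕂) ⊆ (chartAt (EuclideanSpace ℝ (Fin n)) i).source := by
    intro i
    refine (closure_mono ?_).trans (hχ i)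
    intro x hx h
    exact hx (by change ((χ i x : ℝ) : 𝕂) = 0; rw [h, RCLike.ofReal_zero])
  have hsumR : ∀ x, ∑ i ∈ J, χ i x = 1 := by
    intro x
    rw [← χ.sum_eq_one (Set.mem_univ x), finsum_eq_sum_of_support_subset]
    intro i hi
    exact hJ x i hi
  have hsum : ∑ i ∈ J, c i = 1 := by
    refine Subtype.ext (funext fun x => ?_)
    have : ((∑ i ∈ J, c i : SmoothFn n 𝕂 M) : M → 𝕂) x = ∑ i ∈ J, (c i : M → 𝕂) x := by
      rw [AddSubmonoidClass.coe_finsetSum, Finset.sum_apply]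
    rw [this]
    change ∑ i ∈ J, ((χ i x : ℝ) : 𝕂) = 1
    rw [← RCLike.ofReal_sum, hsumR, RCLike.ofReal_one]
  have hint : ∀ i (f : SmoothFn n 𝕂 M), IntegrableOn
      (fun y => ((c i * f : SmoothFn n 𝕂 M) : M → 𝕂) ((chartAt _ i).symm y))
      (chartAt (EuclideanSpace ℝ (Fin n)) i).target := by
    intro i f
    simpa using integrableOn_chart (chartAt (EuclideanSpace ℝ (Fin n)) i) (c i * f)
      ((tsupport_mul_subset_left).trans (hcs i)) (r := fun _ => 1) continuousOn_const
  let L : SmoothFn n 𝕂 M →ₗ[𝕂] 𝕂 :=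
    { toFun := fun f => ∑ i ∈ J, ∫ y in (chartAt (EuclideanSpace ℝ (Fin n)) i).target,
        ((c i * f : SmoothFn n 𝕂 M) : M → 𝕂) ((chartAt (EuclideanSpace ℝ (Fin n)) i).symm y)
      map_add' := fun f g => by
        rw [← Finset.sum_add_distrib]
        refine Finset.sum_congr rfl fun i _ => ?_
        rw [← integral_add (hint i f) (hint i g), mul_add]
        rfl
      map_smul' := fun a f => by
        rw [RingHom.id_apply, Finset.smul_sum]
        refine Finset.sum_congr rfl fun i _ => ?_
        rw [← integral_smul, mul_smul_comm]
        rfl }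
  -- the coefficient of the reference density in a chart
  let W : OpenPartialHomeomorph M (EuclideanSpace ℝ (Fin n)) → EuclideanSpace ℝ (Fin n) → 𝕂 :=
    fun e z => ∑ i ∈ J, (c i : M → 𝕂) (e.symm z) *
      ((|(fderiv ℝ (chartAt (EuclideanSpace ℝ (Fin n)) i ∘ e.symm) z).det| : ℝ) : 𝕂)
  have hW : ∀ e ∈ atlas (EuclideanSpace ℝ (Fin n)) M, ContDiffOn ℝ ∞ (W e) e.target := by
    intro e he
    exact ContDiffOn.sum fun i _ => (cutoff_isDensity (c i) (chart_mem_atlas _ i) (hcs i) he).1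
  have hLW : ∀ e ∈ atlas (EuclideanSpace ℝ (Fin n)) M, ∀ f : SmoothFn n 𝕂 M,
      tsupport (f : M → 𝕂) ⊆ e.source →
        L f = ∫ y in e.target, (f : M → 𝕂) (e.symm y) * W e y := by
    intro e he f hf
    have h := fun i => cutoff_isDensity (c i) (chart_mem_atlas _ i) (hcs i) he
    simp only [W, Finset.mul_sum]
    rw [integral_finsetSum _ fun i _ => integrableOn_chart e f hf (h i).1.continuousOn]
    exact Finset.sum_congr rfl fun i _ => (h i).2.1 f hf
  let ρ₀ : Density n 𝕂 M := ⟨L, fun e he => ⟨W e, hW e he, hLW e he⟩⟩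
  have hρ₀ : ∀ f, ρ₀.integral f = L f := fun f => rfl
  let w : OpenPartialHomeomorph M (EuclideanSpace ℝ (Fin n)) → EuclideanSpace ℝ (Fin n) → ℝ :=
    fun e z => ∑ i ∈ J, χ i (e.symm z) *
      |(fderiv ℝ (chartAt (EuclideanSpace ℝ (Fin n)) i ∘ e.symm) z).det|
  have hWw : ∀ e z, W e z = ((w e z : ℝ) : 𝕂) := by
    intro e z
    simp only [W, w, RCLike.ofReal_sum, RCLike.ofReal_mul]
    rfl
  have hwpos : ∀ e ∈ atlas (EuclideanSpace ℝ (Fin n)) M, ∀ z ∈ e.target, 0 < w e z := by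
    intro e he z hz
    have hnn : ∀ i ∈ J, 0 ≤ χ i (e.symm z) *
        |(fderiv ℝ (chartAt (EuclideanSpace ℝ (Fin n)) i ∘ e.symm) z).det| :=
      fun i _ => mul_nonneg (χ.nonneg i _) (abs_nonneg _)
    obtain ⟨i, hi⟩ := χ.exists_pos_of_mem (Set.mem_univ (e.symm z))
    have hd := (cutoff_isDensity (𝕂 := 𝕂) (c i) (chart_mem_atlas _ i) (hcs i) he).2.2 z hz
      (hχ i (subset_tsupport _ hi.ne'))
    exact (mul_pos hi (abs_pos.2 hd)).trans_le
      (Finset.single_le_sum hnn (hJ _ i hi.ne'))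
  have hWne : ∀ e ∈ atlas (EuclideanSpace ℝ (Fin n)) M, ∀ z ∈ e.target, W e z ≠ 0 := by
    intro e he z hz
    rw [hWw]
    exact RCLike.ofReal_ne_zero.2 (hwpos e he z hz).ne'
  refine ⟨ρ₀, fun ρ => ?_, fun g hg => ?_, ?_⟩
  · choose r hr hrf using fun i : M => ρ.2 (chartAt (EuclideanSpace ℝ (Fin n)) i)
      (chart_mem_atlas _ i)
    let q : M → M → 𝕂 := fun i x =>
      r i (chartAt (EuclideanSpace ℝ (Fin n)) i x) /
        W (chartAt (EuclideanSpace ℝ (Fin n)) i) (chartAt (EuclideanSpace ℝ (Fin n)) i x)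
    have hq : ∀ i, ContMDiff (𝓡 n) 𝓘(ℝ, 𝕂) ∞ (fun x => (c i : M → 𝕂) x * q i x) := by
      intro i x
      by_cases hx : x ∈ tsupport (c i : M → 𝕂)
      · have hxs := hcs i hx
        have ht := (chartAt (EuclideanSpace ℝ (Fin n)) i).map_source hxs
        have hopen := (chartAt (EuclideanSpace ℝ (Fin n)) i).open_target
        have h1 : ContDiffAt ℝ ∞ (fun y => r i y / W (chartAt (EuclideanSpace ℝ (Fin n)) i) y)
            (chartAt (EuclideanSpace ℝ (Fin n)) i x) := by
          simp only [div_eq_mul_inv]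
          exact ((hr i).contDiffAt (hopen.mem_nhds ht)).mul
            (((hW _ (chart_mem_atlas _ i)).contDiffAt (hopen.mem_nhds ht)).inv
              (hWne _ (chart_mem_atlas _ i) _ ht))
        have h2 : ContMDiffAt (𝓡 n) 𝓘(ℝ, 𝕂) ∞ (q i) x :=
          ContMDiffAt.comp x h1.contMDiffAt
            (contMDiffAt_of_mem_maximalAtlas
              (IsManifold.subset_maximalAtlas (I := 𝓡 n) (chart_mem_atlas _ i)) hxs)
        exact contDiff_mul.contMDiff.contMDiffAt.comp x
          (ContMDiffAt.prodMk_space ((c i).2 x) h2)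
      · have : (fun x => (c i : M → 𝕂) x * q i x) =ᶠ[𝓝 x] fun _ => 0 := by
          filter_upwards [(isClosed_tsupport _).isOpen_compl.mem_nhds hx] with y hy
          rw [image_eq_zero_of_notMem_tsupport hy, zero_mul]
        exact contMDiffAt_const.congr_of_eventuallyEq this
    let g : M → SmoothFn n 𝕂 M := fun i => ⟨fun x => (c i : M → 𝕂) x * q i x, hq i⟩
    refine ⟨∑ i ∈ J, g i, Density.ext fun f => ?_⟩
    rw [Density.smul_integral, hρ₀, Finset.sum_mul, map_sum]
    have h1 : ρ.integral f = ∑ i ∈ J, ρ.integral (c i * f) := by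
      rw [← map_sum, ← Finset.sum_mul, hsum, one_mul]
    rw [h1]
    refine Finset.sum_congr rfl fun i _ => ?_
    have hs1 : tsupport ((c i * f : SmoothFn n 𝕂 M) : M → 𝕂) ⊆
        (chartAt (EuclideanSpace ℝ (Fin n)) i).source := tsupport_mul_subset_left.trans (hcs i)
    have hs2 : tsupport ((g i * f : SmoothFn n 𝕂 M) : M → 𝕂) ⊆
        (chartAt (EuclideanSpace ℝ (Fin n)) i).source :=
      (tsupport_mul_subset_left.trans tsupport_mul_subset_left).trans (hcs i)
    rw [hLW _ (chart_mem_atlas _ i) _ hs2]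
    refine (hrf i _ hs1).trans ?_
    refine setIntegral_congr_fun
      (chartAt (EuclideanSpace ℝ (Fin n)) i).open_target.measurableSet fun y hy => ?_
    have hne := hWne _ (chart_mem_atlas _ i) y hy
    have hqy : q i ((chartAt (EuclideanSpace ℝ (Fin n)) i).symm y) =
        r i y / W (chartAt (EuclideanSpace ℝ (Fin n)) i) y := by
      simp only [q, (chartAt (EuclideanSpace ℝ (Fin n)) i).right_inv hy]
    change ((c i : M → 𝕂) _ * (f : M → 𝕂) _) * r i y =
      (((c i : M → 𝕂) _ * q i _) * (f : M → 𝕂) _) * W _ y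
    rw [hqy]
    field_simp
  · refine Subtype.ext (funext fun x => ?_)
    obtain ⟨i, hi⟩ := χ.exists_pos_of_mem (Set.mem_univ x)
    have hxs : x ∈ (chartAt (EuclideanSpace ℝ (Fin n)) i).source :=
      hχ i (subset_tsupport _ hi.ne')
    let k : SmoothFn n 𝕂 M := ⟨fun x => (starRingEnd 𝕂) ((g : M → 𝕂) x),
      contDiff_conj.contMDiff.comp g.2⟩
    have h0 : ρ₀.integral (g * (c i * k)) = 0 := by
      rw [← Density.smul_integral, hg]
      rfl
    have hs : tsupport ((g * (c i * k) : SmoothFn n 𝕂 M) : M → 𝕂) ⊆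
        (chartAt (EuclideanSpace ℝ (Fin n)) i).source :=
      (tsupport_mul_subset_right.trans tsupport_mul_subset_left).trans (hcs i)
    have hL := hLW _ (chart_mem_atlas _ i) _ hs
    rw [← hρ₀, h0] at hL
    let F : EuclideanSpace ℝ (Fin n) → ℝ := fun y =>
      χ i ((chartAt (EuclideanSpace ℝ (Fin n)) i).symm y) *
        ‖(g : M → 𝕂) ((chartAt (EuclideanSpace ℝ (Fin n)) i).symm y)‖ ^ 2 *
          w (chartAt (EuclideanSpace ℝ (Fin n)) i) y
    have hFe : ∀ y, ((g * (c i * k) : SmoothFn n 𝕂 M) : M → 𝕂)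
        ((chartAt (EuclideanSpace ℝ (Fin n)) i).symm y) *
          W (chartAt (EuclideanSpace ℝ (Fin n)) i) y = ((F y : ℝ) : 𝕂) := by
      intro y
      simp only [F, RCLike.ofReal_mul, ← hWw, RCLike.ofReal_pow]
      rw [← RCLike.mul_conj]
      change ((g : M → 𝕂) _ * (((χ i _ : ℝ) : 𝕂) * (starRingEnd 𝕂) ((g : M → 𝕂) _))) * _ = _
      ring
    simp only [hFe] at hL
    rw [integral_ofReal] at hL
    have hL' : ∫ y in (chartAt (EuclideanSpace ℝ (Fin n)) i).target, F y = 0 := by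
      exact_mod_cast hL.symm
    have hcont : ContinuousOn F (chartAt (EuclideanSpace ℝ (Fin n)) i).target := by
      have hre : F = fun y => RCLike.re (((g * (c i * k) : SmoothFn n 𝕂 M) : M → 𝕂)
          ((chartAt (EuclideanSpace ℝ (Fin n)) i).symm y) *
          W (chartAt (EuclideanSpace ℝ (Fin n)) i) y) := by
        funext y; rw [hFe, RCLike.ofReal_re]
      rw [hre]
      refine RCLike.continuous_re.comp_continuousOn (ContinuousOn.mul ?_
        (hW _ (chart_mem_atlas _ i)).continuousOn)
      exact (ContMDiff.continuous (g * (c i * k)).2).comp_continuousOn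
        (chartAt (EuclideanSpace ℝ (Fin n)) i).continuousOn_symm
    have hnn : ∀ y ∈ (chartAt (EuclideanSpace ℝ (Fin n)) i).target, 0 ≤ F y := fun y hy =>
      mul_nonneg (mul_nonneg (χ.nonneg i _) (sq_nonneg _))
        (hwpos _ (chart_mem_atlas _ i) y hy).le
    have hFint : IntegrableOn F (chartAt (EuclideanSpace ℝ (Fin n)) i).target := by
      have h4 := integrableOn_chart _ _ hs (hW _ (chart_mem_atlas _ i)).continuousOn
      simp only [hFe] at h4
      have h5 := h4.re
      simp only [RCLike.ofReal_re] at h5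
      exact h5
    have hae := (setIntegral_eq_zero_iff_of_nonneg_ae
      ((ae_restrict_iff' (chartAt (EuclideanSpace ℝ (Fin n)) i).open_target.measurableSet).2
        (Filter.Eventually.of_forall hnn)) hFint).1 hL'
    have hzero : Set.EqOn F 0 (chartAt (EuclideanSpace ℝ (Fin n)) i).target :=
      Measure.eqOn_open_of_ae_eq hae (chartAt (EuclideanSpace ℝ (Fin n)) i).open_target
        hcont continuousOn_const
    have hFx := hzero ((chartAt (EuclideanSpace ℝ (Fin n)) i).map_source hxs)
    simp only [F, (chartAt (EuclideanSpace ℝ (Fin n)) i).left_inv hxs, Pi.zero_apply] at hFx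
    have hw' := (hwpos _ (chart_mem_atlas _ i) _
      ((chartAt (EuclideanSpace ℝ (Fin n)) i).map_source hxs)).ne'
    have h3 : ‖(g : M → 𝕂) x‖ ^ 2 = 0 := by
      rcases mul_eq_zero.1 hFx with h | h
      · exact (mul_eq_zero.1 h).resolve_left hi.ne'
      · exact absurd h hw'
    change (g : M → 𝕂) x = 0
    exact norm_eq_zero.1 (pow_eq_zero_iff two_ne_zero |>.1 h3)
  · refine ⟨∑ i ∈ J, ∫ y in (chartAt (EuclideanSpace ℝ (Fin n)) i).target,
      ‖(c i : M → 𝕂) ((chartAt (EuclideanSpace ℝ (Fin n)) i).symm y)‖, fun f => ?_⟩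
    rw [hρ₀, Finset.sum_mul]
    refine (norm_sum_le _ _).trans (Finset.sum_le_sum fun i _ => ?_)
    rw [← integral_mul_const]
    refine norm_integral_le_of_norm_le ?_ (Filter.Eventually.of_forall fun y => ?_)
    · have := hint i 1
      rw [mul_one] at this
      exact this.norm.mul_const _
    · change ‖(c i : M → 𝕂) _ * (f : M → 𝕂) _‖ ≤ _
      rw [norm_mul]
      exact mul_le_mul_of_nonneg_left ((toContinuous f).norm_coe_le_norm _) (norm_nonneg _)

end Densities

section LinearMaps

variable {R X Y Z ι : Type*} [CommSemiring R] [AddCommMonoid X] [AddCommMonoid Y]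
  [AddCommMonoid Z] [Module R X] [Module R Y] [Module R Z]

theorem linearMap_comp_sum (g : Y →ₗ[R] Z) (s : Finset ι) (f : ι → X →ₗ[R] Y) :
    g ∘ₗ (∑ i ∈ s, f i) = ∑ i ∈ s, g ∘ₗ f i := by
  ext x
  simp

theorem linearMap_sum_comp (g : X →ₗ[R] Y) (s : Finset ι) (f : ι → Y →ₗ[R] Z) :
    (∑ i ∈ s, f i) ∘ₗ g = ∑ i ∈ s, f i ∘ₗ g := by
  ext x
  simp

end LinearMaps

section GradedModules

variable (n : ℕ) (𝕂 M : Type*) [RCLike 𝕂] [TopologicalSpace M]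
  [ChartedSpace (EuclideanSpace ℝ (Fin n)) M]

/-- A `ℤ`-graded module over `C^∞(M, 𝕂)`, bounded in degree, such as the sections of a graded
vector bundle. The grading is given by the projections onto the homogeneous components. -/
structure GradedModule where
  carrier : Type*
  [addCommGroup : AddCommGroup carrier]
  [moduleK : Module 𝕂 carrier]
  [module : Module (SmoothFn n 𝕂 M) carrier]
  [isScalarTower : IsScalarTower 𝕂 (SmoothFn n 𝕂 M) carrier]
  proj : ℤ → carrier →ₗ[SmoothFn n 𝕂 M] carrier
  proj_comp : ∀ i j, proj i ∘ₗ proj j = if i = j then proj i else 0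
  bounded : ∃ J : Finset ℤ, ∑ i ∈ J, proj i = LinearMap.id

attribute [instance] GradedModule.addCommGroup GradedModule.moduleK GradedModule.module
  GradedModule.isScalarTower

variable {n 𝕂 M}

instance : CoeSort (GradedModule n 𝕂 M) (Type _) := ⟨GradedModule.carrier⟩

namespace GradedModule

variable (X Y : GradedModule n 𝕂 M)

/-- The component of degree `i`. -/
def deg (i : ℤ) : Submodule (SmoothFn n 𝕂 M) X := LinearMap.range (X.proj i)

open Classical in
/-- The projection onto the sum of the components whose degree satisfies `q`. -/
noncomputable def part (q : ℤ → Prop) : X →ₗ[SmoothFn n 𝕂 M] X :=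
  ∑ᶠ i : ℤ, if q i then X.proj i else 0

/-- The even part. -/
noncomputable def evenPart : X →ₗ[SmoothFn n 𝕂 M] X := X.part Even

/-- The odd part. -/
noncomputable def oddPart : X →ₗ[SmoothFn n 𝕂 M] X := X.part Odd

/-- The parity operator `x ↦ (-1)^|x| x`. -/
noncomputable def parity : X →ₗ[SmoothFn n 𝕂 M] X := X.evenPart - X.oddPart

/-- The operator `x ↦ (-1)^(k |x|) x`. -/
noncomputable def koszul (k : ℤ) : X →ₗ[SmoothFn n 𝕂 M] X :=
  X.evenPart + (k.negOnePow : ℤ) • X.oddPart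

/-- The suspension `Σ^k X`, with `(Σ^k X)^i = X^{i+k}`. -/
def shift (k : ℤ) : GradedModule n 𝕂 M where
  carrier := X
  proj i := X.proj (i + k)
  proj_comp i j := by
    rw [X.proj_comp]
    simp
  bounded := by
    obtain ⟨J, hJ⟩ := X.bounded
    refine ⟨J.map (Equiv.subRight k).toEmbedding, ?_⟩
    rw [← hJ, Finset.sum_map]
    simp

theorem proj_eq_zero {J : Finset ℤ} (hJ : ∑ i ∈ J, X.proj i = LinearMap.id) {i : ℤ}
    (hi : i ∉ J) : X.proj i = 0 := by
  have h : X.proj i ∘ₗ (∑ j ∈ J, X.proj j) = X.proj i := by rw [hJ, LinearMap.comp_id]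
  rw [← h, linearMap_comp_sum]
  refine Finset.sum_eq_zero fun j hj => ?_
  rw [X.proj_comp, if_neg]
  rintro rfl
  exact hi hj

theorem sum_proj {J J' : Finset ℤ} (hJ : ∑ i ∈ J, X.proj i = LinearMap.id) (h : J ⊆ J') :
    ∑ i ∈ J', X.proj i = LinearMap.id := by
  rw [← hJ]
  exact (Finset.sum_subset h fun i _ hi => X.proj_eq_zero hJ hi).symm

/-- The direct sum. -/
def prod : GradedModule n 𝕂 M where
  carrier := X × Y
  proj i := (X.proj i).prodMap (Y.proj i)
  proj_comp i j := by
    have h : (X.proj i).prodMap (Y.proj i) ∘ₗ (X.proj j).prodMap (Y.proj j) =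
        (X.proj i ∘ₗ X.proj j).prodMap (Y.proj i ∘ₗ Y.proj j) := rfl
    rw [h, X.proj_comp, Y.proj_comp]
    split_ifs
    · rfl
    · exact LinearMap.prodMap_zero
  bounded := by
    obtain ⟨J, hJ⟩ := X.bounded
    obtain ⟨J', hJ'⟩ := Y.bounded
    refine ⟨J ∪ J', ?_⟩
    have h1 := X.sum_proj hJ (Finset.subset_union_left (s₂ := J'))
    have h2 := Y.sum_proj hJ' (Finset.subset_union_right (s₁ := J))
    refine LinearMap.ext fun x => ?_
    rw [LinearMap.sum_apply]
    refine Prod.ext ?_ ?_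
    · rw [Prod.fst_sum]
      have := LinearMap.congr_fun h1 x.1
      rwa [LinearMap.sum_apply] at this
    · rw [Prod.snd_sum]
      have := LinearMap.congr_fun h2 x.2
      rwa [LinearMap.sum_apply] at this

theorem exists_part : ∃ J : Finset ℤ, ∑ i ∈ J, X.proj i = LinearMap.id ∧
    ∀ q : ℤ → Prop, ∀ _ : DecidablePred q,
      X.part q = ∑ i ∈ J, if q i then X.proj i else 0 := by
  obtain ⟨J, hJ⟩ := X.bounded
  refine ⟨J, hJ, fun q _ => ?_⟩
  rw [part, finsum_eq_sum_of_support_subset (s := J)]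
  · refine Finset.sum_congr rfl fun i _ => ?_
    split_ifs <;> rfl
  · intro i hi
    by_contra h
    refine hi ?_
    simp only [X.proj_eq_zero hJ h, ite_self]

theorem part_comp (q q' : ℤ → Prop) : X.part q ∘ₗ X.part q' = X.part fun i => q i ∧ q' i := by
  classical
  obtain ⟨J, hJ, h⟩ := X.exists_part
  rw [h q (Classical.decPred _), h q' (Classical.decPred _), h _ (Classical.decPred _),
    linearMap_comp_sum]
  refine Finset.sum_congr rfl fun j hj => ?_
  by_cases hq' : q' j
  · rw [if_pos hq', linearMap_sum_comp, Finset.sum_eq_single_of_mem j hj]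
    · by_cases hq : q j
      · rw [if_pos hq, if_pos ⟨hq, hq'⟩, X.proj_comp, if_pos rfl]
      · rw [if_neg hq, if_neg (fun h => hq h.1), LinearMap.zero_comp]
    · intro i _ hij
      split_ifs
      · rw [X.proj_comp, if_neg hij]
      · rw [LinearMap.zero_comp]
  · rw [if_neg hq', if_neg (fun h => hq' h.2), LinearMap.comp_zero]

theorem even_add_odd : X.evenPart + X.oddPart = LinearMap.id := by
  classical
  obtain ⟨J, hJ, h⟩ := X.exists_part
  rw [evenPart, oddPart, h _ inferInstance, h _ inferInstance, ← Finset.sum_add_distrib, ← hJ]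
  refine Finset.sum_congr rfl fun i _ => ?_
  rcases Int.even_or_odd i with hi | hi
  · rw [if_pos hi, if_neg (Int.not_odd_iff_even.2 hi), add_zero]
  · rw [if_pos hi, if_neg (Int.not_even_iff_odd.2 hi), zero_add]

theorem part_of_mem_deg (q : ℤ → Prop) [DecidablePred q] {i : ℤ} {x : X} (hx : x ∈ X.deg i) :
    X.part q x = if q i then x else 0 := by
  obtain ⟨J, hJ, h⟩ := X.exists_part
  obtain ⟨y, rfl⟩ := hx
  have hproj : ∀ j, X.proj j (X.proj i y) = if j = i then X.proj i y else 0 := fun j => by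
    have := LinearMap.congr_fun (X.proj_comp j i) y
    rw [LinearMap.comp_apply] at this
    rw [this]
    split_ifs with hji
    · rw [hji]
    · rfl
  rw [h q inferInstance, LinearMap.sum_apply]
  by_cases hi : i ∈ J
  · rw [Finset.sum_eq_single_of_mem i hi]
    · split_ifs
      · rw [hproj, if_pos rfl]
      · rfl
    · intro j _ hji
      split_ifs
      · rw [hproj, if_neg hji]
      · rfl
  · have h0 : X.proj i = 0 := X.proj_eq_zero hJ hi
    have h1 : X.proj i y = 0 := by rw [h0]; rfl
    rw [h1, ite_self]
    exact Finset.sum_eq_zero fun j _ => map_zero _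

theorem koszul_of_mem_deg (k : ℤ) {i : ℤ} {x : X} (hx : x ∈ X.deg i) :
    X.koszul k x = ((k * i).negOnePow : ℤ) • x := by
  classical
  rw [koszul, LinearMap.add_apply, LinearMap.smul_apply, evenPart, oddPart,
    X.part_of_mem_deg _ hx, X.part_of_mem_deg _ hx]
  rcases Int.even_or_odd i with hi | hi
  · rw [if_pos hi, if_neg (Int.not_odd_iff_even.2 hi), Int.negOnePow_even _ (hi.mul_left k)]
    simp
  · rw [if_pos hi, if_neg (Int.not_even_iff_odd.2 hi), zero_add]
    rcases Int.even_or_odd k with hk | hk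
    · rw [Int.negOnePow_even _ (hk.mul_right i), Int.negOnePow_even _ hk]
    · rw [Int.negOnePow_odd _ (hk.mul hi), Int.negOnePow_odd _ hk]

end GradedModule

end GradedModules

section Duals

variable {n : ℕ} {𝕂 M : Type*} [RCLike 𝕂] [TopologicalSpace M]
  [ChartedSpace (EuclideanSpace ℝ (Fin n)) M] [CompactSpace M] [IsManifold (𝓡 n) ∞ M]

/-- The sections of `W^! = Hom(W, Den_M ⊗ 𝕂)`, i.e. the `C^∞(M, 𝕂)`-linear maps from the sections
of `W` to the smooth densities. The component of degree `i` consists of the maps that vanish on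
all components of `W` but that of degree `-i`. -/
noncomputable def GradedModule.dual (W : GradedModule n 𝕂 M) : GradedModule n 𝕂 M where
  carrier := W →ₗ[SmoothFn n 𝕂 M] Density n 𝕂 M
  proj i := (LinearMap.lcomp (SmoothFn n 𝕂 M) (Density n 𝕂 M) (W.proj (-i)))
  proj_comp i j := by
    refine LinearMap.ext fun ψ => ?_
    have h : (ψ ∘ₗ W.proj (-j)) ∘ₗ W.proj (-i) = ψ ∘ₗ (W.proj (-j) ∘ₗ W.proj (-i)) := rfl
    refine h.trans ?_
    rw [W.proj_comp]
    by_cases hij : i = j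
    · subst hij
      rw [if_pos rfl, if_pos rfl]
      rfl
    · rw [if_neg (fun h => hij (neg_injective h).symm), if_neg hij, LinearMap.comp_zero]
      rfl
  bounded := by
    obtain ⟨J, hJ⟩ := W.bounded
    refine ⟨J.map (Equiv.neg ℤ).toEmbedding, LinearMap.ext fun ψ => ?_⟩
    rw [Finset.sum_map, LinearMap.sum_apply]
    have h : ∀ i ∈ J, (LinearMap.lcomp (SmoothFn n 𝕂 M) (Density n 𝕂 M)
        (W.proj (-((Equiv.neg ℤ).toEmbedding i)))) ψ = ψ ∘ₗ W.proj i := fun i _ => by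
      simp [LinearMap.lcomp_apply']
    rw [Finset.sum_congr rfl h, ← linearMap_comp_sum, hJ, LinearMap.comp_id]
    rfl

end Duals

section Bundles

/-- A `ℤ`-graded smooth `𝕂`-vector bundle (of finite rank) over `M`: a smooth vector bundle whose
fibres are `𝕂`-vector spaces, with `𝕂`-linear trivializations, and which is the direct sum of
subbundles `E^i`, finitely many of them nonzero; the decomposition is recorded by the projections
onto the `E^i`. -/
structure GradedBundle (n : ℕ) (𝕂 M : Type*) [RCLike 𝕂] [TopologicalSpace M]
    [ChartedSpace (EuclideanSpace ℝ (Fin n)) M] where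
  F : Type*
  E : M → Type*
  [normedAddCommGroup : NormedAddCommGroup F]
  [normedSpaceReal : NormedSpace ℝ F]
  [normedSpace : NormedSpace 𝕂 F]
  [scalarTower : IsScalarTower ℝ 𝕂 F]
  [finiteDimensional : FiniteDimensional 𝕂 F]
  [fibreAddCommGroup : ∀ x, AddCommGroup (E x)]
  [fibreModuleReal : ∀ x, Module ℝ (E x)]
  [fibreModule : ∀ x, Module 𝕂 (E x)]
  [fibreScalarTower : ∀ x, IsScalarTower ℝ 𝕂 (E x)]
  [fibreTopology : ∀ x, TopologicalSpace (E x)]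
  [totalTopology : TopologicalSpace (TotalSpace F E)]
  [fiberBundle : FiberBundle F E]
  [vectorBundleReal : VectorBundle ℝ F E]
  [vectorBundle : VectorBundle 𝕂 F E]
  [smoothBundle : ContMDiffVectorBundle ∞ F E (𝓡 n)]
  proj : ℤ → ∀ x, E x →ₗ[𝕂] E x
  proj_comp : ∀ i j x, proj i x ∘ₗ proj j x = if i = j then proj i x else 0
  bounded : ∃ J : Finset ℤ, ∀ x, ∑ i ∈ J, proj i x = LinearMap.id
  proj_smooth : ∀ (i : ℤ) (s : ∀ x, E x),
    ContMDiff (𝓡 n) ((𝓡 n).prod 𝓘(ℝ, F)) ∞ (fun x => TotalSpace.mk' F x (s x)) →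
    ContMDiff (𝓡 n) ((𝓡 n).prod 𝓘(ℝ, F)) ∞ (fun x => TotalSpace.mk' F x (proj i x (s x)))

attribute [instance] GradedBundle.normedAddCommGroup GradedBundle.normedSpaceReal
  GradedBundle.normedSpace GradedBundle.scalarTower GradedBundle.finiteDimensional
  GradedBundle.fibreAddCommGroup GradedBundle.fibreModuleReal GradedBundle.fibreModule
  GradedBundle.fibreScalarTower GradedBundle.fibreTopology GradedBundle.totalTopology
  GradedBundle.fiberBundle GradedBundle.vectorBundleReal GradedBundle.vectorBundle
  GradedBundle.smoothBundle

namespace GradedBundle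

variable {n : ℕ} {𝕂 M : Type*} [RCLike 𝕂] [TopologicalSpace M]
  [ChartedSpace (EuclideanSpace ℝ (Fin n)) M] (B : GradedBundle n 𝕂 M)

/-- The smooth sections, as a submodule of the space of all sections. -/
def smoothSections : Submodule (SmoothFn n 𝕂 M) (∀ x, B.E x) where
  carrier := {s | ContMDiff (𝓡 n) ((𝓡 n).prod 𝓘(ℝ, B.F)) ∞ (fun x => TotalSpace.mk' B.F x (s x))}
  add_mem' hs ht := hs.add_section ht
  zero_mem' := contMDiff_zeroSection ℝ B.E
  smul_mem' f s hs := by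
    intro x
    rw [contMDiffAt_section]
    have h1 := (contMDiffAt_section x).1 (hs x)
    have h2 : ContMDiffAt (𝓡 n) 𝓘(ℝ, B.F) ∞
        (fun y => (f : M → 𝕂) y • (trivializationAt B.F B.E x ⟨y, s y⟩).2) x :=
      (contDiff_smul (𝕜 := ℝ) (𝕜' := 𝕂) (F := B.F)).contMDiff.contMDiffAt.comp x
        (ContMDiffAt.prodMk_space (f.2 x) h1)
    refine h2.congr_of_eventuallyEq ?_
    filter_upwards [(trivializationAt B.F B.E x).open_baseSet.mem_nhds
      (mem_baseSet_trivializationAt B.F B.E x)] with y hy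
    exact ((trivializationAt B.F B.E x).linear 𝕂 hy).2 _ _

instance : IsScalarTower 𝕂 (SmoothFn n 𝕂 M) (∀ x, B.E x) :=
  ⟨fun c f s => funext fun x => smul_assoc c ((f : M → 𝕂) x) (s x)⟩

instance : IsScalarTower (SmoothFn n 𝕂 M) (SmoothFn n 𝕂 M) (∀ x, B.E x) :=
  ⟨fun c f s => funext fun x => mul_smul ((c : M → 𝕂) x) ((f : M → 𝕂) x) (s x)⟩

instance : Module (SmoothFn n 𝕂 M) B.smoothSections := Submodule.module' _

instance : Module 𝕂 B.smoothSections := Submodule.module' _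

/-- The graded module `Γ(M, B)` of smooth sections. -/
def sections : GradedModule n 𝕂 M where
  carrier := B.smoothSections
  addCommGroup := Submodule.addCommGroup _
  isScalarTower := ⟨fun c f s => Subtype.ext (smul_assoc c f s.1)⟩
  proj i :=
    { toFun := fun s => ⟨fun x => B.proj i x (s.1 x), B.proj_smooth i s.1 s.2⟩
      map_add' := fun s t => Subtype.ext (funext fun x => map_add (B.proj i x) _ _)
      map_smul' := fun f s => Subtype.ext (funext fun x => map_smul (B.proj i x) _ _) }
  proj_comp i j := by
    refine LinearMap.ext fun s => Subtype.ext (funext fun x => ?_)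
    refine (LinearMap.congr_fun (B.proj_comp i j x) (s.1 x)).trans ?_
    split_ifs <;> rfl
  bounded := by
    obtain ⟨J, hJ⟩ := B.bounded
    refine ⟨J, LinearMap.ext fun s => Subtype.ext (funext fun x => ?_)⟩
    have h := LinearMap.congr_fun (hJ x) (s.1 x)
    rw [LinearMap.sum_apply] at h
    rw [LinearMap.sum_apply, AddSubmonoidClass.coe_finsetSum, Finset.sum_apply]
    exact h

end GradedBundle

end Bundles

section Locality

variable {n : ℕ} {𝕂 M : Type*} [RCLike 𝕂] [TopologicalSpace M]
  [ChartedSpace (EuclideanSpace ℝ (Fin n)) M] [CompactSpace M] [IsManifold (𝓡 n) ∞ M]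

/-- Differential operators `X → C^∞(M, 𝕂)`: the operators generated, under sums and
multiplication by functions, by compositions `Z₁ ∘ ⋯ ∘ Z_k ∘ φ` where `φ` is
`C^∞(M, 𝕂)`-linear (a map of vector bundles) and the `Z_i` are derivatives along vector fields. -/
inductive IsDiffOp (X : GradedModule n 𝕂 M) : (X →ₗ[𝕂] SmoothFn n 𝕂 M) → Prop
  | linear (φ : X →ₗ[SmoothFn n 𝕂 M] SmoothFn n 𝕂 M) : IsDiffOp X (φ.restrictScalars 𝕂)
  | deriv (Z : SmoothField n M) {D : X →ₗ[𝕂] SmoothFn n 𝕂 M} :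
      IsDiffOp X D → IsDiffOp X (fieldDeriv Z ∘ₗ D)
  | smul (f : SmoothFn n 𝕂 M) {D : X →ₗ[𝕂] SmoothFn n 𝕂 M} :
      IsDiffOp X D → IsDiffOp X (LinearMap.mulLeft 𝕂 f ∘ₗ D)
  | add {D D' : X →ₗ[𝕂] SmoothFn n 𝕂 M} : IsDiffOp X D → IsDiffOp X D' → IsDiffOp X (D + D')

/-- The `C^∞`-topology: uniform convergence (on compact sets) of all derivatives. -/
instance (X : GradedModule n 𝕂 M) : TopologicalSpace X :=
  ⨅ D : {D : X →ₗ[𝕂] SmoothFn n 𝕂 M // IsDiffOp X D},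
    TopologicalSpace.induced (fun x => toContinuous (D.1 x)) inferInstance

variable {X Y Z : GradedModule n 𝕂 M}

theorem IsDiffOp.continuous {D : X →ₗ[𝕂] SmoothFn n 𝕂 M} (hD : IsDiffOp X D) :
    Continuous fun x : X => toContinuous (D x) :=
  continuous_iInf_dom (i := ⟨D, hD⟩) continuous_induced_dom

theorem continuous_of_diffOp {T : Type*} [TopologicalSpace T] {F : T → X}
    (h : ∀ D, IsDiffOp X D → Continuous fun t => toContinuous (D (F t))) : Continuous F :=
  continuous_iInf_rng.2 fun D => continuous_induced_rng.2 (h D.1 D.2)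

theorem IsDiffOp.comp_linear {D : Y →ₗ[𝕂] SmoothFn n 𝕂 M} (hD : IsDiffOp Y D)
    (φ : X →ₗ[SmoothFn n 𝕂 M] Y) : IsDiffOp X (D ∘ₗ φ.restrictScalars 𝕂) := by
  induction hD with
  | linear ψ => exact IsDiffOp.linear (ψ ∘ₗ φ)
  | deriv Z _ ih => exact IsDiffOp.deriv Z ih
  | smul f _ ih => exact IsDiffOp.smul f ih
  | add _ _ ih ih' => exact IsDiffOp.add ih ih'

/-- `C^∞(M, 𝕂)`-linear maps are continuous. -/
def toCLM (φ : X →ₗ[SmoothFn n 𝕂 M] Y) : X →L[𝕂] Y where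
  toLinearMap := φ.restrictScalars 𝕂
  cont := continuous_of_diffOp fun _ hD => (hD.comp_linear φ).continuous

/-- A local operator `X^{⊗ l} → Y`: a finite sum of operators
`x₁, …, x_l ↦ (D₁ x₁ ⋯ D_l x_l) s` with differential operators `D_i` and `s ∈ Y`. -/
def IsLocalOperator {l : ℕ} (F : MultilinearMap 𝕂 (fun _ : Fin l => X) Y) : Prop :=
  F ∈ Submodule.span 𝕂 {G : MultilinearMap 𝕂 (fun _ : Fin l => X) Y |
    ∃ (D : Fin l → X →ₗ[𝕂] SmoothFn n 𝕂 M) (s : Y), (∀ i, IsDiffOp X (D i)) ∧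
      ∀ x, G x = (∏ i, D i (x i)) • s}

/-- A local operator `X ⊗ Y → Z`. -/
def IsLocalBilinear (B : X →ₗ[𝕂] Y →ₗ[𝕂] Z) : Prop :=
  B ∈ Submodule.span 𝕂 {G : X →ₗ[𝕂] Y →ₗ[𝕂] Z |
    ∃ (D : X →ₗ[𝕂] SmoothFn n 𝕂 M) (D' : Y →ₗ[𝕂] SmoothFn n 𝕂 M) (s : Z),
      IsDiffOp X D ∧ IsDiffOp Y D' ∧ ∀ x y, G x y = (D x * D' y) • s}

/-- A local operator `X → Y`. -/
def IsLocalLinear (L : X →ₗ[𝕂] Y) : Prop :=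
  L ∈ Submodule.span 𝕂 {G : X →ₗ[𝕂] Y |
    ∃ (D : X →ₗ[𝕂] SmoothFn n 𝕂 M) (s : Y), IsDiffOp X D ∧ ∀ x, G x = D x • s}

/-- The span of the functions `x₁, …, x_l ↦ g D₁ x₁ ⋯ D_l x_l`. -/
def diffProducts (X : GradedModule n 𝕂 M) (l : ℕ) :
    Submodule 𝕂 ((Fin l → X) → SmoothFn n 𝕂 M) :=
  Submodule.span 𝕂 {G | ∃ (D : Fin l → X →ₗ[𝕂] SmoothFn n 𝕂 M) (g : SmoothFn n 𝕂 M),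
    (∀ i, IsDiffOp X (D i)) ∧ ∀ x, G x = g * ∏ i, D i (x i)}

theorem toContinuous_add (f g : SmoothFn n 𝕂 M) :
    toContinuous (f + g) = toContinuous f + toContinuous g := rfl

theorem toContinuous_mul (f g : SmoothFn n 𝕂 M) :
    toContinuous (f * g) = toContinuous f * toContinuous g := rfl

theorem toContinuous_smul (c : 𝕂) (f : SmoothFn n 𝕂 M) :
    toContinuous (c • f) = c • toContinuous f := rfl

theorem toContinuous_prod {ι : Type*} (s : Finset ι) (f : ι → SmoothFn n 𝕂 M) :
    toContinuous (∏ i ∈ s, f i) = ∏ i ∈ s, toContinuous (f i) := by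
  classical
  induction s using Finset.induction_on with
  | empty => rfl
  | insert i s hi ih => rw [Finset.prod_insert hi, Finset.prod_insert hi, toContinuous_mul, ih]

theorem continuous_of_mem_diffProducts {l : ℕ} {G : (Fin l → X) → SmoothFn n 𝕂 M}
    (hG : G ∈ diffProducts X l) : Continuous fun x => toContinuous (G x) := by
  induction hG using Submodule.span_induction with
  | mem G h =>
    obtain ⟨D, g, hD, hG⟩ := h
    simp only [hG, toContinuous_mul, toContinuous_prod]
    exact continuous_const.mul (continuous_finsetProd _ fun i _ =>
      (hD i).continuous.comp (continuous_apply i))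
  | zero => exact continuous_const (y := toContinuous (0 : SmoothFn n 𝕂 M))
  | add G G' _ _ h h' =>
    simp only [Pi.add_apply, toContinuous_add]
    exact h.add h'
  | smul c G _ h =>
    simp only [Pi.smul_apply, toContinuous_smul]
    exact h.const_smul c

theorem fieldDeriv_prod {ι : Type*} [DecidableEq ι] (Z : SmoothField n M) (s : Finset ι)
    (f : ι → SmoothFn n 𝕂 M) :
    fieldDeriv Z (∏ i ∈ s, f i) =
      ∑ i ∈ s, ∏ j ∈ s, if j = i then fieldDeriv Z (f j) else f j := by
  induction s using Finset.induction_on with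
  | empty =>
    rw [Finset.prod_empty, Finset.sum_empty]
    have h := fieldDeriv_mul Z (1 : SmoothFn n 𝕂 M) 1
    simpa using h
  | insert a s ha ih =>
    rw [Finset.prod_insert ha, fieldDeriv_mul, ih, Finset.sum_insert ha, Finset.prod_insert ha,
      if_pos rfl, Finset.mul_sum]
    congr 1
    · congr 1
      refine Finset.prod_congr rfl fun j hj => ?_
      rw [if_neg]
      rintro rfl
      exact ha hj
    · refine Finset.sum_congr rfl fun i hi => ?_
      rw [Finset.prod_insert ha, if_neg]
      rintro rfl
      exact ha hi

theorem fieldDeriv_mem_diffProducts {l : ℕ} (Z : SmoothField n M)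
    {G : (Fin l → X) → SmoothFn n 𝕂 M} (hG : G ∈ diffProducts X l) :
    (fun x => fieldDeriv Z (G x)) ∈ diffProducts X l := by
  classical
  induction hG using Submodule.span_induction with
  | mem G h =>
    obtain ⟨D, g, hD, hG⟩ := h
    have h1 : (fun x => fieldDeriv Z (G x)) =
        (fun x => fieldDeriv Z g * ∏ i, D i (x i)) + ∑ i : Fin l, fun x =>
          g * ∏ j, (if j = i then fieldDeriv Z ∘ₗ D j else D j) (x j) := by
      funext x
      rw [hG, fieldDeriv_mul, fieldDeriv_prod, Pi.add_apply, Finset.sum_apply, Finset.mul_sum]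
      congr 1
      refine Finset.sum_congr rfl fun i _ => congrArg _ (Finset.prod_congr rfl fun j _ => ?_)
      split_ifs <;> rfl
    rw [h1]
    refine add_mem (Submodule.subset_span ⟨D, _, hD, fun x => rfl⟩)
      (sum_mem fun i _ => Submodule.subset_span ⟨_, g, fun j => ?_, fun x => rfl⟩)
    split_ifs
    · exact (hD j).deriv Z
    · exact hD j
  | zero =>
    simp only [Pi.zero_apply, map_zero]
    exact zero_mem _
  | add G G' _ _ h h' =>
    simp only [Pi.add_apply, map_add]
    exact add_mem h h'
  | smul c G _ h =>
    simp only [Pi.smul_apply, map_smul]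
    exact Submodule.smul_mem _ c h

theorem mul_mem_diffProducts {l : ℕ} (f : SmoothFn n 𝕂 M)
    {G : (Fin l → X) → SmoothFn n 𝕂 M} (hG : G ∈ diffProducts X l) :
    (fun x => f * G x) ∈ diffProducts X l := by
  induction hG using Submodule.span_induction with
  | mem G h =>
    obtain ⟨D, g, hD, hG⟩ := h
    exact Submodule.subset_span ⟨D, f * g, hD, fun x => by
      simp only [hG, mul_assoc]⟩
  | zero =>
    simp only [Pi.zero_apply, mul_zero]
    exact zero_mem _
  | add G G' _ _ h h' =>
    simp only [Pi.add_apply, mul_add]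
    exact add_mem h h'
  | smul c G _ h =>
    simp only [Pi.smul_apply, mul_smul_comm]
    exact Submodule.smul_mem _ c h

theorem IsDiffOp.comp_local {l : ℕ} {T : Y →ₗ[𝕂] SmoothFn n 𝕂 M} (hT : IsDiffOp Y T)
    {F : MultilinearMap 𝕂 (fun _ : Fin l => X) Y} (hF : IsLocalOperator F) :
    (fun x => T (F x)) ∈ diffProducts X l := by
  induction hT with
  | linear φ =>
    induction hF using Submodule.span_induction with
    | mem G h =>
      obtain ⟨D, s, hD, hG⟩ := h
      refine Submodule.subset_span ⟨D, φ s, hD, fun x => ?_⟩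
      simp only [hG, LinearMap.restrictScalars_apply, map_smul, smul_eq_mul, mul_comm]
    | zero =>
      simp only [zero_apply, map_zero]
      exact zero_mem _
    | add G G' _ _ h h' =>
      simp only [add_apply, map_add]
      exact add_mem h h'
    | smul c G _ h =>
      simp only [smul_apply, map_smul]
      exact Submodule.smul_mem _ c h
  | deriv Z _ ih => exact fieldDeriv_mem_diffProducts Z ih
  | smul f _ ih => exact mul_mem_diffProducts f ih
  | add _ _ ih ih' => exact add_mem ih ih'

/-- Local operators are continuous. -/
theorem IsLocalOperator.continuous {l : ℕ} {F : MultilinearMap 𝕂 (fun _ : Fin l => X) Y}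
    (hF : IsLocalOperator F) : Continuous F :=
  continuous_of_diffOp fun _ hT => continuous_of_mem_diffProducts (hT.comp_local hF)

/-- A local distribution: a finite sum of distributions
`x₁, …, x_l ↦ ∫_M D₁ x₁ ⋯ D_l x_l dρ` with differential operators `D_i` and densities `ρ`. -/
def IsLocalDistribution {l : ℕ} (F : MultilinearMap 𝕂 (fun _ : Fin l => X) 𝕂) : Prop :=
  F ∈ Submodule.span 𝕂 {G : MultilinearMap 𝕂 (fun _ : Fin l => X) 𝕂 |
    ∃ (D : Fin l → X →ₗ[𝕂] SmoothFn n 𝕂 M) (ρ : Density n 𝕂 M), (∀ i, IsDiffOp X (D i)) ∧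
      ∀ x, G x = ρ.integral (∏ i, D i (x i))}

variable [T2Space M]

theorem Density.bounded (ρ : Density n 𝕂 M) :
    ∃ C : ℝ, ∀ f : SmoothFn n 𝕂 M, ‖ρ.integral f‖ ≤ C * ‖toContinuous f‖ := by
  obtain ⟨ρ₀, h, -, C, hC⟩ := exists_reference_density n 𝕂 M
  obtain ⟨g, rfl⟩ := h ρ
  refine ⟨|C| * ‖toContinuous g‖, fun f => ?_⟩
  rw [Density.smul_integral, mul_assoc]
  refine (hC _).trans ((mul_le_mul_of_nonneg_right (le_abs_self C) (norm_nonneg _)).trans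
    (mul_le_mul_of_nonneg_left ?_ (abs_nonneg C)))
  rw [toContinuous_mul]
  exact norm_mul_le _ _

theorem Density.continuous_integral (ρ : Density n 𝕂 M) {T : Type*} [TopologicalSpace T]
    {G : T → SmoothFn n 𝕂 M} (hG : Continuous fun t => toContinuous (G t)) :
    Continuous fun t => ρ.integral (G t) := by
  obtain ⟨C, hC⟩ := ρ.bounded
  refine continuous_iff_continuousAt.2 fun t₀ => ?_
  refine tendsto_iff_norm_sub_tendsto_zero.2 ?_
  have h0 : Filter.Tendsto (fun t => C * ‖toContinuous (G t) - toContinuous (G t₀)‖) (𝓝 t₀)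
      (𝓝 0) := by
    have := (tendsto_iff_norm_sub_tendsto_zero.1 (hG.tendsto t₀)).const_mul C
    rwa [mul_zero] at this
  refine squeeze_zero (fun _ => norm_nonneg _) (fun t => ?_) h0
  rw [← map_sub]
  exact hC (G t - G t₀)

/-- Local distributions are continuous. -/
theorem IsLocalDistribution.continuous {l : ℕ} {F : MultilinearMap 𝕂 (fun _ : Fin l => X) 𝕂}
    (hF : IsLocalDistribution F) : Continuous F := by
  induction hF using Submodule.span_induction with
  | mem G h =>
    obtain ⟨D, ρ, hD, hG⟩ := h
    have : (G : (Fin l → X) → 𝕂) = fun x => ρ.integral (∏ i, D i (x i)) := funext hG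
    rw [this]
    refine ρ.continuous_integral ?_
    simp only [toContinuous_prod]
    exact continuous_finsetProd _ fun i _ => (hD i).continuous.comp (continuous_apply i)
  | zero => exact continuous_const
  | add G G' _ _ h h' => exact h.add h'
  | smul c G _ h => exact h.const_smul c

end Locality

section Functionals

variable {n : ℕ} {𝕂 M : Type*} [RCLike 𝕂] [TopologicalSpace M]
  [ChartedSpace (EuclideanSpace ℝ (Fin n)) M] [CompactSpace M] [IsManifold (𝓡 n) ∞ M]

/-- Continuous multilinear functionals `X^{⊗ N} → 𝕂`, the elements of `(X^†)^{⊗ N}`. -/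
abbrev Dist (N : ℕ) (X : GradedModule n 𝕂 M) : Type _ :=
  ContinuousMultilinearMap 𝕂 (fun _ : Fin N => X) 𝕂

variable {X Y : GradedModule n 𝕂 M}

/-- For `b = false` the map `(s₀, …, s_m) ↦ f (s_m^even, s₀, …, s_{m-1})`, and for `b = true` the
map `(s₀, …, s_m) ↦ f (s_m^odd, ε s₀, …, ε s_{m-1})`, where `ε x = (-1)^|x| x`. -/
noncomputable def rotatePart (m : ℕ) (b : Bool) : Dist (m + 1) X →ₗ[𝕂] Dist (m + 1) X where
  toFun f := (f.domDomCongr (finRotate (m + 1)).symm).compContinuousLinearMap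
    (Fin.snoc (α := fun _ => X →L[𝕂] X)
      (fun _ => if b then toCLM X.parity else ContinuousLinearMap.id 𝕂 X)
      (toCLM (if b then X.oddPart else X.evenPart)))
  map_add' _ _ := rfl
  map_smul' _ _ := rfl

/-- The generator of the action of the cyclic group on `(X^†)^{⊗ N}`, with the Koszul sign:
`(τ f)(s₀, …, s_m) = (-1)^(|s_m| (|s₀| + ⋯ + |s_{m-1}|)) f (s_m, s₀, …, s_{m-1})`. -/
noncomputable def rotate : ∀ N : ℕ, Dist N X →ₗ[𝕂] Dist N X
  | 0 => LinearMap.id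
  | m + 1 => rotatePart m false + rotatePart m true

theorem rotatePart_apply (m : ℕ) (b : Bool) (f : Dist (m + 1) X) (s : Fin (m + 1) → X) :
    rotatePart m b f s = f (fun i => (Fin.snoc (α := fun _ => X →ₗ[SmoothFn n 𝕂 M] X)
      (fun _ => if b then X.parity else LinearMap.id)
      (if b then X.oddPart else X.evenPart) (i - 1) : X →ₗ[SmoothFn n 𝕂 M] X) (s (i - 1))) := by
  have h : ∀ i : Fin (m + 1), (finRotate (m + 1)).symm i = i - 1 := fun i => by
    rw [Equiv.symm_apply_eq, finRotate_apply, sub_add_cancel]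
  change f (fun i => (Fin.snoc (α := fun _ => X →L[𝕂] X)
      (fun _ => if b then toCLM X.parity else ContinuousLinearMap.id 𝕂 X)
      (toCLM (if b then X.oddPart else X.evenPart)) ((finRotate (m + 1)).symm i) : X →L[𝕂] X)
        (s ((finRotate (m + 1)).symm i))) = _
  congr 1
  funext i
  rw [h i]
  induction i - 1 using Fin.lastCases with
  | last => rw [Fin.snoc_last, Fin.snoc_last]; rfl
  | cast j => rw [Fin.snoc_castSucc, Fin.snoc_castSucc]; cases b <;> rfl

/-- `x` has parity `p`. -/
def HasParity (p : ℤ) (x : X) : Prop := X.oddPart x = if Odd p then x else 0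

theorem HasParity.even {p : ℤ} {x : X} (h : HasParity p x) :
    X.evenPart x = if Odd p then 0 else x := by
  have h1 := LinearMap.congr_fun X.even_add_odd x
  rw [LinearMap.add_apply, h, LinearMap.id_apply] at h1
  split_ifs at h1 ⊢
  · simpa using h1
  · simpa using h1

theorem HasParity.parity {p : ℤ} {x : X} (h : HasParity p x) :
    X.parity x = (p.negOnePow : ℤ) • x := by
  rw [GradedModule.parity, LinearMap.sub_apply, h, h.even]
  rcases Int.even_or_odd p with hp | hp
  · rw [if_neg (Int.not_odd_iff_even.2 hp), if_neg (Int.not_odd_iff_even.2 hp),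
      Int.negOnePow_even _ hp]
    simp
  · rw [if_pos hp, if_pos hp, Int.negOnePow_odd _ hp]
    simp

theorem hasParity_of_mem_deg {p : ℤ} {x : X} (h : x ∈ X.deg p) : HasParity p x :=
  X.part_of_mem_deg Odd h

theorem hasParity_oddPart (x : X) : HasParity 1 (X.oddPart x) := by
  have := LinearMap.congr_fun (X.part_comp Odd Odd) x
  rw [HasParity, if_pos odd_one]
  simp only [and_self] at this
  exact this

theorem hasParity_evenPart (x : X) : HasParity 0 (X.evenPart x) := by
  have h1 := LinearMap.congr_fun X.even_add_odd (X.evenPart x)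
  have h2 := LinearMap.congr_fun (X.part_comp Even Even) x
  simp only [and_self] at h2
  rw [HasParity, if_neg (by simp)]
  rw [LinearMap.add_apply, LinearMap.id_apply] at h1
  have h3 : X.evenPart (X.evenPart x) = X.evenPart x := h2
  rw [h3] at h1
  simpa using h1

theorem negOnePow_sum {ι : Type*} (t : Finset ι) (g : ι → ℤ) :
    (((∑ i ∈ t, g i).negOnePow : ℤ) : 𝕂) = ∏ i ∈ t, (((g i).negOnePow : ℤ) : 𝕂) := by
  classical
  induction t using Finset.induction_on with
  | empty => simp
  | insert a t ha ih =>
    rw [Finset.sum_insert ha, Finset.prod_insert ha, Int.negOnePow_add, ← ih]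
    push_cast
    ring

/-- The formula for the generator of the cyclic action on homogeneous arguments. -/
theorem rotate_apply (m : ℕ) (f : Dist (m + 1) X) (s : Fin (m + 1) → X) (p : Fin (m + 1) → ℤ)
    (h : ∀ i, HasParity (p i) (s i)) :
    rotate (m + 1) f s =
      (((p (Fin.last m) * (∑ i, p i - p (Fin.last m))).negOnePow : ℤ) : 𝕂) *
        f (fun i => s (i - 1)) := by
  have hl : (0 : Fin (m + 1)) - 1 = Fin.last m := by
    rw [sub_eq_iff_eq_add, Fin.last_add_one]
  change rotatePart m false f s + rotatePart m true f s = _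
  rw [rotatePart_apply, rotatePart_apply]
  rcases Int.even_or_odd (p (Fin.last m)) with hp | hp
  · rw [Int.negOnePow_even _ (hp.mul_right _)]
    have h0 := f.map_coord_zero (m := fun i => (Fin.snoc (α := fun _ => X →ₗ[SmoothFn n 𝕂 M] X)
      (fun _ => if true then X.parity else LinearMap.id)
      (if true then X.oddPart else X.evenPart) (i - 1) : X →ₗ[SmoothFn n 𝕂 M] X) (s (i - 1))) 0
      (by
        rw [hl, Fin.snoc_last]
        exact (h _).trans (if_neg (Int.not_odd_iff_even.2 hp)))
    rw [h0, add_zero, Units.val_one, Int.cast_one, one_mul]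
    congr 1
    funext i
    induction i - 1 using Fin.lastCases with
    | last =>
      rw [Fin.snoc_last]
      exact (h _).even.trans (if_neg (Int.not_odd_iff_even.2 hp))
    | cast j => rw [Fin.snoc_castSucc]; rfl
  · have h0 := f.map_coord_zero (m := fun i => (Fin.snoc (α := fun _ => X →ₗ[SmoothFn n 𝕂 M] X)
      (fun _ => if false then X.parity else LinearMap.id)
      (if false then X.oddPart else X.evenPart) (i - 1) : X →ₗ[SmoothFn n 𝕂 M] X) (s (i - 1))) 0
      (by
        rw [hl, Fin.snoc_last]
        exact (h _).even.trans (if_pos hp))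
    have h1 : (fun i => (Fin.snoc (α := fun _ => X →ₗ[SmoothFn n 𝕂 M] X)
        (fun _ => if true then X.parity else LinearMap.id)
        (if true then X.oddPart else X.evenPart) (i - 1) : X →ₗ[SmoothFn n 𝕂 M] X) (s (i - 1))) =
        fun i => (Fin.snoc (α := fun _ => 𝕂) (fun j => (((p j.castSucc).negOnePow : ℤ) : 𝕂)) 1
          (i - 1) : 𝕂) • s (i - 1) := by
      funext i
      induction i - 1 using Fin.lastCases with
      | last =>
        rw [Fin.snoc_last, Fin.snoc_last, one_smul]
        exact (h _).trans (if_pos hp)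
      | cast j =>
        rw [Fin.snoc_castSucc, Fin.snoc_castSucc, Int.cast_smul_eq_zsmul]
        exact (h _).parity
    have h2 : Odd (p (Fin.last m)) := hp
    have h3 : (p (Fin.last m) * (∑ i, p i - p (Fin.last m))).negOnePow =
        (∑ j : Fin m, p j.castSucc).negOnePow := by
      rw [Fin.sum_univ_castSucc, add_sub_cancel_right]
      rcases Int.even_or_odd (∑ j : Fin m, p j.castSucc) with hs | hs
      · rw [Int.negOnePow_even _ hs, Int.negOnePow_even _ (hs.mul_left _)]
      · rw [Int.negOnePow_odd _ hs, Int.negOnePow_odd _ (hp.mul hs)]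
    rw [h0, zero_add, h1, h3, f.map_smul_univ, smul_eq_mul, negOnePow_sum]
    congr 1
    refine ((Equiv.subRight (1 : Fin (m + 1))).prod_comp (fun i => (Fin.snoc (α := fun _ => 𝕂)
      (fun j => (((p j.castSucc).negOnePow : ℤ) : 𝕂)) 1 i : 𝕂))).trans ?_
    rw [Fin.prod_univ_castSucc]
    simp

theorem finOfNat_succ (m k : ℕ) : Fin.ofNat (m + 1) (k + 1) = Fin.ofNat (m + 1) k + 1 :=
  Fin.ext (by simp [Fin.ofNat, Fin.val_add])

theorem rotate_pow_apply (m : ℕ) (f : Dist (m + 1) X) (k : ℕ) (s : Fin (m + 1) → X)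
    (p : Fin (m + 1) → ℤ) (h : ∀ i, HasParity (p i) (s i)) :
    (rotate (m + 1) ^ k) f s =
      (((∑ j ∈ Finset.range k, p (Fin.last m - Fin.ofNat (m + 1) j) *
        (∑ i, p i - p (Fin.last m - Fin.ofNat (m + 1) j))).negOnePow : ℤ) : 𝕂) *
        f (fun i => s (i - Fin.ofNat (m + 1) k)) := by
  have h0 : Fin.ofNat (m + 1) 0 = 0 := rfl
  induction k generalizing s p with
  | zero => simp
  | succ k ih =>
    have hP : ∑ i, p (i - 1) = ∑ i, p i := (Equiv.subRight (1 : Fin (m + 1))).sum_comp p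
    have hj : ∀ (a : Fin (m + 1)) (j : ℕ),
        a - Fin.ofNat (m + 1) j - 1 = a - Fin.ofNat (m + 1) (j + 1) := fun a j => by
      rw [finOfNat_succ, sub_sub]
    rw [pow_succ', Module.End.mul_apply, rotate_apply m _ s p h,
      ih (fun i => s (i - 1)) (fun i => p (i - 1)) (fun i => h _), hP,
      Finset.sum_range_succ', Int.negOnePow_add]
    simp only [hj, h0, sub_zero]
    push_cast
    ring

theorem Dist.ext_of_hasParity {N : ℕ} {f g : Dist N X}
    (h : ∀ (s : Fin N → X) (p : Fin N → ℤ), (∀ i, HasParity (p i) (s i)) → f s = g s) :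
    f = g := by
  classical
  refine ContinuousMultilinearMap.ext fun s => ?_
  have hs : s = (fun i => X.evenPart (s i)) + fun i => X.oddPart (s i) := by
    funext i
    exact (LinearMap.congr_fun X.even_add_odd (s i)).symm
  rw [hs, f.map_add_univ, g.map_add_univ]
  refine Finset.sum_congr rfl fun t _ => h _ (fun i => if i ∈ t then 0 else 1) fun i => ?_
  by_cases hi : i ∈ t
  · rw [if_pos hi, Finset.piecewise_eq_of_mem _ _ _ hi]
    exact hasParity_evenPart _
  · rw [if_neg hi, Finset.piecewise_eq_of_notMem _ _ _ hi]
    exact hasParity_oddPart _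

theorem rotate_pow_self (m : ℕ) : (rotate (X := X) (m + 1)) ^ (m + 1) = 1 := by
  refine LinearMap.ext fun f => Dist.ext_of_hasParity fun s p h => ?_
  rw [rotate_pow_apply m f (m + 1) s p h, Finset.sum_range]
  have h1 : Fin.ofNat (m + 1) (m + 1) = 0 := Fin.ext (by simp [Fin.ofNat])
  have h2 : ∑ j : Fin (m + 1), p (Fin.last m - Fin.ofNat (m + 1) j) *
      (∑ i, p i - p (Fin.last m - Fin.ofNat (m + 1) j)) = ∑ j, p j * (∑ i, p i - p j) := by
    have h4 : ∀ j : Fin (m + 1), Fin.ofNat (m + 1) j = j := fun j =>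
      Fin.ext (Nat.mod_eq_of_lt j.2)
    simp only [h4]
    exact (Equiv.subLeft (Fin.last m)).sum_comp fun j => p j * (∑ i, p i - p j)
  have h3 : Even (∑ j, p j * (∑ i, p i - p j)) := by
    simp only [mul_sub, Finset.sum_sub_distrib, ← Finset.sum_mul]
    have h4 : ∀ a : ℤ, Even (a * a - a) := fun a => by
      rw [← mul_sub_one]
      exact Int.even_mul_pred_self a
    have h5 : Even (∑ j, p j * p j - ∑ j, p j) := by
      rw [← Finset.sum_sub_distrib]
      exact Finset.even_sum _ fun j _ => h4 _
    have h6 := (h4 (∑ i, p i)).sub h5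
    rwa [sub_sub_sub_cancel_right] at h6
  rw [h1, h2, Int.negOnePow_even _ h3]
  simp

/-- The space `((X^†)^{⊗ N})_cyc` of coinvariants of the cyclic group. -/
abbrev Ham (N : ℕ) (X : GradedModule n 𝕂 M) : Type _ :=
  Dist N X ⧸ LinearMap.range (LinearMap.id - rotate (X := X) N)

/-- The class of a functional. -/
noncomputable def Ham.mk {N : ℕ} : Dist N X →ₗ[𝕂] Ham N X := Submodule.mkQ _

/-- The cyclic sum `f ↦ ∑_k τ^k f`, which is defined on coinvariants. -/
noncomputable def cycSum (m : ℕ) : Ham (m + 1) X →ₗ[𝕂] Dist (m + 1) X :=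
  Submodule.liftQ _ (∑ k ∈ Finset.range (m + 1), rotate (m + 1) ^ k) (by
    rintro _ ⟨f, rfl⟩
    have h := mul_neg_geom_sum (rotate (X := X) (m + 1)) (m + 1)
    rw [rotate_pow_self, sub_self] at h
    have hc := (Commute.sum_right (Finset.range (m + 1)) (fun k => rotate (X := X) (m + 1) ^ k)
      (1 - rotate (m + 1)) fun k _ => ((Commute.one_left _).sub_left (Commute.self_pow _ _)))
    rw [hc.eq] at h
    exact LinearMap.congr_fun h f)

variable (X) in
/-- The (cyclic) Hamiltonians, i.e. noncommutative functionals, `∏_N ((X^†)^{⊗ N})_cyc`. -/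
abbrev KontHam : Type _ := ∀ N : ℕ, Ham N X

variable (X) in
/-- The noncommutative vector fields `∏_N Hom(X^{⊗ N}, X)`. -/
abbrev VectorField : Type _ := ∀ N : ℕ, ContinuousMultilinearMap 𝕂 (fun _ : Fin N => X) X

theorem snoc_update_left {m k : ℕ} (s : Fin (m + k) → X) (i : Fin m) (x : X) (φ : X → X)
    (Y : (Fin k → X) → X) :
    (Fin.snoc (α := fun _ => X)
      (fun a : Fin m => φ (Function.update s (Fin.castAdd k i) x (Fin.castAdd k a)))
      (Y fun b => Function.update s (Fin.castAdd k i) x (Fin.natAdd m b)) : Fin (m + 1) → X) =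
    Function.update (Fin.snoc (α := fun _ => X) (fun a : Fin m => φ (s (Fin.castAdd k a)))
      (Y fun b => s (Fin.natAdd m b)) : Fin (m + 1) → X) i.castSucc (φ x) := by
  rw [← Fin.snoc_update]
  have h1 : (fun a : Fin m => φ (Function.update s (Fin.castAdd k i) x (Fin.castAdd k a))) =
      Function.update (fun a : Fin m => φ (s (Fin.castAdd k a))) i (φ x) := by
    funext a
    rcases eq_or_ne a i with rfl | h
    · rw [Function.update_self, Function.update_self]
    · rw [Function.update_of_ne h, Function.update_of_ne]
      exact fun h' => h (Fin.castAdd_injective m k h')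
  have h2 : (fun b => Function.update s (Fin.castAdd k i) x (Fin.natAdd m b)) =
      fun b => s (Fin.natAdd m b) := by
    funext b
    rw [Function.update_of_ne]
    intro h
    have := congrArg Fin.val h
    simp only [Fin.val_natAdd, Fin.val_castAdd] at this
    omega
  rw [h1, h2]

theorem snoc_update_right {m k : ℕ} (s : Fin (m + k) → X) (i : Fin k) (x : X) (φ : X → X)
    (Y : (Fin k → X) → X) :
    (Fin.snoc (α := fun _ => X)
      (fun a : Fin m => φ (Function.update s (Fin.natAdd m i) x (Fin.castAdd k a)))
      (Y fun b => Function.update s (Fin.natAdd m i) x (Fin.natAdd m b)) : Fin (m + 1) → X) =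
    Function.update (Fin.snoc (α := fun _ => X) (fun a : Fin m => φ (s (Fin.castAdd k a)))
      0 : Fin (m + 1) → X) (Fin.last m)
      (Y (Function.update (fun b => s (Fin.natAdd m b)) i x)) := by
  rw [Fin.update_snoc_last]
  have h1 : (fun a : Fin m => φ (Function.update s (Fin.natAdd m i) x (Fin.castAdd k a))) =
      fun a : Fin m => φ (s (Fin.castAdd k a)) := by
    funext a
    rw [Function.update_of_ne]
    intro h
    have := congrArg Fin.val h
    simp only [Fin.val_natAdd, Fin.val_castAdd] at this
    omega
  have h2 : (fun b => Function.update s (Fin.natAdd m i) x (Fin.natAdd m b)) =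
      Function.update (fun b => s (Fin.natAdd m b)) i x := by
    funext b
    rcases eq_or_ne b i with rfl | h
    · rw [Function.update_self, Function.update_self]
    · rw [Function.update_of_ne h, Function.update_of_ne]
      exact fun h' => h (Fin.natAdd_injective k m h')
  rw [h1, h2]

/-- `insertLast f j Y` is `f ∘ (1^{⊗ m} ⊗ Y)` for `Y` of degree `j`:
`s₁, …, s_{m+k} ↦ (-1)^(j (|s₁| + ⋯ + |s_m|)) f (s₁, …, s_m, Y (s_{m+1}, …, s_{m+k}))`. -/
noncomputable def insertLast {m k N : ℕ} (hN : m + k = N) (f : Dist (m + 1) X) (j : ℤ)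
    (Y : ContinuousMultilinearMap 𝕂 (fun _ : Fin k => X) X) : Dist N X where
  toFun s := f (Fin.snoc (α := fun _ => X)
    (fun i : Fin m => X.koszul j (s (Fin.cast hN (Fin.castAdd k i))))
    (Y fun i => s (Fin.cast hN (Fin.natAdd m i))))
  map_update_add' {dec} s i x y := by
    obtain rfl : dec = instDecidableEqFin N := Subsingleton.elim _ _
    subst hN
    simp only [Fin.cast_eq_self]
    induction i using Fin.addCases with
    | left i =>
      rw [snoc_update_left s i _ (X.koszul j) Y, snoc_update_left s i _ (X.koszul j) Y,
        snoc_update_left s i _ (X.koszul j) Y, map_add, f.map_update_add]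
    | right i =>
      rw [snoc_update_right s i _ (X.koszul j) Y, snoc_update_right s i _ (X.koszul j) Y,
        snoc_update_right s i _ (X.koszul j) Y, Y.map_update_add, f.map_update_add]
  map_update_smul' {dec} s i c x := by
    obtain rfl : dec = instDecidableEqFin N := Subsingleton.elim _ _
    subst hN
    simp only [Fin.cast_eq_self]
    induction i using Fin.addCases with
    | left i =>
      rw [snoc_update_left s i _ (X.koszul j) Y, snoc_update_left s i _ (X.koszul j) Y,
        LinearMap.map_smul_of_tower, f.map_update_smul]
    | right i =>
      rw [snoc_update_right s i _ (X.koszul j) Y, snoc_update_right s i _ (X.koszul j) Y,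
        Y.map_update_smul, f.map_update_smul]
  cont := by
    have h : Continuous fun s : Fin N → X => (Fin.snoc (α := fun _ => X)
        (fun i : Fin m => X.koszul j (s (Fin.cast hN (Fin.castAdd k i))))
        (Y fun i => s (Fin.cast hN (Fin.natAdd m i))) : Fin (m + 1) → X) := by
      refine Continuous.finSnoc ?_ ?_
      · exact continuous_pi fun i => (toCLM (X.koszul j)).continuous.comp (continuous_apply _)
      · exact Y.cont.comp (continuous_pi fun i => continuous_apply _)
    exact f.cont.comp h

/-- The action of a vector field `Y` of degree `j` on Hamiltonians,
`Y h = ∑_{l ≥ 1, k} (cycsum h_l) ∘ (1^{⊗ (l-1)} ⊗ Y_k)`. -/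
noncomputable def act (j : ℤ) (Y : VectorField X) (h : KontHam X) : KontHam X := fun N =>
  ∑ a ∈ (Finset.HasAntidiagonal.antidiagonal N).attach,
    Ham.mk (insertLast (Finset.HasAntidiagonal.mem_antidiagonal.1 a.2) (cycSum a.1.1 (h (a.1.1 + 1))) j (Y a.1.2))

end Functionals

section Classes

variable {n : ℕ} {𝕂 M : Type*} [RCLike 𝕂] [TopologicalSpace M]
  [ChartedSpace (EuclideanSpace ℝ (Fin n)) M] [CompactSpace M] [IsManifold (𝓡 n) ∞ M]

variable {X Y Z : GradedModule n 𝕂 M}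

/-- The functional on `X` induced by a functional on `Y` and a map of graded modules `X → Y`. -/
noncomputable def Dist.pullback {N : ℕ} (φ : X →ₗ[SmoothFn n 𝕂 M] Y) : Dist N Y →ₗ[𝕂] Dist N X where
  toFun f := f.compContinuousLinearMap fun _ => toCLM φ
  map_add' _ _ := rfl
  map_smul' _ _ := rfl

theorem map_part {φ : X →ₗ[SmoothFn n 𝕂 M] Y} (hφ : ∀ i x, φ (X.proj i x) = Y.proj i (φ x))
    (q : ℤ → Prop) (x : X) : φ (X.part q x) = Y.part q (φ x) := by
  classical
  obtain ⟨J, hJ, h⟩ := X.exists_part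
  obtain ⟨J', hJ', h'⟩ := Y.exists_part
  have e1 : X.part q = ∑ i ∈ J ∪ J', if q i then X.proj i else 0 := by
    rw [h q (Classical.decPred _)]
    refine Finset.sum_subset Finset.subset_union_left fun i _ hi => ?_
    rw [X.proj_eq_zero hJ hi, ite_self]
  have e2 : Y.part q = ∑ i ∈ J ∪ J', if q i then Y.proj i else 0 := by
    rw [h' q (Classical.decPred _)]
    refine Finset.sum_subset Finset.subset_union_right fun i _ hi => ?_
    rw [Y.proj_eq_zero hJ' hi, ite_self]
  rw [e1, e2, LinearMap.sum_apply, LinearMap.sum_apply, map_sum]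
  refine Finset.sum_congr rfl fun i _ => ?_
  split_ifs
  · exact hφ i x
  · exact map_zero φ

theorem HasParity.map {φ : X →ₗ[SmoothFn n 𝕂 M] Y}
    (hφ : ∀ i x, φ (X.proj i x) = Y.proj i (φ x)) {p : ℤ} {x : X} (h : HasParity p x) :
    HasParity p (φ x) := by
  have := map_part hφ Odd x
  rw [HasParity, GradedModule.oddPart, ← this]
  rw [HasParity, GradedModule.oddPart] at h
  rw [h]
  split_ifs
  · rfl
  · exact map_zero φ

theorem rotate_pullback {φ : X →ₗ[SmoothFn n 𝕂 M] Y}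
    (hφ : ∀ i x, φ (X.proj i x) = Y.proj i (φ x)) {N : ℕ} (f : Dist N Y) :
    rotate N (Dist.pullback φ f) = Dist.pullback φ (rotate N f) := by
  cases N with
  | zero => rfl
  | succ m =>
    refine Dist.ext_of_hasParity fun s p h => ?_
    rw [rotate_apply m _ s p h]
    exact (rotate_apply m f (fun i => φ (s i)) p fun i => (h i).map hφ).symm

/-- The Hamiltonian on `X` induced by a Hamiltonian on `Y` and a map of graded modules `X → Y`. -/
noncomputable def KontHam.pullback (φ : X →ₗ[SmoothFn n 𝕂 M] Y)
    (hφ : ∀ i x, φ (X.proj i x) = Y.proj i (φ x)) (h : KontHam Y) : KontHam X := fun N =>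
  Submodule.mapQ _ _ (Dist.pullback φ) (by
    rintro _ ⟨f, rfl⟩
    exact ⟨Dist.pullback φ f, by
      rw [LinearMap.sub_apply, LinearMap.sub_apply, rotate_pullback hφ]
      rfl⟩) (h N)

/-- Local functionals: those represented by local distributions. -/
def IsLocal (h : KontHam X) : Prop :=
  ∀ N, ∃ f : Dist N X, IsLocalDistribution f.toMultilinearMap ∧ Ham.mk f = h N

/-- Functionals of degree zero: those represented by functionals that vanish on all homogeneous
arguments of nonzero total degree. -/
def IsDegreeZero (h : KontHam X) : Prop :=
  ∀ N, ∃ f : Dist N X, (∀ (s : Fin N → X) (d : Fin N → ℤ), (∀ i, s i ∈ X.deg (d i)) →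
    ∑ i, d i ≠ 0 → f s = 0) ∧ Ham.mk f = h N

/-- A linear map as a multilinear map in one variable. -/
def ofLinear (L : X →ₗ[𝕂] Y) : MultilinearMap 𝕂 (fun _ : Fin 1 => X) Y :=
  MultilinearMap.ofSubsingleton 𝕂 X Y 0 L

/-- A bilinear map as a multilinear map in two variables. -/
def ofBilinear (B : X →ₗ[𝕂] X →ₗ[𝕂] Y) : MultilinearMap 𝕂 (fun _ : Fin 2 => X) Y :=
  MultilinearMap.uncurryRight (M := fun _ : Fin 2 => X)
    (MultilinearMap.ofSubsingleton 𝕂 X (X →ₗ[𝕂] Y) 0 B)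

theorem ofLinear_apply (L : X →ₗ[𝕂] Y) (s : Fin 1 → X) : ofLinear L s = L (s 0) := rfl

theorem ofBilinear_apply (B : X →ₗ[𝕂] X →ₗ[𝕂] Y) (s : Fin 2 → X) :
    ofBilinear B s = B (s 0) (s 1) := rfl

theorem IsLocalLinear.ofLinear {L : X →ₗ[𝕂] Y} (h : IsLocalLinear L) :
    IsLocalOperator (ofLinear L) := by
  induction h using Submodule.span_induction with
  | mem L h =>
    obtain ⟨D, s, hD, hL⟩ := h
    refine Submodule.subset_span ⟨fun _ => D, s, fun _ => hD, fun x => ?_⟩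
    rw [ofLinear_apply, hL, Fin.prod_univ_one]
  | zero => exact zero_mem _
  | add L L' _ _ h h' => exact add_mem h h'
  | smul c L _ h => exact Submodule.smul_mem _ c h

theorem IsLocalBilinear.ofBilinear {B : X →ₗ[𝕂] X →ₗ[𝕂] Y} (h : IsLocalBilinear B) :
    IsLocalOperator (ofBilinear B) := by
  induction h using Submodule.span_induction with
  | mem B h =>
    obtain ⟨D, D', s, hD, hD', hB⟩ := h
    refine Submodule.subset_span ⟨![D, D'], s, fun i => ?_, fun x => ?_⟩
    · induction i using Fin.cases with
      | zero => exact hD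
      | succ i =>
        obtain rfl : i = 0 := Subsingleton.elim _ _
        exact hD'
    · rw [ofBilinear_apply, hB, Fin.prod_univ_two]
      rfl
  | zero => exact zero_mem _
  | add L L' _ _ h h' => exact add_mem h h'
  | smul c L _ h => exact Submodule.smul_mem _ c h

theorem IsLocalLinear.comp_linear {X' Y' : GradedModule n 𝕂 M} {L : X →ₗ[𝕂] Y}
    (h : IsLocalLinear L) (φ : X' →ₗ[SmoothFn n 𝕂 M] X) (χ : Y →ₗ[SmoothFn n 𝕂 M] Y') :
    IsLocalLinear (χ.restrictScalars 𝕂 ∘ₗ L ∘ₗ φ.restrictScalars 𝕂) := by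
  induction h using Submodule.span_induction with
  | mem L h =>
    obtain ⟨D, s, hD, hL⟩ := h
    refine Submodule.subset_span ⟨_, χ s, hD.comp_linear φ, fun x => ?_⟩
    simp [hL]
  | zero =>
    rw [LinearMap.zero_comp, LinearMap.comp_zero]
    exact zero_mem _
  | add L L' _ _ h h' =>
    rw [LinearMap.add_comp, LinearMap.comp_add]
    exact add_mem h h'
  | smul c L _ h =>
    rw [LinearMap.smul_comp, LinearMap.comp_smul]
    exact Submodule.smul_mem _ c h

theorem IsLocalBilinear.add {B B' : X →ₗ[𝕂] Y →ₗ[𝕂] Z} (h : IsLocalBilinear B)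
    (h' : IsLocalBilinear B') : IsLocalBilinear (B + B') := add_mem h h'

theorem IsLocalBilinear.smul {B : X →ₗ[𝕂] Y →ₗ[𝕂] Z} (c : 𝕂) (h : IsLocalBilinear B) :
    IsLocalBilinear (c • B) := Submodule.smul_mem _ c h

theorem IsLocalBilinear.zero : IsLocalBilinear (0 : X →ₗ[𝕂] Y →ₗ[𝕂] Z) := zero_mem _

theorem IsLocalBilinear.comp_linear {X' Y' Z' : GradedModule n 𝕂 M} {B : X →ₗ[𝕂] Y →ₗ[𝕂] Z}
    (h : IsLocalBilinear B) (φ : X' →ₗ[SmoothFn n 𝕂 M] X) (ψ : Y' →ₗ[SmoothFn n 𝕂 M] Y)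
    (χ : Z →ₗ[SmoothFn n 𝕂 M] Z') :
    IsLocalBilinear ((B.compl₁₂ (φ.restrictScalars 𝕂) (ψ.restrictScalars 𝕂)).compr₂
      (χ.restrictScalars 𝕂)) := by
  induction h using Submodule.span_induction with
  | mem L h =>
    obtain ⟨D, D', s, hD, hD', hL⟩ := h
    refine Submodule.subset_span
      ⟨_, _, χ s, hD.comp_linear φ, hD'.comp_linear ψ, fun x y => ?_⟩
    simp [hL]
  | zero =>
    convert IsLocalBilinear.zero (X := X') (Y := Y') (Z := Z')
    ext x y
    simp
  | add L L' _ _ h h' =>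
    convert IsLocalBilinear.add h h'
    ext x y
    simp
  | smul c L _ h =>
    convert IsLocalBilinear.smul c h
    ext x y
    simp

theorem IsLocalBilinear.left {B : X →ₗ[𝕂] Y →ₗ[𝕂] Z} (h : IsLocalBilinear B) (x : X) :
    IsLocalLinear (B x) := by
  induction h using Submodule.span_induction with
  | mem L h =>
    obtain ⟨D, D', s, hD, hD', hL⟩ := h
    refine Submodule.subset_span ⟨D', D x • s, hD', fun y => ?_⟩
    rw [hL, smul_smul, mul_comm]
  | zero => exact zero_mem _
  | add L L' _ _ h h' => exact add_mem h h'
  | smul c L _ h => exact Submodule.smul_mem _ c h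

theorem IsLocalBilinear.right {B : X →ₗ[𝕂] Y →ₗ[𝕂] Z} (h : IsLocalBilinear B) (y : Y) :
    IsLocalLinear (B.flip y) := by
  induction h using Submodule.span_induction with
  | mem L h =>
    obtain ⟨D, D', s, hD, hD', hL⟩ := h
    refine Submodule.subset_span ⟨D, D' y • s, hD, fun x => ?_⟩
    rw [LinearMap.flip_apply, hL, smul_smul]
  | zero => exact zero_mem _
  | add L L' _ _ h h' => exact add_mem h h'
  | smul c L _ h => exact Submodule.smul_mem _ c h

/-- A local operator, as a component of a vector field. -/
def IsLocalOperator.toCMM {l : ℕ} {F : MultilinearMap 𝕂 (fun _ : Fin l => X) Y}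
    (hF : IsLocalOperator F) : ContinuousMultilinearMap 𝕂 (fun _ : Fin l => X) Y :=
  ⟨F, hF.continuous⟩

end Classes

section BVTheory

variable {n : ℕ} {𝕂 M : Type*} [RCLike 𝕂] [TopologicalSpace M]
  [ChartedSpace (EuclideanSpace ℝ (Fin n)) M] [CompactSpace M] [IsManifold (𝓡 n) ∞ M]

/-- The sections of `W ⊕ Σ⁻¹ W^!`. -/
noncomputable def withAntifields (W : GradedModule n 𝕂 M) : GradedModule n 𝕂 M :=
  W.prod (W.dual.shift (-1))

theorem Density.add_integral (ρ σ : Density n 𝕂 M) (f : SmoothFn n 𝕂 M) :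
    (ρ + σ).integral f = ρ.integral f + σ.integral f := rfl

theorem Density.smul_scalar_integral (c : 𝕂) (ρ : Density n 𝕂 M) (f : SmoothFn n 𝕂 M) :
    (c • ρ).integral f = c * ρ.integral f := rfl

variable (W : GradedModule n 𝕂 M)

/-- The projection of `W ⊕ Σ⁻¹ W^!` onto `W`. -/
noncomputable def fieldPart : withAntifields W →ₗ[SmoothFn n 𝕂 M] W := LinearMap.fst _ _ _

/-- The projection of `W ⊕ Σ⁻¹ W^!` onto `W^!`. -/
noncomputable def antifieldPart :
    withAntifields W →ₗ[SmoothFn n 𝕂 M] W →ₗ[SmoothFn n 𝕂 M] Density n 𝕂 M :=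
  LinearMap.snd (SmoothFn n 𝕂 M) W (W →ₗ[SmoothFn n 𝕂 M] Density n 𝕂 M)

theorem fieldPart_proj (i : ℤ) (x : withAntifields W) :
    fieldPart W ((withAntifields W).proj i x) = W.proj i (fieldPart W x) := rfl

/-- The evaluation `∫_M f(w)` for `f ∈ W^!` and `w ∈ W`. -/
noncomputable def evalIntegral (f : W →ₗ[SmoothFn n 𝕂 M] Density n 𝕂 M) (w : W) : 𝕂 :=
  (f w).integral 1

/-- The skew-symmetric pairing of degree minus one on `W ⊕ Σ⁻¹ W^!` for which
`⟨f, w⟩ = ∫_M f(w)` and hence `⟨w, f⟩ = - ∫_M f(w)`, for `f ∈ W^!` and `w ∈ W`. -/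
noncomputable def pairing : withAntifields W →ₗ[𝕂] withAntifields W →ₗ[𝕂] 𝕂 :=
  LinearMap.mk₂ 𝕂 (fun s t => evalIntegral W (antifieldPart W s) (fieldPart W t) -
      evalIntegral W (antifieldPart W t) (fieldPart W s))
    (fun s s' t => by
      simp only [evalIntegral, map_add, LinearMap.add_apply, Density.add_integral]
      ring)
    (fun c s t => by
      simp only [evalIntegral, LinearMap.map_smul_of_tower, LinearMap.smul_apply,
        Density.smul_scalar_integral, smul_eq_mul]
      ring)
    (fun s t t' => by
      simp only [evalIntegral, map_add, LinearMap.add_apply, Density.add_integral]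
      ring)
    (fun c s t => by
      simp only [evalIntegral, LinearMap.map_smul_of_tower, LinearMap.smul_apply,
        Density.smul_scalar_integral, smul_eq_mul]
      ring)

variable {W}

/-- `Y` is the symplectic vector field of the functional `S` on `W ⊕ Σ⁻¹ W^!`:
`(S_l cycsum)(s₁, …, s_l) = ⟨Y_{l-1}(s₁, …, s_{l-1}), s_l⟩` for all `l ≥ 1`. -/
def IsHamiltonianField (S : KontHam (withAntifields W)) (Y : VectorField (withAntifields W)) :
    Prop :=
  ∀ (l : ℕ) (s : Fin (l + 1) → withAntifields W),
    cycSum l (S (l + 1)) s = pairing W (Y l (Fin.init s)) (s (Fin.last l))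

/-- The classical master equation `{S, S} = 0` for a functional `S` on `W ⊕ Σ⁻¹ W^!`: `S` has
degree zero, it has a symplectic vector field `Y` (which is of degree one and unique), and
`{S, S} = Y S` vanishes. -/
def SatisfiesCME (S : KontHam (withAntifields W)) : Prop :=
  IsDegreeZero S ∧ ∃ Y, IsHamiltonianField S Y ∧ act 1 Y S = 0

end BVTheory

section Gauge

variable {n : ℕ} {𝕂 M : Type*} [RCLike 𝕂] [TopologicalSpace M]
  [ChartedSpace (EuclideanSpace ℝ (Fin n)) M] [CompactSpace M] [IsManifold (𝓡 n) ∞ M]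

/-- A local algebra structure: an associative product that is a local operator of degree zero. -/
structure LocalAlgebra (U : GradedModule n 𝕂 M) where
  mul : U →ₗ[𝕂] U →ₗ[𝕂] U
  mul_local : IsLocalBilinear mul
  mul_deg : ∀ {i j a b}, a ∈ U.deg i → b ∈ U.deg j → mul a b ∈ U.deg (i + j)
  mul_assoc : ∀ a b c, mul (mul a b) c = mul a (mul b c)

/-- A twisted local bimodule over a local algebra: a bimodule whose left and right actions
`left a v = a v` and `right v a = v a` are local operators of degree zero, with a twisting operator
`d`, a derivation that is a local operator of degree zero. -/
structure TwistedLocalBimodule {U : GradedModule n 𝕂 M} (alg : LocalAlgebra U)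
    (V : GradedModule n 𝕂 M) where
  left : U →ₗ[𝕂] V →ₗ[𝕂] V
  right : V →ₗ[𝕂] U →ₗ[𝕂] V
  left_local : IsLocalBilinear left
  right_local : IsLocalBilinear right
  left_deg : ∀ {i j a v}, a ∈ U.deg i → v ∈ V.deg j → left a v ∈ V.deg (i + j)
  right_deg : ∀ {i j v a}, v ∈ V.deg i → a ∈ U.deg j → right v a ∈ V.deg (i + j)
  left_assoc : ∀ a b v, left (alg.mul a b) v = left a (left b v)
  middle_assoc : ∀ a v b, right (left a v) b = left a (right v b)
  right_assoc : ∀ v a b, right (right v a) b = right v (alg.mul a b)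
  d : U →ₗ[𝕂] V
  d_local : IsLocalLinear d
  d_deg : ∀ {i a}, a ∈ U.deg i → d a ∈ V.deg i
  d_mul : ∀ a b, d (alg.mul a b) = right (d a) b + left a (d b)

section Definitions

variable (U V : GradedModule n 𝕂 M)

/-- The graded module `𝒳 = U ⊕ Σ⁻¹ V`. -/
def dgSpace : GradedModule n 𝕂 M := U.prod (V.shift (-1))

/-- The ghosts and fields `Σ𝒳 = ΣU ⊕ V`; the suspension `Σ` is the identity on elements. -/
def ghostsFields : GradedModule n 𝕂 M := (dgSpace U V).shift 1

/-- The projection of `U ⊕ Σ⁻¹ V` onto `U`. -/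
def toU : dgSpace U V →ₗ[SmoothFn n 𝕂 M] U := LinearMap.fst (SmoothFn n 𝕂 M) U V

/-- The projection of `U ⊕ Σ⁻¹ V` onto `V`. -/
def toV : dgSpace U V →ₗ[SmoothFn n 𝕂 M] V := LinearMap.snd (SmoothFn n 𝕂 M) U V

/-- The inclusion of `U` into `U ⊕ Σ⁻¹ V`. -/
def inU : U →ₗ[SmoothFn n 𝕂 M] dgSpace U V := LinearMap.inl (SmoothFn n 𝕂 M) U V

/-- The inclusion of `V` into `U ⊕ Σ⁻¹ V`. -/
def inV : V →ₗ[SmoothFn n 𝕂 M] dgSpace U V := LinearMap.inr (SmoothFn n 𝕂 M) U V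

/-- The suspension `Σ : 𝒳 → Σ𝒳`. -/
def susp : dgSpace U V →ₗ[SmoothFn n 𝕂 M] ghostsFields U V :=
  (LinearMap.id : dgSpace U V →ₗ[SmoothFn n 𝕂 M] dgSpace U V)

/-- The desuspension `Σ⁻¹ : Σ𝒳 → 𝒳`. -/
def desusp : ghostsFields U V →ₗ[SmoothFn n 𝕂 M] dgSpace U V :=
  (LinearMap.id : dgSpace U V →ₗ[SmoothFn n 𝕂 M] dgSpace U V)

/-- The projection of `ΣU ⊕ V` onto `V`. -/
def toFields : ghostsFields U V →ₗ[SmoothFn n 𝕂 M] V := toV U V ∘ₗ desusp U V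

theorem toFields_proj (i : ℤ) (x : ghostsFields U V) :
    toFields U V ((ghostsFields U V).proj i x) = V.proj i (toFields U V x) := by
  change V.proj (i + 1 + -1) _ = _
  rw [add_neg_cancel_right]
  rfl

end Definitions

variable {U V : GradedModule n 𝕂 M} {alg : LocalAlgebra U}

namespace TwistedLocalBimodule

variable (bim : TwistedLocalBimodule alg V)

/-- The product of the differential graded algebra `𝒳 = U ⊕ Σ⁻¹ V`:
`m ((u₁, v₁), (u₂, v₂)) = (u₁ u₂, (-1)^|u₁| u₁ v₂ + v₁ u₂)`. -/
noncomputable def dgMul : dgSpace U V →ₗ[𝕂] dgSpace U V →ₗ[𝕂] dgSpace U V :=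
  (alg.mul.compl₁₂ ((toU U V).restrictScalars 𝕂) ((toU U V).restrictScalars 𝕂)).compr₂
      ((inU U V).restrictScalars 𝕂) +
    (bim.left.compl₁₂ ((U.parity ∘ₗ toU U V).restrictScalars 𝕂)
      ((toV U V).restrictScalars 𝕂)).compr₂ ((inV U V).restrictScalars 𝕂) +
    (bim.right.compl₁₂ ((toV U V).restrictScalars 𝕂) ((toU U V).restrictScalars 𝕂)).compr₂
      ((inV U V).restrictScalars 𝕂)

theorem dgMul_apply (u₁ u₂ : U) (v₁ v₂ : V) :
    bim.dgMul (u₁, v₁) (u₂, v₂) =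
      (alg.mul u₁ u₂, bim.left (U.parity u₁) v₂ + bim.right v₁ u₂) := by
  refine Prod.ext ?_ ?_
  · change alg.mul u₁ u₂ + 0 + 0 = _
    rw [add_zero, add_zero]
  · change 0 + bim.left (U.parity u₁) v₂ + bim.right v₁ u₂ = _
    rw [zero_add]

/-- The differential of `𝒳 = U ⊕ Σ⁻¹ V`: `(u, v) ↦ (0, d u)`. -/
def dgDiff : dgSpace U V →ₗ[𝕂] dgSpace U V :=
  (inV U V).restrictScalars 𝕂 ∘ₗ bim.d ∘ₗ (toU U V).restrictScalars 𝕂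

theorem dgMul_local : IsLocalBilinear bim.dgMul :=
  ((alg.mul_local.comp_linear _ _ _).add (bim.left_local.comp_linear _ _ _)).add
    (bim.right_local.comp_linear _ _ _)

theorem dgDiff_local : IsLocalLinear bim.dgDiff := bim.d_local.comp_linear _ _

/-- `Σ ∘ d ∘ Σ⁻¹`. -/
def gaugeDiff : ghostsFields U V →ₗ[𝕂] ghostsFields U V :=
  (susp U V).restrictScalars 𝕂 ∘ₗ bim.dgDiff ∘ₗ (desusp U V).restrictScalars 𝕂

/-- `Σ ∘ m ∘ (Σ⁻¹)^{⊗ 2}`, i.e. `x₁, x₂ ↦ (-1)^|x₁| Σ m (Σ⁻¹ x₁, Σ⁻¹ x₂)` since `Σ⁻¹` is odd. -/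
noncomputable def gaugeMul :
    ghostsFields U V →ₗ[𝕂] ghostsFields U V →ₗ[𝕂] ghostsFields U V :=
  (bim.dgMul.compl₁₂ ((desusp U V ∘ₗ (ghostsFields U V).parity).restrictScalars 𝕂)
    ((desusp U V).restrictScalars 𝕂)).compr₂ ((susp U V).restrictScalars 𝕂)

/-- The components of the vector field `X^gauge`. -/
noncomputable def gaugeComponent :
    ∀ k : ℕ, MultilinearMap 𝕂 (fun _ : Fin k => ghostsFields U V) (ghostsFields U V)
  | 1 => ofLinear bim.gaugeDiff
  | 2 => ofBilinear bim.gaugeMul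
  | _ => 0

theorem gaugeComponent_local : ∀ k : ℕ, IsLocalOperator (bim.gaugeComponent k)
  | 0 => zero_mem _
  | 1 => (bim.dgDiff_local.comp_linear _ _).ofLinear
  | 2 => (bim.dgMul_local.comp_linear _ _ _).ofBilinear
  | _ + 3 => zero_mem _

/-- The vector field `X^gauge` on `ΣU ⊕ V`. -/
noncomputable def gauge : VectorField (ghostsFields U V) := fun k =>
  (bim.gaugeComponent_local k).toCMM

theorem comm_local (i : ℤ) (a : U) :
    IsLocalLinear (bim.left a - bim.right.flip a ∘ₗ (V.koszul i).restrictScalars 𝕂) :=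
  sub_mem (bim.left_local.left a) ((bim.right_local.right a).comp_linear (V.koszul i) LinearMap.id)

/-- The vector field `- d a + [a, -]` on `V` for `a` of degree `i`, where
`[a, v] = a v - (-1)^(i |v|) v a`. -/
noncomputable def symmetry (i : ℤ) (a : U) : VectorField V
  | 0 => ContinuousMultilinearMap.constOfIsEmpty 𝕂 _ (-bim.d a)
  | 1 => (bim.comm_local i a).ofLinear.toCMM
  | _ => 0

/-- The functional `S` on `V` is invariant under the action of `U`. -/
def IsInvariant (S : KontHam V) : Prop :=
  ∀ (i : ℤ) (a : U), a ∈ U.deg i → act i (bim.symmetry i a) S = 0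

end TwistedLocalBimodule

/-- The functional `(x₁, …, x_k, y) ↦ ⟨F (x₁, …, x_k), y⟩ = - ∫_M y (F (x₁, …, x_k))` for
`x_i ∈ W` and `y ∈ Σ⁻¹ W^!`, extended by zero to a functional on `W ⊕ Σ⁻¹ W^!`. -/
noncomputable def fibreLinear {W : GradedModule n 𝕂 M} {k : ℕ} :
    MultilinearMap 𝕂 (fun _ : Fin k => W) W →ₗ[𝕂]
      MultilinearMap 𝕂 (fun _ : Fin (k + 1) => withAntifields W) 𝕂 where
  toFun F := MultilinearMap.uncurryRight (M := fun _ : Fin (k + 1) => withAntifields W)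
    (((-LinearMap.mk₂ 𝕂 (fun (w : W) (t : withAntifields W) =>
          evalIntegral W (antifieldPart W t) w)
        (fun w w' t => by simp only [evalIntegral, map_add, Density.add_integral])
        (fun c w t => by
          simp only [evalIntegral, LinearMap.map_smul_of_tower, Density.smul_scalar_integral,
            smul_eq_mul])
        (fun w t t' => by
          simp only [evalIntegral, map_add, LinearMap.add_apply, Density.add_integral])
        (fun c w t => by
          simp only [evalIntegral, LinearMap.map_smul_of_tower, LinearMap.smul_apply,
            Density.smul_scalar_integral, smul_eq_mul])).compMultilinearMap F).compLinearMap
      fun _ => (fieldPart W).restrictScalars 𝕂)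
  map_add' F F' := by
    ext s
    simp
  map_smul' c F := by
    ext s
    simp

theorem fibreLinear_apply {W : GradedModule n 𝕂 M} {k : ℕ}
    (F : MultilinearMap 𝕂 (fun _ : Fin k => W) W) (s : Fin (k + 1) → withAntifields W) :
    fibreLinear F s = -evalIntegral W (antifieldPart W (s (Fin.last k)))
      (F fun i => fieldPart W (s i.castSucc)) := rfl

variable [T2Space M]

theorem fibreLinear_local {W : GradedModule n 𝕂 M} {k : ℕ}
    {F : MultilinearMap 𝕂 (fun _ : Fin k => W) W} (hF : IsLocalOperator F) :
    IsLocalDistribution (fibreLinear F) := by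
  obtain ⟨ρ₀, hs, hi, -⟩ := exists_reference_density n 𝕂 M
  have hbij : Function.Bijective
      (LinearMap.toSpanSingleton (SmoothFn n 𝕂 M) (Density n 𝕂 M) ρ₀) := by
    constructor
    · rw [← LinearMap.ker_eq_bot, LinearMap.ker_eq_bot']
      exact fun g hg => hi g hg
    · intro ρ
      obtain ⟨g, rfl⟩ := hs ρ
      exact ⟨g, rfl⟩
  induction hF using Submodule.span_induction with
  | mem F h =>
    obtain ⟨D, w, hD, hF⟩ := h
    let Θ : withAntifields W →ₗ[SmoothFn n 𝕂 M] SmoothFn n 𝕂 M :=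
      -((LinearEquiv.ofBijective _ hbij).symm.toLinearMap ∘ₗ
        (LinearMap.applyₗ w ∘ₗ antifieldPart W))
    have hΘ : ∀ t, Θ t • ρ₀ = -antifieldPart W t w := fun t => by
      have := LinearEquiv.apply_symm_apply (LinearEquiv.ofBijective _ hbij) (antifieldPart W t w)
      change (-_ : SmoothFn n 𝕂 M) • ρ₀ = _
      rw [neg_smul]
      exact congrArg Neg.neg this
    refine Submodule.subset_span ⟨Fin.snoc (α := fun _ => withAntifields W →ₗ[𝕂] SmoothFn n 𝕂 M)
      (fun i => D i ∘ₗ (fieldPart W).restrictScalars 𝕂) (Θ.restrictScalars 𝕂), ρ₀,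
      fun i => ?_, fun s => ?_⟩
    · induction i using Fin.lastCases with
      | last =>
        rw [Fin.snoc_last]
        exact IsDiffOp.linear Θ
      | cast j =>
        rw [Fin.snoc_castSucc]
        exact (hD j).comp_linear (fieldPart W)
    · rw [Fin.prod_univ_castSucc]
      simp only [Fin.snoc_last, Fin.snoc_castSucc]
      have h1 : ∀ g, -(antifieldPart W (s (Fin.last k)) w).integral g =
          ρ₀.integral (Θ (s (Fin.last k)) * g) := fun g => by
        rw [← Density.smul_integral, hΘ]
        rfl
      rw [fibreLinear_apply, hF, evalIntegral, map_smul, Density.smul_integral, mul_one, h1]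
      exact congrArg _ (mul_comm _ _)
  | zero =>
    rw [map_zero]
    exact zero_mem _
  | add F F' _ _ h h' =>
    rw [map_add]
    exact add_mem h h'
  | smul c F _ h =>
    rw [map_smul]
    exact Submodule.smul_mem _ c h

/-- The functional `S^gauge` on `ΣU ⊕ V ⊕ Σ⁻¹ V^! ⊕ Σ⁻² U^!`:
`S^gauge (x₁, …, x_k, y) = ⟨X^gauge_k (x₁, …, x_k), y⟩` for `x_i ∈ ΣU ⊕ V` and
`y ∈ Σ⁻¹ V^! ⊕ Σ⁻² U^! = Σ⁻¹ (ΣU ⊕ V)^!`. -/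
noncomputable def TwistedLocalBimodule.gaugeAction (bim : TwistedLocalBimodule alg V) :
    KontHam (withAntifields (ghostsFields U V))
  | 0 => 0
  | k + 1 => Ham.mk ⟨fibreLinear (bim.gaugeComponent k),
      (fibreLinear_local (bim.gaugeComponent_local k)).continuous⟩

/-- A functional on `V` as a functional on `ΣU ⊕ V`. -/
noncomputable def onFields (U : GradedModule n 𝕂 M) (S : KontHam V) :
    KontHam (ghostsFields U V) :=
  S.pullback (toFields U V) (toFields_proj U V)

/-- A functional on `V` as a functional on `ΣU ⊕ V ⊕ Σ⁻¹ V^! ⊕ Σ⁻² U^!`. -/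
noncomputable def onAll (U : GradedModule n 𝕂 M) (S : KontHam V) :
    KontHam (withAntifields (ghostsFields U V)) :=
  (onFields U S).pullback (fieldPart _) (fieldPart_proj _)

end Gauge

end NCBV

/-! The core is the expansion {S,S} = {S^gauge,S^gauge} + 2{S^gauge,S^V} + {S^V,S^V}: the outer
terms vanish and the middle one is X^gauge S^V, seen on the larger space.

Symplectic vector fields exist because the functionals are local. Isolate the last argument and let
it be a field: integration by parts (`exists_adjoint`, resting on the divergence theorem in charts
through `exists_lieDeriv`) takes all derivatives off it and leaves a local operator with values in
W^!, the antifield component of the vector field. The field component is prescribed by the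
dependence on the antifields; it is zero for S^V and X^gauge both for S^gauge and for S
(`exists_hamiltonianField`, `cycSum_fibreDist_ofAntifield`). The bracket is symmetric on functionals
of degree zero (`act_comm`), because both sides are the pairing of the two vector fields up to a
cyclic permutation, whose sign is controlled by the degree of the pairing. Hence the master equation
may be tested on any one symplectic vector field.

A functional that is pulled back from the fields is affected only by the field component of a vector
field (`act_pullback`). This gives (1), and it identifies X^S S^V with the pullback of X^gauge S^V.
In {S^gauge,S^gauge} the field and antifield components of the symplectic vector field contribute
equally (`act_gaugeAction`); the field component produces d², the failure of the Leibniz rule and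
the failure of associativity, all zero (`act_eq_zero_of_quadratic`, `gaugeDiff_gaugeMul`,
`gaugeMul_gaugeMul`). What is left of {S,S} is twice the pullback of X^gauge S^V, and pullback along
a split projection is injective.

For the explicit identities, X^gauge S^V is linear in a single ghost a. Its class modulo cyclic
permutations has a representative into which the ghost enters only through the last slot
(`gaugeVariation`). On (v_1, …, v_l, a) every proper rotation of it vanishes, so the class is zero
exactly when the representative is; and the representative is, up to an overall sign, the difference
of the two sides (`gaugeVariation_apply`). For (3), the components of (-da+[a,-])S^V are, after
rotating the left-action term, the same difference with a as a parameter.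

All of this works for graded modules over the smooth functions that are bounded in degree; bundles
enter only in the final statement. -/

open scoped Manifold ContDiff Topology

set_option linter.unusedSectionVars false

namespace NCBV

open Bundle MeasureTheory

/-! ### Integration by parts against a smooth density. -/

section LieDerivative

variable {n : ℕ} {𝕂 M : Type*} [RCLike 𝕂] [TopologicalSpace M]
  [ChartedSpace (EuclideanSpace ℝ (Fin n)) M] [IsManifold (𝓡 n) ∞ M]

/-- A smooth vector field in a chart. -/
theorem exists_fieldDeriv_chart (Z : SmoothField n M)
    {e : OpenPartialHomeomorph M (EuclideanSpace ℝ (Fin n))}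
    (he : e ∈ atlas (EuclideanSpace ℝ (Fin n)) M) :
    ∃ ζ : EuclideanSpace ℝ (Fin n) → EuclideanSpace ℝ (Fin n), ContDiffOn ℝ ∞ ζ e.target ∧
      ∀ (f : SmoothFn n 𝕂 M), ∀ y ∈ e.target,
        (fieldDeriv Z f : M → 𝕂) (e.symm y) =
          fderiv ℝ (fun z => (f : M → 𝕂) (e.symm z)) y (ζ y) := by
  have hm : e ∈ IsManifold.maximalAtlas (𝓡 n) ∞ M := IsManifold.subset_maximalAtlas (I := 𝓡 n) he
  have hes := contMDiffOn_symm_of_mem_maximalAtlas hm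
  have hee := contMDiffOn_of_mem_maximalAtlas hm
  -- The coefficient is the push-forward of `Z` under the chart; the derivative is taken within the
  -- source because the chart is smooth only there.
  refine ⟨fun y => mfderivWithin (𝓡 n) (𝓡 n) e e.source (e.symm y) (Z (e.symm y)), ?_,
    fun f y hy => ?_⟩
  · have h1 := hee.contMDiffOn_tangentMapWithin (m := ∞) (by simp) e.open_source.uniqueMDiffOn
    have h2 : ContMDiffOn (𝓡 n) (𝓡 n).tangent ∞
        (fun y => (⟨e.symm y, Z (e.symm y)⟩ : TangentBundle (𝓡 n) M)) e.target :=
      Z.contMDiff.comp_contMDiffOn hes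
    have h3 := h1.comp h2 fun y hy => e.map_target hy
    exact ((contMDiff_snd_tangentBundle_modelSpace _ (𝓡 n)).comp_contMDiffOn h3).contDiffOn
  · have hx := e.map_target hy
    have h1 : MDifferentiableAt (𝓡 n) 𝓘(ℝ, 𝕂) (fun z => (f : M → 𝕂) (e.symm z)) y :=
      (ContMDiff.comp_contMDiffOn f.2 hes).contMDiffAt (e.open_target.mem_nhds hy)
        |>.mdifferentiableAt (by simp)
    have h2 : MDifferentiableAt (𝓡 n) (𝓡 n) e (e.symm y) :=
      (hee.contMDiffAt (e.open_source.mem_nhds hx)).mdifferentiableAt (by simp)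
    have h3 : (f : M → 𝕂) =ᶠ[𝓝 (e.symm y)] (fun z => (f : M → 𝕂) (e.symm z)) ∘ e := by
      filter_upwards [e.open_source.mem_nhds hx] with x hx
      simp [e.left_inv hx]
    have h4 : mfderiv (𝓡 n) 𝓘(ℝ, 𝕂) (f : M → 𝕂) (e.symm y) =
        (mfderiv (𝓡 n) 𝓘(ℝ, 𝕂) (fun z => (f : M → 𝕂) (e.symm z)) (e (e.symm y))).comp
          (mfderiv (𝓡 n) (𝓡 n) e (e.symm y)) := by
      rw [h3.mfderiv_eq]
      refine mfderiv_comp _ ?_ h2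
      rwa [e.right_inv hy]
    have h5 : ∀ w u, w = y → mfderiv (𝓡 n) 𝓘(ℝ, 𝕂) (fun z => (f : M → 𝕂) (e.symm z)) w u =
        fderiv ℝ (fun z => (f : M → 𝕂) (e.symm z)) y u := by
      rintro _ u rfl
      rw [mfderiv_eq_fderiv]
      rfl
    have h6 := mfderivWithin_of_isOpen (I := 𝓡 n) (I' := 𝓡 n) (f := e) e.open_source hx
    refine (congrArg (fun T : EuclideanSpace ℝ (Fin n) →L[ℝ] 𝕂 => T (Z (e.symm y))) h4).trans
      ((h5 _ _ (e.right_inv hy)).trans ?_)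
    exact congrArg (fun T : EuclideanSpace ℝ (Fin n) →L[ℝ] EuclideanSpace ℝ (Fin n) =>
      fderiv ℝ (fun z => (f : M → 𝕂) (e.symm z)) y (T (Z (e.symm y)))) h6.symm

/-- The integral of a derivative of a compactly supported function vanishes. -/
theorem integral_fderiv_eq_zero {g : EuclideanSpace ℝ (Fin n) → 𝕂} (hg : ContDiff ℝ ∞ g)
    (hc : HasCompactSupport g) (v : EuclideanSpace ℝ (Fin n)) :
    ∫ y, fderiv ℝ g y v = 0 := by
  have h1 : Continuous fun y => fderiv ℝ g y v :=
    (hg.continuous_fderiv (by simp)).clm_apply continuous_const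
  have h2 : HasCompactSupport fun y => fderiv ℝ g y v := hc.fderiv_apply ℝ v
  -- Integration by parts against the constant function 1, whose derivative is zero.
  have h := integral_mul_fderiv_eq_neg_fderiv_mul_of_integrable (𝕜 := 𝕂) (f := fun _ => 1)
    (g := g) (v := v) (μ := volume) (by simp) (by simpa using h1.integrable_of_hasCompactSupport h2)
    (by simpa using hg.continuous.integrable_of_hasCompactSupport hc)
    (fun _ _ => differentiableAt_const _) (fun _ _ => hg.differentiable (by simp) _)
  simpa using h

variable [CompactSpace M]

/-- The divergence theorem for a smooth function times a vector field in a chart. -/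
theorem integral_fieldDeriv_chart [T2Space M] {e : OpenPartialHomeomorph M (EuclideanSpace ℝ (Fin n))}
    (he : e ∈ atlas (EuclideanSpace ℝ (Fin n)) M) (f : SmoothFn n 𝕂 M)
    (hf : tsupport (f : M → 𝕂) ⊆ e.source) {r : EuclideanSpace ℝ (Fin n) → 𝕂}
    (hr : ContDiffOn ℝ ∞ r e.target) (v : EuclideanSpace ℝ (Fin n)) :
    IntegrableOn (fun y => fderiv ℝ (fun z => (f : M → 𝕂) (e.symm z)) y v * r y) e.target ∧
      ∫ y in e.target, fderiv ℝ (fun z => (f : M → 𝕂) (e.symm z)) y v * r y =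
        -∫ y in e.target, (f : M → 𝕂) (e.symm y) * fderiv ℝ r y v := by
  have hm : e ∈ IsManifold.maximalAtlas (𝓡 n) ∞ M := IsManifold.subset_maximalAtlas (I := 𝓡 n) he
  set K := e '' tsupport (f : M → 𝕂)
  have hK : IsCompact K :=
    (isClosed_tsupport _).isCompact.image_of_continuousOn (e.continuousOn.mono hf)
  have hKt : K ⊆ e.target := by
    rintro _ ⟨x, hx, rfl⟩
    exact e.map_source (hf hx)
  have hφ : ContDiffOn ℝ ∞ (fun z => (f : M → 𝕂) (e.symm z)) e.target :=
    (ContMDiff.comp_contMDiffOn f.2 (contMDiffOn_symm_of_mem_maximalAtlas hm)).contDiffOn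
  -- The coefficient `r` is smooth only on the chart target. Since `f` has compact support in the
  -- source, the product extends by zero to a smooth compactly supported function on the whole
  -- space.
  set g : EuclideanSpace ℝ (Fin n) → 𝕂 :=
    e.target.indicator fun z => (f : M → 𝕂) (e.symm z) * r z with hgdef
  have hg0 : ∀ y ∉ K, g y = 0 := fun y hy => by
    by_cases hyt : y ∈ e.target
    · have : e.symm y ∉ tsupport (f : M → 𝕂) := fun h => hy ⟨_, h, e.right_inv hyt⟩
      rw [hgdef, Set.indicator_of_mem hyt, image_eq_zero_of_notMem_tsupport this, zero_mul]
    · rw [hgdef, Set.indicator_of_notMem hyt]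
  have hgt : ∀ y ∈ e.target, g =ᶠ[𝓝 y] fun z => (f : M → 𝕂) (e.symm z) * r z := fun y hy => by
    filter_upwards [e.open_target.mem_nhds hy] with z hz
    rw [hgdef, Set.indicator_of_mem hz]
  have hg : ContDiff ℝ ∞ g := contDiff_iff_contDiffAt.2 fun y => by
    by_cases hy : y ∈ e.target
    · exact ((hφ.mul hr).contDiffAt (e.open_target.mem_nhds hy)).congr_of_eventuallyEq (hgt y hy)
    · refine (contDiffAt_const (c := (0 : 𝕂))).congr_of_eventuallyEq ?_
      filter_upwards [hK.isClosed.isOpen_compl.mem_nhds fun h => hy (hKt h)] with z hz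
      exact hg0 z hz
  have hgc : HasCompactSupport g := HasCompactSupport.intro hK hg0
  have hd : ∀ y ∈ e.target, fderiv ℝ g y v =
      fderiv ℝ (fun z => (f : M → 𝕂) (e.symm z)) y v * r y +
        (f : M → 𝕂) (e.symm y) * fderiv ℝ r y v := fun y hy => by
    have h1 := (hφ.contDiffAt (e.open_target.mem_nhds hy)).differentiableAt (by simp)
    have h2 := (hr.contDiffAt (e.open_target.mem_nhds hy)).differentiableAt (by simp)
    refine (congrArg (fun T : EuclideanSpace ℝ (Fin n) →L[ℝ] 𝕂 => T v)
      ((hgt y hy).fderiv_eq.trans (h1.hasFDerivAt.mul h2.hasFDerivAt).fderiv)).trans ?_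
    simp only [_root_.add_apply, _root_.smul_apply, smul_eq_mul]
    ring
  have hr' : ContinuousOn (fun y => fderiv ℝ r y v) e.target :=
    (hr.continuousOn_fderiv_of_isOpen e.open_target (by simp)).clm_apply continuousOn_const
  have hi2 := integrableOn_chart e f hf hr'
  have hi0 : IntegrableOn (fun y => fderiv ℝ g y v) e.target :=
    (((hg.continuous_fderiv (by simp)).clm_apply continuous_const).integrable_of_hasCompactSupport
      (hgc.fderiv_apply ℝ v)).integrableOn
  -- Outside the target `g` vanishes near every point, so nothing is lost in passing to the integral
  -- over the whole space.
  have h0 : ∫ y in e.target, fderiv ℝ g y v = 0 := by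
    rw [← integral_fderiv_eq_zero hg hgc v]
    refine setIntegral_eq_integral_of_forall_compl_eq_zero fun y hy => ?_
    have : g =ᶠ[𝓝 y] fun _ => 0 := by
      filter_upwards [hK.isClosed.isOpen_compl.mem_nhds fun h => hy (hKt h)] with z hz
      exact hg0 z hz
    rw [this.fderiv_eq]
    simp
  have hdd : Set.EqOn (fun y => fderiv ℝ g y v - (f : M → 𝕂) (e.symm y) * fderiv ℝ r y v)
      (fun y => fderiv ℝ (fun z => (f : M → 𝕂) (e.symm z)) y v * r y) e.target := fun y hy => by
    simp only [hd y hy, add_sub_cancel_right]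
  refine ⟨(hi0.sub hi2).congr_fun hdd e.open_target.measurableSet, ?_⟩
  rw [← zero_sub, ← h0, ← integral_sub hi0 hi2]
  exact (setIntegral_congr_fun e.open_target.measurableSet hdd).symm

/-- By the divergence theorem `σ` is minus the Lie derivative of `ρ`. The point is that the
functional on the right is again given by a smooth density, which is what makes repeated integration
by parts possible. -/
theorem exists_lieDeriv [T2Space M] (Z : SmoothField n M) (ρ : Density n 𝕂 M) :
    ∃ σ : Density n 𝕂 M, ∀ f, σ.integral f = ρ.integral (fieldDeriv Z f) := by
  refine ⟨⟨ρ.integral ∘ₗ fieldDeriv Z, fun e he => ?_⟩, fun f => rfl⟩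
  obtain ⟨r, hr, hρ⟩ := ρ.2 e he
  obtain ⟨ζ, hζ, hZ⟩ := exists_fieldDeriv_chart (𝕂 := 𝕂) Z he
  let b := EuclideanSpace.basisFun (Fin n) ℝ
  have hri : ∀ i : Fin n, ContDiffOn ℝ ∞ (fun y => ((ζ y i : ℝ) : 𝕂) * r y) e.target := fun i =>
    (contDiff_ofReal.comp_contDiffOn
      ((EuclideanSpace.proj (𝕜 := ℝ) i).contDiff.comp_contDiffOn hζ)).mul hr
  -- Minus the divergence of `r ζ`, the chart expression of minus the Lie derivative.
  refine ⟨fun y => -∑ i, fderiv ℝ (fun y => ((ζ y i : ℝ) : 𝕂) * r y) y (b i), ?_, fun f hf => ?_⟩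
  · exact (ContDiffOn.sum fun i _ =>
      ((hri i).fderiv_of_isOpen e.open_target (m := ∞) (by simp)).clm_apply contDiffOn_const).neg
  -- Derivatives do not enlarge supports, so the chart formula for `ρ` applies to `Z f` as well.
  · have hs : tsupport (fieldDeriv Z f : M → 𝕂) ⊆ tsupport (f : M → 𝕂) := by
      refine closure_minimal (fun x hx => ?_) (isClosed_tsupport _)
      by_contra h
      refine hx ?_
      have h0 : (f : M → 𝕂) =ᶠ[𝓝 x] fun _ => 0 := by
        filter_upwards [(isClosed_tsupport _).isOpen_compl.mem_nhds h] with y hy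
        exact image_eq_zero_of_notMem_tsupport hy
      exact congrArg (fun T : EuclideanSpace ℝ (Fin n) →L[ℝ] 𝕂 => T (Z x))
        (h0.mfderiv_eq.trans mfderiv_const)
    refine (hρ _ (hs.trans hf)).trans ?_
    have h1 : ∀ y ∈ e.target, (fieldDeriv Z f : M → 𝕂) (e.symm y) * r y =
        ∑ i, fderiv ℝ (fun z => (f : M → 𝕂) (e.symm z)) y (b i) * (((ζ y i : ℝ) : 𝕂) * r y) :=
      fun y hy => by
        have h2 : ζ y = ∑ i, ζ y i • b i := by
          simpa [b] using (b.sum_repr (ζ y)).symm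
        rw [hZ f y hy]
        conv_lhs => rw [h2]
        rw [map_sum, Finset.sum_mul]
        refine Finset.sum_congr rfl fun i _ => ?_
        rw [map_smul, RCLike.real_smul_eq_coe_mul]
        ring
    rw [setIntegral_congr_fun e.open_target.measurableSet h1]
    have hd : ∀ i, ContinuousOn
        (fun y => fderiv ℝ (fun y => ((ζ y i : ℝ) : 𝕂) * r y) y (b i)) e.target := fun i =>
      ((hri i).continuousOn_fderiv_of_isOpen e.open_target (by simp)).clm_apply continuousOn_const
    rw [integral_finsetSum _ fun i _ => (integral_fieldDeriv_chart he f hf (hri i) (b i)).1]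
    simp only [(integral_fieldDeriv_chart he f hf (hri _) _).2, mul_neg, Finset.mul_sum]
    rw [integral_neg, integral_finsetSum _ fun i _ => integrableOn_chart e f hf (hd i),
      Finset.sum_neg_distrib]

end LieDerivative

/-! ### Transposes of local distributions, and locality of cyclic sums. -/

section Adjoints

variable {n : ℕ} {𝕂 M : Type*} [RCLike 𝕂] [TopologicalSpace M]
  [ChartedSpace (EuclideanSpace ℝ (Fin n)) M] [CompactSpace M] [IsManifold (𝓡 n) ∞ M]

variable {X Y X' Y' W : GradedModule n 𝕂 M}

/-- The local operator `x₁, …, x_l ↦ (D₁ x₁ ⋯ D_l x_l) s`. -/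
noncomputable def prodSMul {l : ℕ} (D : Fin l → X →ₗ[𝕂] SmoothFn n 𝕂 M) (s : Y) :
    MultilinearMap 𝕂 (fun _ : Fin l => X) Y :=
  ((LinearMap.toSpanSingleton (SmoothFn n 𝕂 M) Y s).restrictScalars 𝕂).compMultilinearMap
    ((MultilinearMap.mkPiAlgebra 𝕂 (Fin l) (SmoothFn n 𝕂 M)).compLinearMap D)

theorem prodSMul_local {l : ℕ} {D : Fin l → X →ₗ[𝕂] SmoothFn n 𝕂 M}
    (hD : ∀ i, IsDiffOp X (D i)) (s : Y) : IsLocalOperator (prodSMul D s) :=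
  Submodule.subset_span ⟨D, s, hD, fun _ => rfl⟩

theorem IsLocalOperator.zero {l : ℕ} :
    IsLocalOperator (0 : MultilinearMap 𝕂 (fun _ : Fin l => X) Y) := zero_mem _

theorem IsLocalOperator.add {l : ℕ} {F G : MultilinearMap 𝕂 (fun _ : Fin l => X) Y}
    (hF : IsLocalOperator F) (hG : IsLocalOperator G) : IsLocalOperator (F + G) := add_mem hF hG

theorem IsLocalOperator.smul {l : ℕ} {F : MultilinearMap 𝕂 (fun _ : Fin l => X) Y} (c : 𝕂)
    (hF : IsLocalOperator F) : IsLocalOperator (c • F) := Submodule.smul_mem _ c hF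

theorem IsLocalDistribution.zero {l : ℕ} :
    IsLocalDistribution (0 : MultilinearMap 𝕂 (fun _ : Fin l => X) 𝕂) := zero_mem _

theorem IsLocalDistribution.add {l : ℕ} {F G : MultilinearMap 𝕂 (fun _ : Fin l => X) 𝕂}
    (hF : IsLocalDistribution F) (hG : IsLocalDistribution G) : IsLocalDistribution (F + G) :=
  add_mem hF hG

theorem IsLocalDistribution.smul {l : ℕ} {F : MultilinearMap 𝕂 (fun _ : Fin l => X) 𝕂} (c : 𝕂)
    (hF : IsLocalDistribution F) : IsLocalDistribution (c • F) := Submodule.smul_mem _ c hF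

theorem IsLocalOperator.comp_linear {l : ℕ} {F : MultilinearMap 𝕂 (fun _ : Fin l => X) Y}
    (h : IsLocalOperator F) (φ : X' →ₗ[SmoothFn n 𝕂 M] X) (χ : Y →ₗ[SmoothFn n 𝕂 M] Y') :
    IsLocalOperator ((χ.restrictScalars 𝕂).compMultilinearMap
      (F.compLinearMap fun _ => φ.restrictScalars 𝕂)) := by
  induction h using Submodule.span_induction with
  | mem L h =>
    obtain ⟨D, s, hD, hL⟩ := h
    refine Submodule.subset_span ⟨_, χ s, fun i => (hD i).comp_linear φ, fun x => ?_⟩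
    simp [hL]
  | zero =>
    convert IsLocalOperator.zero (X := X') (Y := Y') (l := l)
    ext x
    simp
  | add L L' _ _ h h' =>
    convert IsLocalOperator.add h h'
    ext x
    simp
  | smul c L _ h =>
    convert IsLocalOperator.smul c h
    ext x
    simp

theorem evalIntegral_fn_smul_left (g : SmoothFn n 𝕂 M) (f : W →ₗ[SmoothFn n 𝕂 M] Density n 𝕂 M)
    (w : W) : evalIntegral W (g • f) w = (f w).integral g := by
  change (f w).integral (g * 1) = _
  rw [mul_one]

/-- The transpose of a differential operator, by integration by parts. -/
theorem exists_adjoint [T2Space M] {D : W →ₗ[𝕂] SmoothFn n 𝕂 M} (hD : IsDiffOp W D) {l : ℕ} :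
    ∀ (ρ : Density n 𝕂 M) {G : (Fin l → X) → SmoothFn n 𝕂 M}, G ∈ diffProducts X l →
      ∃ A : MultilinearMap 𝕂 (fun _ : Fin l => X) W.dual, IsLocalOperator A ∧
        ∀ s w, ρ.integral (G s * D w) = evalIntegral W (A s) w := by
  -- The density and the coefficient `G` must vary in the induction: the derivative step changes
  -- each of them, and multiplication by a function is absorbed into `G`.
  induction hD with
  | linear φ =>
    intro ρ G hG
    induction hG using Submodule.span_induction with
    | mem G h =>
      obtain ⟨D, g, hD, hG⟩ := h
      refine ⟨prodSMul (Y := W.dual) D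
        ((LinearMap.toSpanSingleton (SmoothFn n 𝕂 M) _ (g • ρ)) ∘ₗ φ :
          W →ₗ[SmoothFn n 𝕂 M] Density n 𝕂 M), prodSMul_local hD _, fun s w => ?_⟩
      rw [hG]
      refine Eq.trans ?_ (evalIntegral_fn_smul_left _ _ w).symm
      change _ = ρ.integral (g * (φ w * _))
      congr 1
      exact (mul_right_comm g (∏ i, D i (s i)) (φ w)).trans (mul_assoc _ _ _)
    | zero => exact ⟨0, zero_mem _, fun s w => by
        change ρ.integral (0 * _) = _
        rw [zero_mul, map_zero]; rfl⟩
    | add G G' _ _ h h' =>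
      obtain ⟨A, hA, h⟩ := h
      obtain ⟨A', hA', h'⟩ := h'
      refine ⟨A + A', add_mem hA hA', fun s w => ?_⟩
      rw [Pi.add_apply, add_mul, map_add, h, h']
      rfl
    | smul c G _ h =>
      obtain ⟨A, hA, h⟩ := h
      refine ⟨c • A, Submodule.smul_mem _ c hA, fun s w => ?_⟩
      rw [Pi.smul_apply, smul_mul_assoc, map_smul, h]
      rfl
  | deriv Z _ ih =>
    intro ρ G hG
    -- ∫ G·Z(Dw) dρ = ∫ Z(G·Dw) dρ − ∫ Z(G)·Dw dρ, where the first integral is ∫ G·Dw dσ. Both terms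
    -- are covered by the induction hypothesis.
    obtain ⟨σ, hσ⟩ := exists_lieDeriv Z ρ
    obtain ⟨A, hA, h⟩ := ih σ hG
    obtain ⟨A', hA', h'⟩ := ih ρ (fieldDeriv_mem_diffProducts Z hG)
    refine ⟨A - A', sub_mem hA hA', fun s w => ?_⟩
    have h1 := h s w
    rw [hσ, fieldDeriv_mul, map_add, h' s w] at h1
    rw [LinearMap.comp_apply, eq_sub_of_add_eq' h1]
    rfl
  | smul f _ ih =>
    intro ρ G hG
    obtain ⟨A, hA, h⟩ := ih ρ (mul_mem_diffProducts f hG)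
    refine ⟨A, hA, fun s w => ?_⟩
    rw [← h s w]
    congr 1
    change G s * (f * _) = _
    ring
  | add _ _ ih ih' =>
    intro ρ G hG
    obtain ⟨A, hA, h⟩ := ih ρ hG
    obtain ⟨A', hA', h'⟩ := ih' ρ hG
    refine ⟨A + A', add_mem hA hA', fun s w => ?_⟩
    rw [LinearMap.add_apply, mul_add, map_add, h, h']
    rfl

/-- Once the last differential operator has been transposed, the distribution is linear over the
smooth functions in `w`; hence it is evaluation on an element of W^! that depends on the other
arguments through a local operator. It is applied with `φ` the inclusion of the fields. -/
theorem IsLocalDistribution.exists_adjoint [T2Space M] {l : ℕ}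
    {F : MultilinearMap 𝕂 (fun _ : Fin (l + 1) => X) 𝕂} (hF : IsLocalDistribution F)
    (φ : W →ₗ[SmoothFn n 𝕂 M] X) :
    ∃ A : MultilinearMap 𝕂 (fun _ : Fin l => X) W.dual, IsLocalOperator A ∧
      ∀ s w, F (Fin.snoc s (φ w)) = evalIntegral W (A s) w := by
  induction hF using Submodule.span_induction with
  | mem F h =>
    obtain ⟨D, ρ, hD, hF⟩ := h
    obtain ⟨A, hA, h⟩ := NCBV.exists_adjoint ((hD (Fin.last l)).comp_linear φ) ρ
      -- The factor 1 is the function coefficient required of a generator of `diffProducts`.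
      (G := fun s => 1 * ∏ i : Fin l, D i.castSucc (s i))
      (Submodule.subset_span ⟨_, 1, fun i => hD i.castSucc, fun x => rfl⟩)
    refine ⟨A, hA, fun s w => ?_⟩
    rw [← h, hF, Fin.prod_univ_castSucc]
    simp
  | zero => exact ⟨0, zero_mem _, fun s w => rfl⟩
  | add F F' _ _ h h' =>
    obtain ⟨A, hA, h⟩ := h
    obtain ⟨A', hA', h'⟩ := h'
    refine ⟨A + A', add_mem hA hA', fun s w => ?_⟩
    rw [add_apply, h, h']
    rfl
  | smul c F _ h =>
    obtain ⟨A, hA, h⟩ := h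
    refine ⟨c • A, Submodule.smul_mem _ c hA, fun s w => ?_⟩
    rw [smul_apply, h]
    rfl

/-- The permutation and the linear maps only relabel and modify the differential operators. The maps
may differ from slot to slot because a signed rotation applies parity operators in some slots and an
even or odd projection in another. -/
theorem IsLocalDistribution.comp_perm {l : ℕ} {F : MultilinearMap 𝕂 (fun _ : Fin l => X) 𝕂}
    (hF : IsLocalDistribution F) (σ : Equiv.Perm (Fin l)) (φ : Fin l → X' →ₗ[SmoothFn n 𝕂 M] X) :
    IsLocalDistribution ((F.domDomCongr σ).compLinearMap fun i => (φ i).restrictScalars 𝕂) := by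
  induction hF using Submodule.span_induction with
  | mem F h =>
    obtain ⟨D, ρ, hD, hF⟩ := h
    refine Submodule.subset_span ⟨fun i => D (σ.symm i) ∘ₗ (φ i).restrictScalars 𝕂, ρ,
      fun i => (hD _).comp_linear _, fun x => ?_⟩
    rw [MultilinearMap.compLinearMap_apply, MultilinearMap.domDomCongr_apply, hF]
    refine congrArg _ (Eq.trans ?_ (Equiv.prod_comp σ fun i =>
      (D (σ.symm i) ∘ₗ (φ i).restrictScalars 𝕂) (x i)))
    simp
  | zero =>
    convert IsLocalDistribution.zero (X := X') (l := l)
    ext x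
    simp
  | add F F' _ _ h h' =>
    convert IsLocalDistribution.add h h'
    ext x
    simp
  | smul c F _ h =>
    convert IsLocalDistribution.smul c h
    ext x
    simp

theorem rotate_local {N : ℕ} {f : Dist N X} (hf : IsLocalDistribution f.toMultilinearMap) :
    IsLocalDistribution (rotate N f).toMultilinearMap := by
  cases N with
  | zero => exact hf
  | succ m =>
    have h : ∀ b, IsLocalDistribution (rotatePart m b f).toMultilinearMap := fun b => by
      convert hf.comp_perm (finRotate (m + 1)).symm
        (Fin.snoc (α := fun _ => X →ₗ[SmoothFn n 𝕂 M] X)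
          (fun _ => if b then X.parity else LinearMap.id) (if b then X.oddPart else X.evenPart))
      refine MultilinearMap.ext fun s => ?_
      refine (rotatePart_apply m b f s).trans ?_
      have h : ∀ i : Fin (m + 1), (finRotate (m + 1)).symm i = i - 1 := fun i => by
        rw [Equiv.symm_apply_eq, finRotate_apply, sub_add_cancel]
      change _ = f _
      congr 1
      funext i
      rw [h i]
      rfl
    exact add_mem (h false) (h true)

theorem cycSum_mk (m : ℕ) (f : Dist (m + 1) X) :
    cycSum m (Ham.mk f) = ∑ k ∈ Finset.range (m + 1), (rotate (m + 1) ^ k) f := by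
  rw [← LinearMap.sum_apply]
  rfl

theorem cycSum_local {h : KontHam X} (hh : IsLocal h) (m : ℕ) :
    IsLocalDistribution (cycSum m (h (m + 1))).toMultilinearMap := by
  obtain ⟨f, hf, hfh⟩ := hh (m + 1)
  have hk : ∀ k, IsLocalDistribution ((rotate (m + 1) ^ k) f).toMultilinearMap := fun k => by
    induction k with
    | zero => exact hf
    | succ k ih =>
      rw [pow_succ']
      exact rotate_local ih
  have h1 : (cycSum m (h (m + 1))).toMultilinearMap =
      ∑ k ∈ Finset.range (m + 1), ((rotate (m + 1) ^ k) f).toMultilinearMap := by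
    rw [← hfh, cycSum_mk]
    refine MultilinearMap.ext fun s => ?_
    change (∑ k ∈ Finset.range (m + 1), (rotate (m + 1) ^ k) f) s = _
    rw [_root_.sum_apply, _root_.sum_apply]
    rfl
  rw [h1]
  exact sum_mem fun k _ => hk k

end Adjoints

/-! ### Cyclic rotations, their Koszul signs, and the action of vector fields. -/

section Cyclic

variable {n : ℕ} {𝕂 M : Type*} [RCLike 𝕂] [TopologicalSpace M]
  [ChartedSpace (EuclideanSpace ℝ (Fin n)) M] [CompactSpace M] [IsManifold (𝓡 n) ∞ M]

variable {X Y : GradedModule n 𝕂 M}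

theorem GradedModule.exists_sum_proj (X : GradedModule n 𝕂 M) :
    ∃ J : Finset ℤ, ∀ x, ∑ i ∈ J, X.proj i x = x := by
  obtain ⟨J, hJ⟩ := X.bounded
  refine ⟨J, fun x => ?_⟩
  rw [← LinearMap.sum_apply, hJ, LinearMap.id_apply]

theorem GradedModule.proj_mem_deg (X : GradedModule n 𝕂 M) (i : ℤ) (x : X) :
    X.proj i x ∈ X.deg i := ⟨x, rfl⟩

theorem GradedModule.proj_of_mem_deg (X : GradedModule n 𝕂 M) {i : ℤ} {x : X}
    (hx : x ∈ X.deg i) (j : ℤ) : X.proj j x = if j = i then x else 0 := by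
  obtain ⟨y, rfl⟩ := hx
  have := LinearMap.congr_fun (X.proj_comp j i) y
  rw [LinearMap.comp_apply] at this
  rw [this]
  split_ifs with h
  · rw [h]
  · rfl

/-- The grading is bounded, so every argument is a finite sum of homogeneous ones and multilinearity
applies. This is why the signs below are computed on homogeneous arguments only. -/
theorem Dist.ext_of_mem_deg {N : ℕ} {f g : Dist N X}
    (h : ∀ (s : Fin N → X) (d : Fin N → ℤ), (∀ i, s i ∈ X.deg (d i)) → f s = g s) : f = g := by
  classical
  obtain ⟨J, hJ⟩ := X.exists_sum_proj
  refine ContinuousMultilinearMap.ext fun s => ?_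
  have hs : s = fun i => ∑ j ∈ J, X.proj j (s i) := funext fun i => (hJ _).symm
  rw [hs, f.map_sum_finset, g.map_sum_finset]
  exact Finset.sum_congr rfl fun r _ => h _ r fun i => X.proj_mem_deg _ _

/-- A functional that vanishes on homogeneous arguments of nonzero total degree. -/
def Dist.OfDegreeZero {N : ℕ} (f : Dist N X) : Prop :=
  ∀ (s : Fin N → X) (d : Fin N → ℤ), (∀ i, s i ∈ X.deg (d i)) → ∑ i, d i ≠ 0 → f s = 0

theorem negOnePow_mul_self (a : ℤ) : ((a.negOnePow : ℤ) : 𝕂) * ((a.negOnePow : ℤ) : 𝕂) = 1 := by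
  rcases Int.even_or_odd a with h | h
  · simp [Int.negOnePow_even _ h]
  · simp [Int.negOnePow_odd _ h]

theorem negOnePow_add_cast (a b : ℤ) : (((a + b).negOnePow : ℤ) : 𝕂) =
    ((a.negOnePow : ℤ) : 𝕂) * ((b.negOnePow : ℤ) : 𝕂) := by
  rw [Int.negOnePow_add]
  push_cast
  rfl

theorem negOnePow_congr {a b : ℤ} (h : Even (a - b)) :
    ((a.negOnePow : ℤ) : 𝕂) = ((b.negOnePow : ℤ) : 𝕂) := by
  rw [(Int.negOnePow_eq_iff a b).2 h]

theorem rotate_snoc {m : ℕ} (f : Dist (m + 1) X) {s : Fin m → X} {x : X} {p : Fin m → ℤ} {q : ℤ}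
    (hs : ∀ i, s i ∈ X.deg (p i)) (hx : x ∈ X.deg q) :
    rotate (m + 1) f (Fin.snoc (α := fun _ => X) s x) =
      (((q * ∑ i, p i).negOnePow : ℤ) : 𝕂) * f (Fin.cons (α := fun _ => X) x s) := by
  rw [rotate_apply m f _ (Fin.snoc (α := fun _ => ℤ) p q)]
  · congr 1
    · rw [Fin.snoc_last, Fin.sum_univ_castSucc]
      simp
    · congr 1
      funext i
      induction i using Fin.cases with
      | zero =>
        have hl : (0 : Fin (m + 1)) - 1 = Fin.last m := by
          rw [sub_eq_iff_eq_add, Fin.last_add_one]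
        rw [hl, Fin.snoc_last, Fin.cons_zero]
      | succ j =>
        have hl : j.succ - 1 = j.castSucc := by
          rw [sub_eq_iff_eq_add, Fin.coeSucc_eq_succ]
        rw [hl, Fin.snoc_castSucc, Fin.cons_succ]
  · intro i
    induction i using Fin.lastCases with
    | last => rw [Fin.snoc_last, Fin.snoc_last]; exact hasParity_of_mem_deg hx
    | cast j => rw [Fin.snoc_castSucc, Fin.snoc_castSucc]; exact hasParity_of_mem_deg (hs j)

/-- With P = ∑ p_i, modulo 2 one has ∑ p_i² ≡ P ≡ P², so ∑ p_i(P+Q−p_i) ≡ PQ. For signs: when a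
block is rotated one argument at a time, each pair inside the block is crossed twice, and only the
crossings with the other block count. -/
theorem even_sum_mul_sub {ι : Type*} (t : Finset ι) (p : ι → ℤ) (Q : ℤ) :
    Even (∑ i ∈ t, p i * (∑ i ∈ t, p i + Q - p i) - (∑ i ∈ t, p i) * Q) := by
  have h4 : ∀ a : ℤ, Even (a * a - a) := fun a => by
    rw [← mul_sub_one]
    exact Int.even_mul_pred_self a
  have h5 : Even (∑ i ∈ t, (p i * p i - p i)) := Finset.even_sum _ fun j _ => h4 _
  have h6 := (h4 (∑ i ∈ t, p i)).sub h5
  rw [Finset.sum_sub_distrib] at h6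
  have h7 : ∑ i ∈ t, p i * (∑ i ∈ t, p i + Q - p i) =
      (∑ i ∈ t, p i) * (∑ i ∈ t, p i + Q) - ∑ i ∈ t, p i * p i := by
    rw [Finset.sum_mul, ← Finset.sum_sub_distrib]
    exact Finset.sum_congr rfl fun i _ => by ring
  have h8 : ∑ i ∈ t, p i * (∑ i ∈ t, p i + Q - p i) - (∑ i ∈ t, p i) * Q =
      (∑ i ∈ t, p i) * (∑ i ∈ t, p i) - ∑ i ∈ t, p i -
        (∑ i ∈ t, p i * p i - ∑ i ∈ t, p i) := by
    rw [h7]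
    ring
  rw [h8]
  exact h6

/-- Rotating as often as the length of the final block carries that block to the front as a whole,
so only the Koszul sign of exchanging two blocks remains. -/
theorem rotate_pow_append {m k N : ℕ} (h : m + k = N + 1) (f : Dist (N + 1) X) {u : Fin m → X}
    {w : Fin k → X} {p : Fin m → ℤ} {q : Fin k → ℤ} (hu : ∀ i, u i ∈ X.deg (p i))
    (hw : ∀ i, w i ∈ X.deg (q i)) :
    (rotate (N + 1) ^ m) f (fun i => Fin.append w u (Fin.cast ((add_comm k m).trans h).symm i)) =
      ((((∑ i, p i) * ∑ i, q i).negOnePow : ℤ) : 𝕂) *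
        f (fun i => Fin.append u w (Fin.cast h.symm i)) := by
  have hlt : ∀ j : Fin m, (j : ℕ) % (N + 1) = j := fun j => Nat.mod_eq_of_lt (by omega)
  rw [rotate_pow_apply N f m _ (fun i => Fin.append q p (Fin.cast ((add_comm k m).trans h).symm i))]
  · congr 1
    · refine negOnePow_congr ?_
      have h1 : ∑ i, Fin.append q p (Fin.cast ((add_comm k m).trans h).symm i) =
          ∑ i, p i + ∑ i, q i := by
        refine ((finCongr ((add_comm k m).trans h).symm).sum_comp (Fin.append q p)).trans ?_
        rw [Fin.sum_univ_add]
        simp [add_comm]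
      -- The rotations take arguments from the end, so the block `u` is met in reverse order.
      have h2 : ∀ j : Fin m, Fin.append q p (Fin.cast ((add_comm k m).trans h).symm
          (Fin.last N - Fin.ofNat (N + 1) j)) = p j.rev := fun j => by
        have : Fin.cast ((add_comm k m).trans h).symm (Fin.last N - Fin.ofNat (N + 1) j) =
            Fin.natAdd k j.rev := by
          refine Fin.ext ?_
          simp only [Fin.val_cast, Fin.val_natAdd, Fin.val_rev, Fin.sub_def, Fin.val_ofNat,
            Fin.val_last, hlt]
          have : N + 1 - j + N = (N - j) + (N + 1) := by omega
          rw [this, Nat.add_mod_right, Nat.mod_eq_of_lt (by omega)]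
          omega
        rw [this, Fin.append_right]
      rw [Finset.sum_range, h1]
      simp only [h2]
      have h3 := Equiv.sum_comp (Fin.revPerm (n := m)) fun j => p j * (∑ i, p i + ∑ i, q i - p j)
      simp only [Fin.revPerm_apply] at h3
      rw [h3]
      exact even_sum_mul_sub _ _ _
    · congr 1
      funext i
      obtain ⟨i, rfl⟩ := (finCongr h).surjective i
      induction i using Fin.addCases with
      | left i =>
        have : Fin.cast ((add_comm k m).trans h).symm
            (finCongr h (Fin.castAdd k i) - Fin.ofNat (N + 1) m) = Fin.natAdd k i := by
          refine Fin.ext ?_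
          simp only [Fin.val_cast, Fin.val_natAdd, Fin.sub_def, Fin.val_ofNat, finCongr_apply,
            Fin.val_castAdd]
          have hi := i.2
          -- For `k = 0` the rotation is a full turn and the shift is 0 modulo `N + 1`.
          rcases Nat.eq_zero_or_pos k with rfl | hk
          · have : m = N + 1 := by omega
            subst this
            simp only [Nat.mod_self, Nat.sub_zero, Nat.zero_add]
            rw [Nat.add_mod_left, Nat.mod_eq_of_lt (by omega)]
          · rw [Nat.mod_eq_of_lt (a := m) (by omega), Nat.mod_eq_of_lt (by omega)]
            omega
        rw [this, Fin.append_right]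
        simp
      | right i =>
        have : Fin.cast ((add_comm k m).trans h).symm
            (finCongr h (Fin.natAdd m i) - Fin.ofNat (N + 1) m) = Fin.castAdd m i := by
          refine Fin.ext ?_
          simp only [Fin.val_cast, Fin.val_natAdd, Fin.sub_def, Fin.val_ofNat, finCongr_apply,
            Fin.val_castAdd]
          have hi := i.2
          rw [Nat.mod_eq_of_lt (a := m) (by omega)]
          have : N + 1 - m + (m + i) = i + (N + 1) := by omega
          rw [this, Nat.add_mod_right, Nat.mod_eq_of_lt (by omega)]
        rw [this, Fin.append_left]
        simp
  · intro i
    induction Fin.cast ((add_comm k m).trans h).symm i using Fin.addCases with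
    | left i => rw [Fin.append_left, Fin.append_left]; exact hasParity_of_mem_deg (hw i)
    | right i => rw [Fin.append_right, Fin.append_right]; exact hasParity_of_mem_deg (hu i)

theorem Ham.mk_rotate {N : ℕ} (f : Dist N X) : Ham.mk (rotate N f) = Ham.mk f :=
  ((Submodule.Quotient.eq _).2 (LinearMap.mem_range.2 ⟨f, rfl⟩)).symm

theorem Ham.mk_rotate_pow {N : ℕ} (f : Dist N X) (k : ℕ) :
    Ham.mk ((rotate N ^ k) f) = Ham.mk f := by
  induction k with
  | zero => rfl
  | succ k ih => rw [pow_succ', Module.End.mul_apply, Ham.mk_rotate, ih]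

theorem Ham.exists_mk {N : ℕ} (h : Ham N X) : ∃ f, Ham.mk f = h := Submodule.mkQ_surjective _ h

theorem append_cast_eq {m k N : ℕ} (h : m + k = N) {α : Type*} (s : Fin N → α) :
    (fun i => Fin.append (fun i => s (Fin.cast h (Fin.castAdd k i)))
      (fun i => s (Fin.cast h (Fin.natAdd m i))) (Fin.cast h.symm i)) = s := by
  subst h
  funext i
  simp only [Fin.cast_eq_self]
  induction i using Fin.addCases with
  | left i => rw [Fin.append_left]
  | right i => rw [Fin.append_right]

/-- The hypothesis says that `g` is the rotation of `f` by `m` steps, and rotations do not change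
the class. -/
theorem Ham.mk_eq_of_swap {m k N : ℕ} (h : m + k = N) {f g : Dist N X}
    (H : ∀ (u : Fin m → X) (w : Fin k → X) (p : Fin m → ℤ) (q : Fin k → ℤ),
      (∀ i, u i ∈ X.deg (p i)) → (∀ i, w i ∈ X.deg (q i)) →
      f (fun i => Fin.append u w (Fin.cast h.symm i)) =
        ((((∑ i, p i) * ∑ i, q i).negOnePow : ℤ) : 𝕂) *
          g (fun i => Fin.append w u (Fin.cast ((add_comm k m).trans h).symm i))) :
    Ham.mk f = Ham.mk g := by
  cases N with
  | zero =>
    obtain rfl : m = 0 := by omega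
    obtain rfl : k = 0 := by omega
    refine congrArg _ (ContinuousMultilinearMap.ext fun s => ?_)
    have h1 := H Fin.elim0 Fin.elim0 Fin.elim0 Fin.elim0 (fun i => i.elim0) (fun i => i.elim0)
    simp only [Finset.univ_eq_empty, Finset.sum_empty, mul_zero, Int.negOnePow_zero,
      Units.val_one, Int.cast_one, one_mul] at h1
    rw [Subsingleton.elim s _, h1]
  | succ N =>
    rw [← Ham.mk_rotate_pow f m]
    refine congrArg _ (Dist.ext_of_mem_deg fun s d hs => ?_)
    have h' : k + m = N + 1 := by omega
    rw [← append_cast_eq h' s, rotate_pow_append h f (fun i => hs _) (fun i => hs _),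
      H _ _ _ _ (fun i => hs _) (fun i => hs _), ← mul_assoc, negOnePow_mul_self, one_mul]

/-- Multiplying the sum of all powers of the rotation by the rotation permutes the summands, since
the rotation has finite order. -/
theorem rotate_cycSum (m : ℕ) (h : Ham (m + 1) X) :
    rotate (m + 1) (cycSum m h) = cycSum m h := by
  obtain ⟨f, rfl⟩ := h.exists_mk
  have h1 := mul_geom_sum (rotate (X := X) (m + 1)) (m + 1)
  rw [rotate_pow_self, sub_self] at h1
  exact sub_eq_zero.1 (LinearMap.congr_fun h1 f)

theorem cycSum_snoc {m : ℕ} (h : Ham (m + 1) X) {s : Fin m → X} {x : X} {p : Fin m → ℤ} {q : ℤ}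
    (hs : ∀ i, s i ∈ X.deg (p i)) (hx : x ∈ X.deg q) :
    cycSum m h (Fin.snoc (α := fun _ => X) s x) =
      (((q * ∑ i, p i).negOnePow : ℤ) : 𝕂) * cycSum m h (Fin.cons (α := fun _ => X) x s) := by
  rw [← rotate_snoc _ hs hx, rotate_cycSum]

theorem Dist.OfDegreeZero.rotate_pow {m : ℕ} {f : Dist (m + 1) X} (hf : f.OfDegreeZero) (k : ℕ) :
    Dist.OfDegreeZero ((rotate (m + 1) ^ k) f) := fun s d hs hd => by
  rw [rotate_pow_apply m f k s d fun i => hasParity_of_mem_deg (hs i),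
    hf _ (fun i => d (i - Fin.ofNat (m + 1) k)) (fun i => hs _), mul_zero]
  exact fun h => hd (((Equiv.subRight (Fin.ofNat (m + 1) k)).sum_comp d).symm.trans h)

theorem IsDegreeZero.cycSum {h : KontHam X} (hh : IsDegreeZero h) (m : ℕ) :
    Dist.OfDegreeZero (cycSum m (h (m + 1))) := by
  obtain ⟨f, hf, hfh⟩ := hh (m + 1)
  rw [← hfh, cycSum_mk]
  intro s d hs hd
  rw [_root_.sum_apply]
  exact Finset.sum_eq_zero fun k _ => Dist.OfDegreeZero.rotate_pow hf k s d hs hd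

theorem insertLast_append {m k N : ℕ} (hN : m + k = N) (f : Dist (m + 1) X) (j : ℤ)
    (Y : ContinuousMultilinearMap 𝕂 (fun _ : Fin k => X) X) {u : Fin m → X} (w : Fin k → X)
    {p : Fin m → ℤ} (hu : ∀ i, u i ∈ X.deg (p i)) :
    insertLast hN f j Y (fun i => Fin.append u w (Fin.cast hN.symm i)) =
      (((j * ∑ i, p i).negOnePow : ℤ) : 𝕂) * f (Fin.snoc (α := fun _ => X) u (Y w)) := by
  subst hN
  change f (Fin.snoc (α := fun _ => X) (fun i : Fin m => X.koszul j
    (Fin.append u w (Fin.castAdd k i))) (Y fun i => Fin.append u w (Fin.natAdd m i))) = _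
  simp only [Fin.append_left, Fin.append_right]
  have h1 : (Fin.snoc (α := fun _ => X) (fun i : Fin m => X.koszul j (u i)) (Y w)) =
      fun i => (Fin.snoc (α := fun _ => 𝕂) (fun i : Fin m => (((j * p i).negOnePow : ℤ) : 𝕂)) 1 i
        : 𝕂) • (Fin.snoc (α := fun _ => X) u (Y w) i : X) := by
    funext i
    induction i using Fin.lastCases with
    | last => simp
    | cast i =>
      simp only [Fin.snoc_castSucc]
      rw [X.koszul_of_mem_deg j (hu i), Int.cast_smul_eq_zsmul]
  rw [h1, f.map_smul_univ, Fin.prod_univ_castSucc, smul_eq_mul, Finset.mul_sum, negOnePow_sum]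
  simp

/-- The mechanism behind the symmetry of the bracket. Exchanging the blocks `u` and `w` turns one
insertion into the other; the sign of the exchange, the Koszul signs of the two insertions and the
minus sign in the hypothesis cancel in total degree −1, the only one in which the value can be
nonzero. -/
theorem Ham.mk_insertLast_comm {m k N : ℕ} (h : m + k = N) (h' : k + m = N) {f : Dist (m + 1) X}
    {g : Dist (k + 1) X} {P : ContinuousMultilinearMap 𝕂 (fun _ : Fin k => X) X}
    {Q : ContinuousMultilinearMap 𝕂 (fun _ : Fin m => X) X}
    (H : ∀ (u : Fin m → X) (w : Fin k → X) (p : Fin m → ℤ) (q : Fin k → ℤ),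
      (∀ i, u i ∈ X.deg (p i)) → (∀ i, w i ∈ X.deg (q i)) →
      f (Fin.snoc (α := fun _ => X) u (P w)) = -g (Fin.snoc (α := fun _ => X) w (Q u)) ∧
        (g (Fin.snoc (α := fun _ => X) w (Q u)) ≠ 0 → ∑ i, p i + ∑ i, q i = -1)) :
    Ham.mk (insertLast h f 1 P) = Ham.mk (insertLast h' g 1 Q) := by
  refine Ham.mk_eq_of_swap h fun u w p q hu hw => ?_
  obtain ⟨H1, H2⟩ := H u w p q hu hw
  rw [insertLast_append h f 1 P w hu, insertLast_append h' g 1 Q u hw, H1, one_mul, one_mul]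
  by_cases h0 : g (Fin.snoc (α := fun _ => X) w (Q u)) = 0
  · rw [h0]
    simp
  · have h1 : ∑ i, p i = -1 - ∑ i, q i := by linarith [H2 h0]
    rw [h1]
    have h2 : ((((-1 - ∑ i, q i) * ∑ i, q i).negOnePow : ℤ) : 𝕂) = 1 := by
      have : Even ((-1 - ∑ i, q i) * ∑ i, q i) := by
        have := (Int.even_mul_succ_self (∑ i, q i)).neg
        have h3 : (-1 - ∑ i, q i) * ∑ i, q i = -((∑ i, q i) * (∑ i, q i + 1)) := by ring
        rwa [h3]
      rw [Int.negOnePow_even _ this]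
      simp
    have h3 : (((-1 - ∑ i, q i).negOnePow : ℤ) : 𝕂) = -(((∑ i, q i).negOnePow : ℤ) : 𝕂) := by
      rw [sub_eq_add_neg, negOnePow_add_cast, Int.negOnePow_neg]
      simp
    rw [h2, h3]
    ring

theorem act_apply (j : ℤ) (Y : VectorField X) (h : KontHam X) (N : ℕ) :
    act j Y h N = ∑ a ∈ (Finset.HasAntidiagonal.antidiagonal N).attach,
      Ham.mk (insertLast (Finset.HasAntidiagonal.mem_antidiagonal.1 a.2)
        (cycSum a.1.1 (h (a.1.1 + 1))) j (Y a.1.2)) := rfl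

/-- The sum over m + k = N is invariant under interchanging m and k, so it suffices to match the
term (m, k) on one side with (k, m) on the other. -/
theorem act_eq_of_swap {j : ℤ} {Y Y' : VectorField X} {h h' : KontHam X}
    (H : ∀ {m k N : ℕ} (hN : m + k = N) (hN' : k + m = N),
      Ham.mk (insertLast hN (cycSum m (h (m + 1))) j (Y k)) =
        Ham.mk (insertLast hN' (cycSum k (h' (k + 1))) j (Y' m))) :
    act j Y h = act j Y' h' := by
  funext N
  rw [act_apply, act_apply]
  have hs : ∀ a ∈ Finset.HasAntidiagonal.antidiagonal N,
      a.swap ∈ Finset.HasAntidiagonal.antidiagonal N := fun a ha =>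
    Finset.HasAntidiagonal.mem_antidiagonal.2
      ((add_comm _ _).trans (Finset.HasAntidiagonal.mem_antidiagonal.1 ha))
  refine Finset.sum_bij' (fun a _ => ⟨a.1.swap, hs _ a.2⟩)
    (fun a _ => ⟨a.1.swap, hs _ a.2⟩) (fun _ _ => Finset.mem_attach _ _)
    (fun _ _ => Finset.mem_attach _ _) (fun _ _ => rfl) (fun _ _ => rfl) fun a _ => H _ _

theorem insertLast_of_add {m k N : ℕ} (hN : m + k = N) (f : Dist (m + 1) X) (j : ℤ)
    {Y Y' Y'' : ContinuousMultilinearMap 𝕂 (fun _ : Fin k => X) X}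
    (H : ∀ s, Y s = Y' s + Y'' s) :
    insertLast hN f j Y = insertLast hN f j Y' + insertLast hN f j Y'' := by
  refine ContinuousMultilinearMap.ext fun s => ?_
  have h := f.toMultilinearMap.map_update_add (Fin.snoc (α := fun _ => X)
    (fun i : Fin m => X.koszul j (s (Fin.cast hN (Fin.castAdd k i)))) 0) (Fin.last m)
    (Y' fun i => s (Fin.cast hN (Fin.natAdd m i))) (Y'' fun i => s (Fin.cast hN (Fin.natAdd m i)))
  simp only [Fin.update_snoc_last, ← H] at h
  exact h

theorem act_of_add (j : ℤ) {Y Y' Y'' : VectorField X} (H : ∀ k s, Y k s = Y' k s + Y'' k s)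
    (h : KontHam X) : act j Y h = act j Y' h + act j Y'' h := by
  funext N
  rw [Pi.add_apply, act_apply, act_apply, act_apply, ← Finset.sum_add_distrib]
  refine Finset.sum_congr rfl fun a _ => ?_
  rw [insertLast_of_add _ _ _ (H _), map_add]

theorem act_add_right (j : ℤ) (Y : VectorField X) (h h' : KontHam X) :
    act j Y (h + h') = act j Y h + act j Y h' := by
  funext N
  rw [Pi.add_apply, act_apply, act_apply, act_apply, ← Finset.sum_add_distrib]
  refine Finset.sum_congr rfl fun a _ => ?_
  rw [← map_add, Pi.add_apply, map_add]
  rfl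

end Cyclic

/-! ### Functionals induced along maps of graded modules. -/

section Pullbacks

variable {n : ℕ} {𝕂 M : Type*} [RCLike 𝕂] [TopologicalSpace M]
  [ChartedSpace (EuclideanSpace ℝ (Fin n)) M] [CompactSpace M] [IsManifold (𝓡 n) ∞ M]

variable {X Y : GradedModule n 𝕂 M}

theorem Dist.snoc_add {m : ℕ} (f : Dist (m + 1) X) (s : Fin m → X) (x y : X) :
    f (Fin.snoc (α := fun _ => X) s (x + y)) =
      f (Fin.snoc (α := fun _ => X) s x) + f (Fin.snoc (α := fun _ => X) s y) := by
  have h := f.toMultilinearMap.map_update_add (Fin.snoc (α := fun _ => X) s 0) (Fin.last m) x y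
  simp only [Fin.update_snoc_last] at h
  exact h

theorem Dist.snoc_zero {m : ℕ} (f : Dist (m + 1) X) (s : Fin m → X) :
    f (Fin.snoc (α := fun _ => X) s 0) = 0 :=
  f.map_coord_zero (Fin.last m) (Fin.snoc_last _ _)

theorem Dist.snoc_smul {m : ℕ} (f : Dist (m + 1) X) (s : Fin m → X) (c : 𝕂) (x : X) :
    f (Fin.snoc (α := fun _ => X) s (c • x)) = c * f (Fin.snoc (α := fun _ => X) s x) := by
  have h := f.toMultilinearMap.map_update_smul (Fin.snoc (α := fun _ => X) s 0) (Fin.last m) c x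
  simp only [Fin.update_snoc_last] at h
  exact h

theorem Dist.snoc_sum {m : ℕ} (f : Dist (m + 1) X) (s : Fin m → X) {ι : Type*} (J : Finset ι)
    (x : ι → X) : f (Fin.snoc (α := fun _ => X) s (∑ j ∈ J, x j)) =
      ∑ j ∈ J, f (Fin.snoc (α := fun _ => X) s (x j)) := by
  classical
  induction J using Finset.induction_on with
  | empty => rw [Finset.sum_empty, Finset.sum_empty, Dist.snoc_zero]
  | insert a J ha ih => rw [Finset.sum_insert ha, Finset.sum_insert ha, Dist.snoc_add, ih]

theorem Dist.pullback_apply {N : ℕ} (φ : X →ₗ[SmoothFn n 𝕂 M] Y) (f : Dist N Y) (s : Fin N → X) :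
    Dist.pullback φ f s = f fun i => φ (s i) := rfl

theorem KontHam.pullback_mk {φ : X →ₗ[SmoothFn n 𝕂 M] Y}
    (hφ : ∀ i x, φ (X.proj i x) = Y.proj i (φ x)) {h : KontHam Y} {N : ℕ} {f : Dist N Y}
    (hf : Ham.mk f = h N) : h.pullback φ hφ N = Ham.mk (Dist.pullback φ f) := by
  rw [KontHam.pullback, ← hf]
  rfl

theorem map_mem_deg {φ : X →ₗ[SmoothFn n 𝕂 M] Y} (hφ : ∀ i x, φ (X.proj i x) = Y.proj i (φ x))
    {i : ℤ} {x : X} (hx : x ∈ X.deg i) : φ x ∈ Y.deg i := by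
  obtain ⟨y, rfl⟩ := hx
  exact ⟨φ y, (hφ i y).symm⟩

theorem rotate_pow_pullback {φ : X →ₗ[SmoothFn n 𝕂 M] Y}
    (hφ : ∀ i x, φ (X.proj i x) = Y.proj i (φ x)) {N : ℕ} (f : Dist N Y) (k : ℕ) :
    (rotate N ^ k) (Dist.pullback φ f) = Dist.pullback φ ((rotate N ^ k) f) := by
  induction k with
  | zero => rfl
  | succ k ih =>
    rw [pow_succ', pow_succ', Module.End.mul_apply, Module.End.mul_apply, ih, rotate_pullback hφ]

theorem cycSum_pullback {φ : X →ₗ[SmoothFn n 𝕂 M] Y}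
    (hφ : ∀ i x, φ (X.proj i x) = Y.proj i (φ x)) (h : KontHam Y) (m : ℕ) :
    cycSum m (h.pullback φ hφ (m + 1)) = Dist.pullback φ (cycSum m (h (m + 1))) := by
  obtain ⟨f, hf⟩ := (h (m + 1)).exists_mk
  rw [KontHam.pullback_mk hφ hf, ← hf, cycSum_mk, cycSum_mk, map_sum]
  exact Finset.sum_congr rfl fun k _ => rotate_pow_pullback hφ f k

theorem IsDegreeZero.pullback {φ : X →ₗ[SmoothFn n 𝕂 M] Y}
    (hφ : ∀ i x, φ (X.proj i x) = Y.proj i (φ x)) {h : KontHam Y} (hh : IsDegreeZero h) :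
    IsDegreeZero (h.pullback φ hφ) := fun N => by
  obtain ⟨f, hf, hfh⟩ := hh N
  exact ⟨Dist.pullback φ f, fun s d hs hd => hf _ d (fun i => map_mem_deg hφ (hs i)) hd,
    (KontHam.pullback_mk hφ hfh).symm⟩

theorem IsLocal.pullback {φ : X →ₗ[SmoothFn n 𝕂 M] Y}
    (hφ : ∀ i x, φ (X.proj i x) = Y.proj i (φ x)) {h : KontHam Y} (hh : IsLocal h) :
    IsLocal (h.pullback φ hφ) := fun N => by
  obtain ⟨f, hf, hfh⟩ := hh N
  exact ⟨Dist.pullback φ f, hf.comp_perm (Equiv.refl _) fun _ => φ,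
    (KontHam.pullback_mk hφ hfh).symm⟩

theorem IsDegreeZero.add {h h' : KontHam X} (hh : IsDegreeZero h) (hh' : IsDegreeZero h') :
    IsDegreeZero (h + h') := fun N => by
  obtain ⟨f, hf, hfh⟩ := hh N
  obtain ⟨f', hf', hfh'⟩ := hh' N
  refine ⟨f + f', fun s d hs hd => ?_, by rw [map_add, hfh, hfh', Pi.add_apply]⟩
  rw [add_apply, hf s d hs hd, hf' s d hs hd, add_zero]

theorem koszul_map {φ : X →ₗ[SmoothFn n 𝕂 M] Y} (hφ : ∀ i x, φ (X.proj i x) = Y.proj i (φ x))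
    (j : ℤ) (x : X) : φ (X.koszul j x) = Y.koszul j (φ x) := by
  have h1 : φ (X.evenPart x) = Y.evenPart (φ x) := map_part hφ _ _
  have h2 : φ (X.oddPart x) = Y.oddPart (φ x) := map_part hφ _ _
  rw [GradedModule.koszul, GradedModule.koszul, LinearMap.add_apply, LinearMap.add_apply, map_add,
    LinearMap.smul_apply, LinearMap.smul_apply, map_zsmul, h1, h2]

/-- The action of `φ`-related vector fields. -/
theorem act_pullback {φ : X →ₗ[SmoothFn n 𝕂 M] Y}
    (hφ : ∀ i x, φ (X.proj i x) = Y.proj i (φ x)) (j : ℤ) {P : VectorField X} {Q : VectorField Y}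
    (H : ∀ k s, φ (P k s) = Q k fun i => φ (s i)) (h : KontHam Y) :
    act j P (h.pullback φ hφ) = (act j Q h).pullback φ hφ := by
  funext N
  have h1 : act j Q h N = Ham.mk (∑ a ∈ (Finset.HasAntidiagonal.antidiagonal N).attach,
      insertLast (Finset.HasAntidiagonal.mem_antidiagonal.1 a.2)
        (cycSum a.1.1 (h (a.1.1 + 1))) j (Q a.1.2)) := by rw [act_apply, map_sum]
  rw [KontHam.pullback_mk hφ h1.symm, act_apply, map_sum, map_sum]
  refine Finset.sum_congr rfl fun a _ => congrArg _ (ContinuousMultilinearMap.ext fun s => ?_)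
  rw [cycSum_pullback]
  change cycSum a.1.1 (h (a.1.1 + 1)) (fun i => φ (Fin.snoc (α := fun _ => X) _ _ i)) =
    cycSum a.1.1 (h (a.1.1 + 1)) (Fin.snoc (α := fun _ => Y) _ _)
  congr 1
  funext i
  induction i using Fin.lastCases with
  | last =>
    rw [Fin.snoc_last, Fin.snoc_last, H]
    rfl
  | cast i =>
    rw [Fin.snoc_castSucc, Fin.snoc_castSucc, koszul_map hφ]
    rfl

theorem KontHam.pullback_zero {φ : X →ₗ[SmoothFn n 𝕂 M] Y}
    (hφ : ∀ i x, φ (X.proj i x) = Y.proj i (φ x)) : (0 : KontHam Y).pullback φ hφ = 0 :=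
  funext fun _ => map_zero _

/-- A right inverse `ψ` of `φ` gives a left inverse of the pullback, which is therefore injective.
It is used for the projection from fields and antifields onto the fields. -/
theorem KontHam.pullback_eq_zero {φ : X →ₗ[SmoothFn n 𝕂 M] Y}
    (hφ : ∀ i x, φ (X.proj i x) = Y.proj i (φ x)) {ψ : Y →ₗ[SmoothFn n 𝕂 M] X}
    (hψ : ∀ i x, ψ (Y.proj i x) = X.proj i (ψ x)) (hφψ : ∀ y, φ (ψ y) = y) {h : KontHam Y}
    (h0 : h.pullback φ hφ = 0) : h = 0 := by
  funext N
  obtain ⟨f, hf⟩ := (h N).exists_mk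
  have h1 : h.pullback φ hφ N = Ham.mk (Dist.pullback φ f) := KontHam.pullback_mk hφ hf
  have h2 : (h.pullback φ hφ).pullback ψ hψ N = Ham.mk (Dist.pullback ψ (Dist.pullback φ f)) :=
    KontHam.pullback_mk hψ h1.symm
  have h3 : Dist.pullback ψ (Dist.pullback φ f) = f := ContinuousMultilinearMap.ext fun s => by
    rw [Dist.pullback_apply, Dist.pullback_apply]
    simp only [hφψ]
  rw [h3, hf, h0, KontHam.pullback_zero] at h2
  exact h2.symm

end Pullbacks

/-! ### The odd symplectic pairing, symplectic vector fields and the bracket. -/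

section Brackets

variable {n : ℕ} {𝕂 M : Type*} [RCLike 𝕂] [TopologicalSpace M]
  [ChartedSpace (EuclideanSpace ℝ (Fin n)) M] [CompactSpace M] [IsManifold (𝓡 n) ∞ M]

variable {W : GradedModule n 𝕂 M}

variable (W) in
/-- The inclusion of `W` into `W ⊕ Σ⁻¹ W^!`. -/
noncomputable def ofField : W →ₗ[SmoothFn n 𝕂 M] withAntifields W := LinearMap.inl _ _ _

variable (W) in
/-- The inclusion of `W^!` into `W ⊕ Σ⁻¹ W^!`. -/
noncomputable def ofAntifield : W.dual →ₗ[SmoothFn n 𝕂 M] withAntifields W := LinearMap.inr _ _ _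

theorem ofField_proj (i : ℤ) (w : W) :
    ofField W (W.proj i w) = (withAntifields W).proj i (ofField W w) :=
  Prod.ext rfl (map_zero ((W.dual.shift (-1)).proj i)).symm

theorem fieldPart_ofField (w : W) : fieldPart W (ofField W w) = w := rfl

theorem antifieldPart_ofField (w : W) : antifieldPart W (ofField W w) = 0 := rfl

theorem fieldPart_ofAntifield (f : W.dual) : fieldPart W (ofAntifield W f) = 0 := rfl

theorem ofField_add_ofAntifield (s : withAntifields W) :
    ofField W (fieldPart W s) + ofAntifield W (antifieldPart W s) = s :=
  Prod.ext (add_zero _) (zero_add _)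

theorem evalIntegral_zero_left (w : W) : evalIntegral W 0 w = 0 := rfl

theorem evalIntegral_zero_right (f : W →ₗ[SmoothFn n 𝕂 M] Density n 𝕂 M) :
    evalIntegral W f 0 = 0 := by
  rw [evalIntegral, map_zero]
  rfl

theorem evalIntegral_add_right (f : W →ₗ[SmoothFn n 𝕂 M] Density n 𝕂 M) (w w' : W) :
    evalIntegral W f (w + w') = evalIntegral W f w + evalIntegral W f w' := by
  rw [evalIntegral, map_add]
  rfl

theorem pairing_apply (s t : withAntifields W) :
    pairing W s t = evalIntegral W (antifieldPart W s) (fieldPart W t) -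
      evalIntegral W (antifieldPart W t) (fieldPart W s) := rfl

theorem pairing_swap (s t : withAntifields W) : pairing W s t = -pairing W t s := by
  rw [pairing_apply, pairing_apply, neg_sub]

/-- An element of degree i in Σ⁻¹W^! has degree i−1 in W^!, hence vanishes on all fields of degree
other than 1−i. This is the form in which the degree of the pairing enters every sign computation.
-/
theorem evalIntegral_of_mem_deg {i j : ℤ} {s t : withAntifields W}
    (hs : s ∈ (withAntifields W).deg i) (ht : t ∈ (withAntifields W).deg j) (hij : i + j ≠ 1) :
    evalIntegral W (antifieldPart W s) (fieldPart W t) = 0 := by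
  obtain ⟨s, rfl⟩ := hs
  obtain ⟨t, rfl⟩ := ht
  change Density.integral (antifieldPart W s (W.proj (-(i + -1)) (W.proj j (fieldPart W t)))) 1 = 0
  rw [W.proj_of_mem_deg (W.proj_mem_deg j _), if_neg (by omega), map_zero]
  rfl

theorem pairing_of_mem_deg {i j : ℤ} {s t : withAntifields W}
    (hs : s ∈ (withAntifields W).deg i) (ht : t ∈ (withAntifields W).deg j) (hij : i + j ≠ 1) :
    pairing W s t = 0 := by
  rw [pairing_apply, evalIntegral_of_mem_deg hs ht hij,
    evalIntegral_of_mem_deg ht hs (by rwa [add_comm]), sub_zero]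

theorem IsHamiltonianField.cycSum_snoc {S : KontHam (withAntifields W)}
    {Y : VectorField (withAntifields W)} (h : IsHamiltonianField S Y) (l : ℕ)
    (s : Fin l → withAntifields W) (t : withAntifields W) :
    cycSum l (S (l + 1)) (Fin.snoc (α := fun _ => withAntifields W) s t) =
      pairing W (Y l s) t := by
  rw [h, Fin.snoc_last, Fin.init_snoc]

/-- The bracket `{S, S'} = Y_S S'` is symmetric on functionals of degree zero. -/
theorem act_comm {S S' : KontHam (withAntifields W)} (hS : IsDegreeZero S)
    (hS' : IsDegreeZero S') {Y Y' : VectorField (withAntifields W)} (hY : IsHamiltonianField S Y)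
    (hY' : IsHamiltonianField S' Y') : act 1 Y S' = act 1 Y' S := by
  refine act_eq_of_swap fun {m k N} hN hN' => Ham.mk_insertLast_comm hN hN' fun u w p q hu hw => ?_
  rw [hY'.cycSum_snoc, hY.cycSum_snoc]
  -- It remains to see that ⟨Y(w), Y'(u)⟩ vanishes unless |u|+|w| = −1. Homogeneity of the vector
  -- fields is not part of the hypotheses, so their values are split into components, and the
  -- degrees of `S` and `S'` are used through the pairing.
  refine ⟨pairing_swap _ _, fun h0 => ?_⟩
  by_contra hne
  refine h0 ?_
  obtain ⟨J, hJ⟩ := (withAntifields W).exists_sum_proj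
  rw [← hY.cycSum_snoc]
  conv_lhs => rw [← hJ (Y' m u)]
  rw [Dist.snoc_sum]
  refine Finset.sum_eq_zero fun j _ => ?_
  by_cases hj : ∑ i, q i + j = 0
  · rw [hY.cycSum_snoc, ← hJ (Y k w), map_sum, LinearMap.sum_apply]
    refine Finset.sum_eq_zero fun i _ => ?_
    by_cases hij : i + j = 1
    -- Here i + j = 1 and |w| + j = 0, so |u| + i = |u| + |w| + 1 ≠ 0 and `S'` forces the pairing of
    -- Y'(u) with anything of degree i to vanish. That pairing detects only the component of Y'(u)
    -- of degree j.
    · rw [pairing_swap]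
      have h1 : ∀ t, t ∈ (withAntifields W).deg i → pairing W (Y' m u) t = 0 := fun t ht => by
        rw [← hY'.cycSum_snoc]
        refine hS'.cycSum m _ (Fin.snoc (α := fun _ => ℤ) p i) (fun l => ?_) ?_
        · induction l using Fin.lastCases with
          | last => rw [Fin.snoc_last, Fin.snoc_last]; exact ht
          | cast l => rw [Fin.snoc_castSucc, Fin.snoc_castSucc]; exact hu l
        · rw [Fin.sum_univ_castSucc]
          simp only [Fin.snoc_last, Fin.snoc_castSucc]
          omega
      have h2 := h1 _ ((withAntifields W).proj_mem_deg i (Y k w))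
      conv at h2 => lhs; rw [← hJ (Y' m u), map_sum, LinearMap.sum_apply]
      rw [Finset.sum_eq_single j] at h2
      · rw [pairing_swap, neg_neg, pairing_swap, h2, neg_zero]
      · intro b _ hb
        exact pairing_of_mem_deg ((withAntifields W).proj_mem_deg _ _)
          ((withAntifields W).proj_mem_deg _ _) (by omega)
      · intro hjJ
        rw [(withAntifields W).proj_eq_zero (J := J) (LinearMap.ext fun x => by
          rw [LinearMap.sum_apply, hJ]; rfl) hjJ]
        simp
    · exact pairing_of_mem_deg ((withAntifields W).proj_mem_deg _ _)
        ((withAntifields W).proj_mem_deg _ _) hij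
  · refine hS.cycSum k _ (Fin.snoc (α := fun _ => ℤ) q j) (fun l => ?_) ?_
    · induction l using Fin.lastCases with
      | last => rw [Fin.snoc_last, Fin.snoc_last]; exact (withAntifields W).proj_mem_deg _ _
      | cast l => rw [Fin.snoc_castSucc, Fin.snoc_castSucc]; exact hw l
    · rw [Fin.sum_univ_castSucc]
      simpa using hj

/-- Local functionals have symplectic vector fields, provided that their dependence on the
antifields is through local operators. -/
theorem exists_hamiltonianField [T2Space M] {S : KontHam (withAntifields W)} (hS : IsLocal S)
    {F : ∀ k, MultilinearMap 𝕂 (fun _ : Fin k => W) W} (hF : ∀ k, IsLocalOperator (F k))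
    (H : ∀ (l : ℕ) (s : Fin l → withAntifields W) (f : W.dual),
      cycSum l (S (l + 1)) (Fin.snoc (α := fun _ => withAntifields W) s (ofAntifield W f)) =
        -evalIntegral W f (F l fun i => fieldPart W (s i))) :
    ∃ Y, IsHamiltonianField S Y ∧
      ∀ k s, fieldPart W (Y k s) = F k fun i => fieldPart W (s i) := by
  -- The antifield component of the vector field, obtained by transposing in the last slot
  -- restricted to fields. The field component is `F`.
  choose A hA hAe using fun l => (cycSum_local hS l).exists_adjoint (ofField W)
  let Y : ∀ k, MultilinearMap 𝕂 (fun _ : Fin k => withAntifields W) (withAntifields W) := fun k =>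
    ((ofField W).restrictScalars 𝕂).compMultilinearMap
        ((F k).compLinearMap fun _ => (fieldPart W).restrictScalars 𝕂) +
      ((ofAntifield W).restrictScalars 𝕂).compMultilinearMap
        ((A k).compLinearMap fun _ => (LinearMap.id : withAntifields W →ₗ[SmoothFn n 𝕂 M]
          withAntifields W).restrictScalars 𝕂)
  have hY : ∀ k, IsLocalOperator (Y k) := fun k =>
    ((hF k).comp_linear _ _).add ((hA k).comp_linear _ _)
  have h1 : ∀ k s, fieldPart W (Y k s) = F k fun i => fieldPart W (s i) := fun k s => add_zero _
  have h2 : ∀ k s, antifieldPart W (Y k s) = A k s := fun k s => zero_add _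
  refine ⟨fun k => (hY k).toCMM, fun l s => ?_, h1⟩
  change _ = pairing W (Y l (Fin.init s)) (s (Fin.last l))
  rw [pairing_apply, h1, h2]
  -- Splitting the last argument into field and antifield matches the two terms of the pairing, one
  -- given by the adjoint and the other by `H`.
  conv_lhs => rw [← Fin.snoc_init_self s, ← ofField_add_ofAntifield (s (Fin.last l))]
  rw [Dist.snoc_add, sub_eq_add_neg]
  exact congrArg₂ (· + ·) (hAe l _ _) (H l _ (antifieldPart W (s (Fin.last l))))

end Brackets

/-! ### Functionals linear in one antifield, and insertion up to rotation. -/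

section FibreLinear

variable {n : ℕ} {𝕂 M : Type*} [RCLike 𝕂] [TopologicalSpace M]
  [ChartedSpace (EuclideanSpace ℝ (Fin n)) M] [CompactSpace M] [IsManifold (𝓡 n) ∞ M]

variable {X W : GradedModule n 𝕂 M}

/-- The summand of `act j Y h` in which `Y_k` is inserted into `h_{m+1}`. -/
noncomputable def actTerm (j : ℤ) (Y : VectorField X) (h : KontHam X) (m k N : ℕ) : Ham N X :=
  if hN : m + k = N then Ham.mk (insertLast hN (cycSum m (h (m + 1))) j (Y k)) else 0

theorem actTerm_eq (j : ℤ) (Y : VectorField X) (h : KontHam X) {m k N : ℕ} (hN : m + k = N) :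
    actTerm j Y h m k N = Ham.mk (insertLast hN (cycSum m (h (m + 1))) j (Y k)) := dif_pos hN

theorem actTerm_eq_zero (j : ℤ) {Y : VectorField X} (h : KontHam X) (m : ℕ) {k : ℕ} (N : ℕ)
    (hY : ∀ s, Y k s = 0) : actTerm j Y h m k N = 0 := by
  by_cases hN : m + k = N
  · rw [actTerm_eq _ _ _ hN]
    have : insertLast hN (cycSum m (h (m + 1))) j (Y k) = 0 :=
      ContinuousMultilinearMap.ext fun s => by
        refine (cycSum m (h (m + 1))).map_coord_zero (Fin.last m) ?_
        rw [Fin.snoc_last, hY]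
    rw [this, map_zero]
  · exact dif_neg hN

theorem act_eq_sum_actTerm (j : ℤ) (Y : VectorField X) (h : KontHam X) (N : ℕ) :
    act j Y h N = ∑ k ∈ Finset.range (N + 1), actTerm j Y h (N - k) k N := by
  have h1 : act j Y h N = ∑ a ∈ (Finset.HasAntidiagonal.antidiagonal N).attach,
      (fun a : ℕ × ℕ => actTerm j Y h a.1 a.2 N) a.1 :=
    Finset.sum_congr rfl fun a _ =>
      (actTerm_eq j Y h (Finset.HasAntidiagonal.mem_antidiagonal.1 a.2)).symm
  rw [h1, Finset.sum_attach _ fun a : ℕ × ℕ => actTerm j Y h a.1 a.2 N,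
    Finset.Nat.sum_antidiagonal_eq_sum_range_succ fun m k => actTerm j Y h m k N,
    ← Finset.sum_range_reflect]
  refine Finset.sum_congr rfl fun k hk => ?_
  have := Finset.mem_range.1 hk
  congr 1
  omega

theorem act_zero_eq (j : ℤ) (Y : VectorField X) (h : KontHam X) :
    act j Y h 0 = actTerm j Y h 0 0 0 := by
  rw [act_eq_sum_actTerm]
  simp

theorem act_one_eq (j : ℤ) (Y : VectorField X) (h : KontHam X) :
    act j Y h 1 = actTerm j Y h 1 0 1 + actTerm j Y h 0 1 1 := by
  rw [act_eq_sum_actTerm]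
  simp [Finset.sum_range_succ]

/-- The action of an at most quadratic vector field. -/
theorem act_add_two_eq (j : ℤ) {Y : VectorField X} (hY : ∀ k s, Y (k + 3) s = 0)
    (h : KontHam X) (N : ℕ) :
    act j Y h (N + 2) = actTerm j Y h (N + 2) 0 (N + 2) + actTerm j Y h (N + 1) 1 (N + 2) +
      actTerm j Y h N 2 (N + 2) := by
  rw [act_eq_sum_actTerm, Finset.sum_range_succ', Finset.sum_range_succ', Finset.sum_range_succ',
    Finset.sum_eq_zero fun k _ => actTerm_eq_zero j h _ _ (hY k), zero_add]
  simp only [Nat.zero_add, Nat.reduceAdd, Nat.add_sub_cancel, Nat.sub_zero]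
  rw [show N + 2 - 1 = N + 1 by omega]
  abel

/-- Moving the inserted argument to the front. -/
theorem rotate_pow_insertLast_rotate {m k N : ℕ} (h : m + k = N + 1) (f : Dist (m + 1) X)
    {P : ContinuousMultilinearMap 𝕂 (fun _ : Fin k => X) X} {u : Fin m → X} {w : Fin k → X}
    {p : Fin m → ℤ} {q : Fin k → ℤ} (hu : ∀ i, u i ∈ X.deg (p i)) (hw : ∀ i, w i ∈ X.deg (q i))
    (hP : P w ∈ X.deg (∑ i, q i + 1)) :
    (rotate (N + 1) ^ m) (insertLast h (rotate (m + 1) f) 1 P)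
        (fun i => Fin.append w u (Fin.cast ((add_comm k m).trans h).symm i)) =
      f (Fin.cons (α := fun _ => X) (P w) u) := by
  rw [rotate_pow_append h _ hu hw, insertLast_append h _ 1 P w hu, rotate_snoc f hu hP,
    ← mul_assoc, ← mul_assoc, ← negOnePow_add_cast, ← negOnePow_add_cast, Int.negOnePow_even,
    Units.val_one, Int.cast_one, one_mul]
  -- Three signs cancel: |u||w| from exchanging the blocks, |u| from `P` passing `u`, and |u|(|w|+1)
  -- from rotating P(w) to the front.
  refine ⟨(∑ i, p i) * (∑ i, q i) + ∑ i, p i, ?_⟩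
  ring

/-- Moving the inserted argument to the middle. -/
theorem rotate_insertLast_rotate_two {k : ℕ} (h : 2 + k = k + 2) (f : Dist 3 X)
    {P : ContinuousMultilinearMap 𝕂 (fun _ : Fin k => X) X} {x y : X} {w : Fin k → X}
    {a b : ℤ} {q : Fin k → ℤ} (hx : x ∈ X.deg a) (hy : y ∈ X.deg b) (hw : ∀ i, w i ∈ X.deg (q i))
    (hP : P w ∈ X.deg (∑ i, q i + 1)) :
    rotate (k + 2) (insertLast h ((rotate 3 ^ 2) f) 1 P)
        (Fin.snoc (α := fun _ => X) (Fin.cons (α := fun _ => X) x w) y) =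
      ((a.negOnePow : ℤ) : 𝕂) * f ![x, P w, y] := by
  rw [rotate_snoc (p := Fin.cons (α := fun _ => ℤ) a q) _ (fun i => by
    induction i using Fin.cases with
    | zero => exact hx
    | succ i => exact hw i) hy]
  have h1 : (Fin.cons (α := fun _ => X) y (Fin.cons (α := fun _ => X) x w) : Fin (k + 2) → X) =
      fun i => Fin.append ![y, x] w (Fin.cast h.symm i) := by
    funext i
    induction i using Fin.cases with
    | zero => rfl
    | succ i =>
      induction i using Fin.cases with
      | zero => rfl
      | succ i =>
        rw [Fin.cons_succ, Fin.cons_succ]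
        have : Fin.cast h.symm i.succ.succ = Fin.natAdd 2 i :=
          Fin.ext (by simp only [Fin.val_cast, Fin.val_succ, Fin.val_natAdd]; omega)
        rw [this, Fin.append_right]
  have hu : ∀ i, (![y, x] : Fin 2 → X) i ∈ X.deg ((![b, a] : Fin 2 → ℤ) i) := fun i => by
    fin_cases i
    · exact hy
    · exact hx
  have hu' : ∀ i, (![x, P w] : Fin 2 → X) i ∈ X.deg ((![a, ∑ i, q i + 1] : Fin 2 → ℤ) i) :=
    fun i => by
      fin_cases i
      · exact hx
      · exact hP
  have h2 := rotate_pow_append (m := 2) (k := 1) (N := 2) rfl f (w := ![y]) (q := ![b]) hu'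
    (fun i => by fin_cases i; exact hy)
  have h3 : (fun i => Fin.append ![y] ![x, P w] (Fin.cast rfl i)) =
      Fin.snoc (α := fun _ => X) ![y, x] (P w) := by
    funext i
    fin_cases i <;> rfl
  have h4 : (fun i => Fin.append ![x, P w] ![y] (Fin.cast rfl i)) = ![x, P w, y] := by
    funext i
    fin_cases i <;> rfl
  rw [h3, h4] at h2
  rw [h1, insertLast_append h _ 1 P w hu, h2, ← mul_assoc, ← mul_assoc, ← negOnePow_add_cast,
    ← negOnePow_add_cast]
  congr 1
  refine negOnePow_congr ?_
  simp only [Fin.sum_univ_two, Fin.sum_univ_one, Fin.sum_cons, Matrix.cons_val_zero,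
    Matrix.cons_val_one]
  -- All signs involving `y` occur in pairs; what survives is |x|, the sign of the odd map `P`
  -- passing `x`.
  refine ⟨b * (a + ∑ i, q i) + b, ?_⟩
  ring

variable [T2Space M]

/-- The functional `(x₁, …, x_k, y) ↦ ⟨F (x₁, …, x_k), y⟩`. -/
noncomputable def fibreDist {k : ℕ} {F : MultilinearMap 𝕂 (fun _ : Fin k => W) W}
    (hF : IsLocalOperator F) : Dist (k + 1) (withAntifields W) :=
  ⟨fibreLinear F, (fibreLinear_local hF).continuous⟩

theorem fibreDist_apply {k : ℕ} {F : MultilinearMap 𝕂 (fun _ : Fin k => W) W}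
    (hF : IsLocalOperator F) (s : Fin (k + 1) → withAntifields W) :
    fibreDist hF s = -evalIntegral W (antifieldPart W (s (Fin.last k)))
      (F fun i => fieldPart W (s i.castSucc)) := rfl

theorem fieldPart_mem_deg {i : ℤ} {s : withAntifields W} (hs : s ∈ (withAntifields W).deg i) :
    fieldPart W s ∈ W.deg i := map_mem_deg (fieldPart_proj W) hs

theorem ofField_mem_deg {i : ℤ} {w : W} (hw : w ∈ W.deg i) :
    ofField W w ∈ (withAntifields W).deg i := map_mem_deg ofField_proj hw

theorem ofAntifield_antifieldPart_mem_deg {i : ℤ} {s : withAntifields W}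
    (hs : s ∈ (withAntifields W).deg i) :
    ofAntifield W (antifieldPart W s) ∈ (withAntifields W).deg i := by
  obtain ⟨s, rfl⟩ := hs
  exact ⟨ofAntifield W (antifieldPart W s), Prod.ext (map_zero (W.proj i)) rfl⟩

/-- A map raising the degree by one. -/
def RaisesDegree {k : ℕ} (F : MultilinearMap 𝕂 (fun _ : Fin k => W) W) : Prop :=
  ∀ (s : Fin k → W) (d : Fin k → ℤ), (∀ i, s i ∈ W.deg (d i)) → F s ∈ W.deg (∑ i, d i + 1)

/-- The degree gained by applying `F` is the degree of the integral pairing, since a field of degree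
j pairs only with antifields of degree 1−j. -/
theorem fibreDist_ofDegreeZero {k : ℕ} {F : MultilinearMap 𝕂 (fun _ : Fin k => W) W}
    (hF : IsLocalOperator F) (hd : RaisesDegree F) : (fibreDist hF).OfDegreeZero :=
  fun s d hs hne => by
    have h1 := hd (fun i => fieldPart W (s i.castSucc)) (fun i => d i.castSucc)
      fun i => fieldPart_mem_deg (hs _)
    have h2 := evalIntegral_of_mem_deg (hs (Fin.last k)) (ofField_mem_deg h1) (by
      rw [Fin.sum_univ_castSucc] at hne
      omega)
    rw [fibreDist_apply]
    rw [fieldPart_ofField] at h2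
    rw [h2, neg_zero]

/-- A functional that is linear in the antifields and takes the antifield in its last slot is not
changed by the cyclic sum when the last argument is a pure antifield: every proper rotation carries
that argument to a field slot, where its field part is zero. -/
theorem cycSum_fibreDist_ofAntifield {k : ℕ} {F : MultilinearMap 𝕂 (fun _ : Fin k => W) W}
    (hF : IsLocalOperator F) (s : Fin k → withAntifields W) (f : W.dual) :
    cycSum k (Ham.mk (fibreDist hF))
        (Fin.snoc (α := fun _ => withAntifields W) s (ofAntifield W f)) =
      -evalIntegral W f (F fun i => fieldPart W (s i)) := by
  -- Projecting the last slot onto the antifields turns the claim into an equality of functionals of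
  -- arbitrary arguments, which may be tested on homogeneous ones.
  let κ : withAntifields W →ₗ[SmoothFn n 𝕂 M] withAntifields W :=
    ofAntifield W ∘ₗ LinearMap.snd (SmoothFn n 𝕂 M) W W.dual
  let φ : Fin (k + 1) → withAntifields W →ₗ[SmoothFn n 𝕂 M] withAntifields W :=
    Fin.snoc (α := fun _ => withAntifields W →ₗ[SmoothFn n 𝕂 M] withAntifields W)
      (fun _ => LinearMap.id) κ
  have h1 : (cycSum k (Ham.mk (fibreDist hF))).compContinuousLinearMap (fun i => toCLM (φ i)) =
      (fibreDist hF).compContinuousLinearMap (fun i => toCLM (φ i)) := by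
    refine Dist.ext_of_mem_deg fun s d hs => ?_
    change cycSum k (Ham.mk (fibreDist hF)) (fun i => φ i (s i)) =
      fibreDist hF (fun i => φ i (s i))
    have ht : ∀ i, φ i (s i) ∈ (withAntifields W).deg (d i) := fun i => by
      induction i using Fin.lastCases with
      | last =>
        simp only [φ, Fin.snoc_last]
        exact ofAntifield_antifieldPart_mem_deg (hs _)
      | cast i =>
        simp only [φ, Fin.snoc_castSucc]
        exact hs _
    rw [cycSum_mk, _root_.sum_apply, Finset.sum_range_succ', Finset.sum_eq_zero fun j hj => ?_]
    · rw [zero_add]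
      rfl
    -- In the rotation by `j + 1` steps the last argument arrives in slot `j`, an argument of `F`.
    · have hj := Finset.mem_range.1 hj
      rw [rotate_pow_apply k _ _ _ d fun i => hasParity_of_mem_deg (ht i), fibreDist_apply,
        F.map_coord_zero ⟨j, hj⟩, evalIntegral_zero_right, neg_zero, mul_zero]
      have h2 : Fin.castSucc ⟨j, hj⟩ - Fin.ofNat (k + 1) (j + 1) = Fin.last k := by
        refine Fin.ext ?_
        simp only [Fin.sub_def, Fin.val_ofNat, Fin.val_castSucc, Fin.val_last]
        rw [Nat.mod_eq_of_lt (a := j + 1) (by omega),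
          show k + 1 - (j + 1) + j = k by omega, Nat.mod_eq_of_lt (by omega)]
      simp only [h2, φ, Fin.snoc_last]
      rfl
  have h2 := congrArg (fun g : Dist (k + 1) (withAntifields W) =>
    g (Fin.snoc (α := fun _ => withAntifields W) s (ofAntifield W f))) h1
  have h3 : (fun i => φ i (Fin.snoc (α := fun _ => withAntifields W) s (ofAntifield W f) i :
      withAntifields W)) = Fin.snoc (α := fun _ => withAntifields W) s (ofAntifield W f) := by
    funext i
    induction i using Fin.lastCases with
    | last =>
      simp only [φ, Fin.snoc_last]
      rfl
    | cast i =>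
      simp only [φ, Fin.snoc_castSucc]
      rfl
  change cycSum k (Ham.mk (fibreDist hF)) (fun i => φ i _) =
    fibreDist hF (fun i => φ i _) at h2
  rw [h3] at h2
  rw [h2, fibreDist_apply]
  simp only [Fin.snoc_last, Fin.snoc_castSucc]
  rfl

end FibreLinear

/-! ### The components of X^gauge and the identities expressing that it squares to zero. -/

section GaugeAlgebra

variable {n : ℕ} {𝕂 M : Type*} [RCLike 𝕂] [TopologicalSpace M]
  [ChartedSpace (EuclideanSpace ℝ (Fin n)) M] [CompactSpace M] [IsManifold (𝓡 n) ∞ M]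

variable {U V : GradedModule n 𝕂 M} {alg : LocalAlgebra U}

/-- The element `u + v` of `ΣU ⊕ V`. -/
def ghostPair (u : U) (v : V) : ghostsFields U V := ((u, v) : U × V)

variable (U V) in
/-- The projection of `ΣU ⊕ V` onto `ΣU`. -/
def toGhosts : ghostsFields U V →ₗ[SmoothFn n 𝕂 M] U := toU U V ∘ₗ desusp U V

theorem ghostsFields_ext {x y : ghostsFields U V} (h : toGhosts U V x = toGhosts U V y)
    (h' : toFields U V x = toFields U V y) : x = y := Prod.ext h h'

theorem toGhosts_ghostPair (u : U) (v : V) : toGhosts U V (ghostPair u v) = u := rfl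

theorem toFields_ghostPair (u : U) (v : V) : toFields U V (ghostPair u v) = v := rfl

theorem toGhosts_mem_deg {i : ℤ} {x : ghostsFields U V} (hx : x ∈ (ghostsFields U V).deg i) :
    toGhosts U V x ∈ U.deg (i + 1) := by
  obtain ⟨y, rfl⟩ := hx
  exact ⟨toGhosts U V y, rfl⟩

theorem toFields_mem_deg {i : ℤ} {x : ghostsFields U V} (hx : x ∈ (ghostsFields U V).deg i) :
    toFields U V x ∈ V.deg i := map_mem_deg (toFields_proj U V) hx

theorem ghostPair_mem_deg {i : ℤ} {u : U} {v : V} (hu : u ∈ U.deg (i + 1)) (hv : v ∈ V.deg i) :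
    ghostPair u v ∈ (ghostsFields U V).deg i := by
  refine ⟨ghostPair u v, ghostsFields_ext ?_ ?_⟩
  · change U.proj (i + 1) u = u
    rw [U.proj_of_mem_deg hu, if_pos rfl]
  · rw [toFields_proj, toFields_ghostPair, V.proj_of_mem_deg hv, if_pos rfl]

theorem GradedModule.parity_of_mem_deg (X : GradedModule n 𝕂 M) {i : ℤ} {x : X}
    (hx : x ∈ X.deg i) : X.parity x = ((i.negOnePow : ℤ) : 𝕂) • x := by
  rw [(hasParity_of_mem_deg hx).parity, Int.cast_smul_eq_zsmul]

theorem GradedModule.smul_mem_deg (X : GradedModule n 𝕂 M) {i : ℤ} {x : X} (c : 𝕂)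
    (hx : x ∈ X.deg i) : c • x ∈ X.deg i := by
  obtain ⟨y, rfl⟩ := hx
  exact ⟨c • y, LinearMap.map_smul_of_tower _ c y⟩

theorem negOnePow_succ_cast (i : ℤ) :
    (((i + 1).negOnePow : ℤ) : 𝕂) = -((i.negOnePow : ℤ) : 𝕂) := by
  rw [negOnePow_add_cast]
  simp

namespace TwistedLocalBimodule

variable (bim : TwistedLocalBimodule alg V)

theorem gaugeDiff_apply (x : ghostsFields U V) :
    bim.gaugeDiff x = ghostPair 0 (bim.d (toGhosts U V x)) := rfl

/-- Two signs meet: (-1)^|x| from the odd map Σ⁻¹ passing x, and (-1)^|u| from the definition of m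
on U ⊗ Σ⁻¹V, where the degree of u in U is |x|+1. Their product is −1, so the left action enters
with a sign independent of degrees, whereas the product of U and the right action keep (-1)^|x|. -/
theorem gaugeMul_apply {i : ℤ} {x : ghostsFields U V} (hx : x ∈ (ghostsFields U V).deg i)
    (y : ghostsFields U V) :
    bim.gaugeMul x y = ghostPair
      (((i.negOnePow : ℤ) : 𝕂) • alg.mul (toGhosts U V x) (toGhosts U V y))
      (-bim.left (toGhosts U V x) (toFields U V y) +
        ((i.negOnePow : ℤ) : 𝕂) • bim.right (toFields U V x) (toGhosts U V y)) := by
  have h1 : bim.gaugeMul x y =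
      ((i.negOnePow : ℤ) : 𝕂) • (bim.dgMul (desusp U V x) (desusp U V y) : dgSpace U V) := by
    change bim.dgMul ((ghostsFields U V).parity x) y = _
    rw [GradedModule.parity_of_mem_deg _ hx]
    exact (congrArg (fun L : dgSpace U V →ₗ[𝕂] dgSpace U V => L y)
      (map_smul bim.dgMul ((i.negOnePow : ℤ) : 𝕂) (desusp U V x)))
  have h2 : bim.dgMul (desusp U V x) (desusp U V y) =
      (alg.mul (toGhosts U V x) (toGhosts U V y),
        bim.left (U.parity (toGhosts U V x)) (toFields U V y) +
          bim.right (toFields U V x) (toGhosts U V y)) :=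
    bim.dgMul_apply (toGhosts U V x) (toGhosts U V y) (toFields U V x) (toFields U V y)
  rw [h1, h2, GradedModule.parity_of_mem_deg _ (toGhosts_mem_deg hx), negOnePow_succ_cast]
  refine ghostsFields_ext rfl ?_
  change ((i.negOnePow : ℤ) : 𝕂) • (bim.left (-((i.negOnePow : ℤ) : 𝕂) • toGhosts U V x)
    (toFields U V y) + bim.right (toFields U V x) (toGhosts U V y)) = _
  rw [map_smul, LinearMap.smul_apply, smul_add, smul_smul, mul_neg, negOnePow_mul_self, neg_smul,
    one_smul]
  rfl

theorem gaugeDiff_mem_deg {i : ℤ} {x : ghostsFields U V} (hx : x ∈ (ghostsFields U V).deg i) :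
    bim.gaugeDiff x ∈ (ghostsFields U V).deg (i + 1) := by
  rw [gaugeDiff_apply]
  exact ghostPair_mem_deg (zero_mem _) (bim.d_deg (toGhosts_mem_deg hx))

theorem gaugeMul_mem_deg {i j : ℤ} {x y : ghostsFields U V} (hx : x ∈ (ghostsFields U V).deg i)
    (hy : y ∈ (ghostsFields U V).deg j) :
    bim.gaugeMul x y ∈ (ghostsFields U V).deg (i + j + 1) := by
  rw [bim.gaugeMul_apply hx]
  refine ghostPair_mem_deg ?_ (add_mem (neg_mem ?_) ?_)
  · have := alg.mul_deg (toGhosts_mem_deg hx) (toGhosts_mem_deg hy)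
    rw [show i + 1 + (j + 1) = i + j + 1 + 1 by ring] at this
    exact U.smul_mem_deg _ this
  · have := bim.left_deg (toGhosts_mem_deg hx) (toFields_mem_deg hy)
    rwa [show i + 1 + j = i + j + 1 by ring] at this
  · have := bim.right_deg (toFields_mem_deg hx) (toGhosts_mem_deg hy)
    rw [show i + (j + 1) = i + j + 1 by ring] at this
    exact V.smul_mem_deg _ this

theorem gaugeDiff_gaugeDiff (x : ghostsFields U V) : bim.gaugeDiff (bim.gaugeDiff x) = 0 := by
  rw [gaugeDiff_apply, gaugeDiff_apply, toGhosts_ghostPair, map_zero]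
  rfl

/-- Only the V-component can be nonzero, and there the three terms are, up to (-1)^|x|, d(ab),
−(da)b and −a(db): the derivation property of d. -/
theorem gaugeDiff_gaugeMul {i : ℤ} {x y : ghostsFields U V}
    (hx : x ∈ (ghostsFields U V).deg i) :
    bim.gaugeDiff (bim.gaugeMul x y) + bim.gaugeMul (bim.gaugeDiff x) y +
      ((i.negOnePow : ℤ) : 𝕂) • bim.gaugeMul x (bim.gaugeDiff y) = 0 := by
  rw [bim.gaugeMul_apply hx, bim.gaugeMul_apply hx, bim.gaugeMul_apply (bim.gaugeDiff_mem_deg hx),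
    negOnePow_succ_cast]
  simp only [gaugeDiff_apply, toGhosts_ghostPair, toFields_ghostPair]
  refine ghostsFields_ext ?_ ?_
  · simp only [map_add, LinearMap.map_smul_of_tower, toGhosts_ghostPair, map_zero,
      LinearMap.zero_apply, smul_zero, add_zero]
  · simp only [map_add, LinearMap.map_smul_of_tower, toFields_ghostPair, map_zero,
      LinearMap.zero_apply, smul_zero, add_zero, neg_zero, zero_add, bim.d_mul, map_smul]
    module

/-- In the U-component this is associativity of the product. In the V-component it is the three
bimodule axioms, one for each position of the element of V among x, y, z. -/
theorem gaugeMul_gaugeMul {i j : ℤ} {x y z : ghostsFields U V}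
    (hx : x ∈ (ghostsFields U V).deg i) (hy : y ∈ (ghostsFields U V).deg j) :
    bim.gaugeMul (bim.gaugeMul x y) z +
      ((i.negOnePow : ℤ) : 𝕂) • bim.gaugeMul x (bim.gaugeMul y z) = 0 := by
  rw [bim.gaugeMul_apply (bim.gaugeMul_mem_deg hx hy), bim.gaugeMul_apply hx,
    bim.gaugeMul_apply hx, bim.gaugeMul_apply hy, negOnePow_succ_cast, negOnePow_add_cast]
  have hi := negOnePow_mul_self (𝕂 := 𝕂) i
  -- From here on the signs are scalars, and the only property needed is α² = 1.
  generalize ((i.negOnePow : ℤ) : 𝕂) = α at *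
  generalize ((j.negOnePow : ℤ) : 𝕂) = β at *
  simp only [toGhosts_ghostPair, toFields_ghostPair]
  refine ghostsFields_ext ?_ ?_
  · simp only [map_add, LinearMap.map_smul_of_tower, toGhosts_ghostPair, map_zero, map_smul,
      LinearMap.smul_apply, alg.mul_assoc, smul_smul]
    rw [← add_smul]
    convert zero_smul 𝕂 _
    ring
  · simp only [map_add, LinearMap.map_smul_of_tower, toFields_ghostPair, map_zero, map_smul,
      LinearMap.smul_apply, LinearMap.add_apply, LinearMap.neg_apply, map_neg, bim.left_assoc,
      bim.middle_assoc, bim.right_assoc, smul_smul, smul_add, smul_neg]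
    have h1 : α * (α * β) = β := by linear_combination β * hi
    have h2 : -(α * β) * α = -β := by linear_combination -β * hi
    simp only [h1, h2]
    module

theorem gaugeComponent_raisesDegree : ∀ k, RaisesDegree (bim.gaugeComponent k)
  | 0 => fun _ _ _ => zero_mem _
  | 1 => fun s d hs => by
    have := bim.gaugeDiff_mem_deg (hs 0)
    rwa [Fin.sum_univ_one]
  | 2 => fun s d hs => by
    have := bim.gaugeMul_mem_deg (hs 0) (hs 1)
    rwa [Fin.sum_univ_two]
  | _ + 3 => fun _ _ _ => zero_mem _

end TwistedLocalBimodule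

end GaugeAlgebra

/-! ### The vanishing of {S^gauge, S^gauge}. -/

section GaugeBracket

variable {n : ℕ} {𝕂 M : Type*} [RCLike 𝕂] [TopologicalSpace M]
  [ChartedSpace (EuclideanSpace ℝ (Fin n)) M] [CompactSpace M] [IsManifold (𝓡 n) ∞ M] [T2Space M]

variable {U V : GradedModule n 𝕂 M} {alg : LocalAlgebra U}

theorem evalIntegral_smul_right {W : GradedModule n 𝕂 M} (c : 𝕂)
    (f : W →ₗ[SmoothFn n 𝕂 M] Density n 𝕂 M) (w : W) :
    evalIntegral W f (c • w) = c * evalIntegral W f w := by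
  rw [evalIntegral, LinearMap.map_smul_of_tower]
  rfl

/-- For a functional reading only antifields in its last slot, the insertion of a field-valued `P`
there is zero. The other rotation inserts `P` in the first slot, and rotating the result restores
the order of the arguments. -/
theorem mk_insertLast_cycSum_one {X : GradedModule n 𝕂 M} {k N : ℕ} (h : 1 + k = N) {f : Dist 2 X}
    {P : ContinuousMultilinearMap 𝕂 (fun _ : Fin k => X) X} (h0 : insertLast h f 1 P = 0) :
    Ham.mk (insertLast h (cycSum 1 (Ham.mk f)) 1 P) =
      Ham.mk ((rotate N ^ 1) (insertLast h (rotate 2 f) 1 P)) := by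
  have h1 : insertLast h (cycSum 1 (Ham.mk f)) 1 P =
      insertLast h f 1 P + insertLast h (rotate 2 f) 1 P := by
    rw [cycSum_mk, Finset.sum_range_succ, Finset.sum_range_one]
    rfl
  rw [h1, h0, zero_add, Ham.mk_rotate_pow]

/-- As in the bilinear case, but with two surviving rotations, which insert `P` in the first and in
the middle slot. They are brought back to the original order of arguments by different rotations. -/
theorem mk_insertLast_cycSum_two {X : GradedModule n 𝕂 M} {k N : ℕ} (h : 2 + k = N) {f : Dist 3 X}
    {P : ContinuousMultilinearMap 𝕂 (fun _ : Fin k => X) X} (h0 : insertLast h f 1 P = 0) :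
    Ham.mk (insertLast h (cycSum 2 (Ham.mk f)) 1 P) =
      Ham.mk ((rotate N ^ 2) (insertLast h (rotate 3 f) 1 P)) +
        Ham.mk (rotate N (insertLast h ((rotate 3 ^ 2) f) 1 P)) := by
  have h1 : insertLast h (cycSum 2 (Ham.mk f)) 1 P =
      insertLast h f 1 P + insertLast h (rotate 3 f) 1 P +
        insertLast h ((rotate 3 ^ 2) f) 1 P := by
    rw [cycSum_mk, Finset.sum_range_succ, Finset.sum_range_succ, Finset.sum_range_one]
    rfl
  rw [h1, h0, zero_add, Ham.mk_rotate_pow, Ham.mk_rotate, map_add]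

/-! ### Vector fields with linear and quadratic components. -/

section Quadratic

variable {X : GradedModule n 𝕂 M} {P : ContinuousMultilinearMap 𝕂 (fun _ : Fin 1 => X) X}
  {Q : ContinuousMultilinearMap 𝕂 (fun _ : Fin 2 => X) X}

/-- This and the next three results are the normal forms of the insertions: the arguments keep their
order, and the only sign is that of the odd map passing the first argument when it is inserted in
the middle slot. -/
theorem rotate_insertLast_one_one (f : Dist 2 X)
    (hP : ∀ (w : Fin 1 → X) (q : Fin 1 → ℤ), (∀ i, w i ∈ X.deg (q i)) →
      P w ∈ X.deg (∑ i, q i + 1)) (s : Fin 2 → X)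
    (d : Fin 2 → ℤ) (hs : ∀ i, s i ∈ X.deg (d i)) :
    (rotate 2 ^ 1) (insertLast (m := 1) (k := 1) (N := 2) rfl (rotate 2 f) 1 P) s =
      f ![P ![s 0], s 1] := by
  have hs1 : s = fun i => Fin.append ![s 0] ![s 1] (Fin.cast rfl i) := by
    funext i
    fin_cases i <;> rfl
  have h1 := rotate_pow_insertLast_rotate (m := 1) (k := 1) (N := 1) rfl f (P := P) (w := ![s 0])
    (u := ![s 1]) (p := ![d 1]) (q := ![d 0]) (fun i => by fin_cases i; exact hs 1)
    (fun i => by fin_cases i; exact hs 0) (hP _ _ fun i => by fin_cases i; exact hs 0)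
  rw [← hs1] at h1
  exact h1

theorem rotate_insertLast_one_two (f : Dist 2 X)
    (hQ : ∀ (w : Fin 2 → X) (q : Fin 2 → ℤ), (∀ i, w i ∈ X.deg (q i)) →
      Q w ∈ X.deg (∑ i, q i + 1)) (s : Fin 3 → X)
    (d : Fin 3 → ℤ) (hs : ∀ i, s i ∈ X.deg (d i)) :
    (rotate 3 ^ 1) (insertLast (m := 1) (k := 2) (N := 3) rfl (rotate 2 f) 1 Q) s =
      f ![Q ![s 0, s 1], s 2] := by
  have hs1 : s = fun i => Fin.append ![s 0, s 1] ![s 2] (Fin.cast rfl i) := by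
    funext i
    fin_cases i <;> rfl
  have hw : ∀ i, (![s 0, s 1] : Fin 2 → X) i ∈ X.deg ((![d 0, d 1] : Fin 2 → ℤ) i) := fun i => by
    fin_cases i
    exacts [hs 0, hs 1]
  have h1 := rotate_pow_insertLast_rotate (m := 1) (k := 2) (N := 2) rfl f (P := Q)
    (w := ![s 0, s 1]) (u := ![s 2]) (p := ![d 2]) (q := ![d 0, d 1])
    (fun i => by fin_cases i; exact hs 2) hw (hQ _ _ hw)
  rw [← hs1] at h1
  exact h1

theorem rotate_insertLast_two_one (f : Dist 3 X)
    (hP : ∀ (w : Fin 1 → X) (q : Fin 1 → ℤ), (∀ i, w i ∈ X.deg (q i)) →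
      P w ∈ X.deg (∑ i, q i + 1)) (s : Fin 3 → X)
    (d : Fin 3 → ℤ) (hs : ∀ i, s i ∈ X.deg (d i)) :
    (rotate 3 ^ 2) (insertLast (m := 2) (k := 1) (N := 3) rfl (rotate 3 f) 1 P) s =
        f ![P ![s 0], s 1, s 2] ∧
      rotate 3 (insertLast (m := 2) (k := 1) (N := 3) rfl ((rotate 3 ^ 2) f) 1 P) s =
        (((d 0).negOnePow : ℤ) : 𝕂) * f ![s 0, P ![s 1], s 2] := by
  have hs1 : s = fun i => Fin.append ![s 0] ![s 1, s 2] (Fin.cast rfl i) := by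
    funext i
    fin_cases i <;> rfl
  have hs2 : s = Fin.snoc (α := fun _ => X) (Fin.cons (α := fun _ => X) (s 0) ![s 1]) (s 2) := by
    funext i
    fin_cases i <;> rfl
  have h1 := rotate_pow_insertLast_rotate (m := 2) (k := 1) (N := 2) rfl f (P := P) (w := ![s 0])
    (u := ![s 1, s 2]) (p := ![d 1, d 2]) (q := ![d 0])
    (fun i => by fin_cases i; exacts [hs 1, hs 2]) (fun i => by fin_cases i; exact hs 0)
    (hP _ _ fun i => by fin_cases i; exact hs 0)
  have h2 := rotate_insertLast_rotate_two (k := 1) rfl f (P := P) (w := ![s 1]) (q := ![d 1])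
    (hs 0) (hs 2) (fun i => by fin_cases i; exact hs 1)
    (hP _ _ fun i => by fin_cases i; exact hs 1)
  rw [← hs1] at h1
  rw [← hs2] at h2
  exact ⟨h1, h2⟩

theorem rotate_insertLast_two_two (f : Dist 3 X)
    (hQ : ∀ (w : Fin 2 → X) (q : Fin 2 → ℤ), (∀ i, w i ∈ X.deg (q i)) →
      Q w ∈ X.deg (∑ i, q i + 1)) (s : Fin 4 → X)
    (d : Fin 4 → ℤ) (hs : ∀ i, s i ∈ X.deg (d i)) :
    (rotate 4 ^ 2) (insertLast (m := 2) (k := 2) (N := 4) rfl (rotate 3 f) 1 Q) s =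
        f ![Q ![s 0, s 1], s 2, s 3] ∧
      rotate 4 (insertLast (m := 2) (k := 2) (N := 4) rfl ((rotate 3 ^ 2) f) 1 Q) s =
        (((d 0).negOnePow : ℤ) : 𝕂) * f ![s 0, Q ![s 1, s 2], s 3] := by
  have hs1 : s = fun i => Fin.append ![s 0, s 1] ![s 2, s 3] (Fin.cast rfl i) := by
    funext i
    fin_cases i <;> rfl
  have hs2 : s =
      Fin.snoc (α := fun _ => X) (Fin.cons (α := fun _ => X) (s 0) ![s 1, s 2]) (s 3) := by
    funext i
    fin_cases i <;> rfl
  have hw : ∀ i, (![s 0, s 1] : Fin 2 → X) i ∈ X.deg ((![d 0, d 1] : Fin 2 → ℤ) i) := fun i => by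
    fin_cases i
    exacts [hs 0, hs 1]
  have hw' : ∀ i, (![s 1, s 2] : Fin 2 → X) i ∈ X.deg ((![d 1, d 2] : Fin 2 → ℤ) i) := fun i => by
    fin_cases i
    exacts [hs 1, hs 2]
  have hu : ∀ i, (![s 2, s 3] : Fin 2 → X) i ∈ X.deg ((![d 2, d 3] : Fin 2 → ℤ) i) := fun i => by
    fin_cases i
    exacts [hs 2, hs 3]
  have h1 := rotate_pow_insertLast_rotate (m := 2) (k := 2) (N := 3) rfl f (P := Q)
    (w := ![s 0, s 1]) (u := ![s 2, s 3]) (p := ![d 2, d 3]) (q := ![d 0, d 1]) hu hw (hQ _ _ hw)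
  have h2 := rotate_insertLast_rotate_two (k := 2) rfl f (P := Q) (w := ![s 1, s 2])
    (q := ![d 1, d 2]) (hs 0) (hs 3) hw' (hQ _ _ hw')
  rw [← hs1] at h1
  rw [← hs2] at h2
  exact ⟨h1, h2⟩

/-- A linear-plus-quadratic vector field of square zero annihilates the functional that is
linear along the fibres and has it as its components. -/
theorem act_eq_zero_of_quadratic {Y : VectorField X} {S : KontHam X} {f : Dist 2 X} {g : Dist 3 X}
    (hf : S 2 = Ham.mk f) (hg : S 3 = Ham.mk g) (h0 : cycSum 0 (S 1) = 0)
    (h3 : ∀ m, cycSum (m + 3) (S (m + 4)) = 0) (hY0 : ∀ s, Y 0 s = 0)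
    (hY3 : ∀ k s, Y (k + 3) s = 0)
    (hY : ∀ (k : ℕ) (w : Fin k → X) (q : Fin k → ℤ), (∀ i, w i ∈ X.deg (q i)) →
      Y k w ∈ X.deg (∑ i, q i + 1))
    (hfY : ∀ {k N : ℕ} (h : 1 + k = N), insertLast h f 1 (Y k) = 0)
    (hgY : ∀ {k N : ℕ} (h : 2 + k = N), insertLast h g 1 (Y k) = 0)
    (e2 : ∀ x y, f ![Y 1 ![x], y] = 0)
    (e3 : ∀ (x y z : X) (i : ℤ), x ∈ X.deg i → g ![Y 1 ![x], y, z] +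
      ((i.negOnePow : ℤ) : 𝕂) * g ![x, Y 1 ![y], z] + f ![Y 2 ![x, y], z] = 0)
    (e4 : ∀ (x y z t : X) (i j : ℤ), x ∈ X.deg i → y ∈ X.deg j → g ![Y 2 ![x, y], z, t] +
      ((i.negOnePow : ℤ) : 𝕂) * g ![x, Y 2 ![y, z], t] = 0) :
    act 1 Y S = 0 := by
  have hS : ∀ {m : ℕ} k N, cycSum m (S (m + 1)) = 0 → actTerm 1 Y S m k N = 0 :=
    fun {m} k N hm => by
      by_cases hN : m + k = N
      · rw [actTerm_eq _ _ _ hN, hm]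
        exact map_zero _
      · exact dif_neg hN
  have hf' : ∀ {k N : ℕ} (h : 1 + k = N), actTerm 1 Y S 1 k N =
      Ham.mk ((rotate N ^ 1) (insertLast h (rotate 2 f) 1 (Y k))) := fun h => by
    rw [actTerm_eq _ _ _ h]
    change Ham.mk (insertLast h (cycSum 1 (S 2)) 1 _) = _
    rw [hf]
    exact mk_insertLast_cycSum_one h (hfY h)
  have hg' : ∀ {k N : ℕ} (h : 2 + k = N), actTerm 1 Y S 2 k N =
      Ham.mk ((rotate N ^ 2) (insertLast h (rotate 3 g) 1 (Y k)) +
        rotate N (insertLast h ((rotate 3 ^ 2) g) 1 (Y k))) := fun h => by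
    rw [actTerm_eq _ _ _ h]
    change Ham.mk (insertLast h (cycSum 2 (S 3)) 1 _) = _
    rw [hg, map_add]
    exact mk_insertLast_cycSum_two h (hgY h)
  funext N
  rw [Pi.zero_apply]
  match N with
  | 0 => rw [act_zero_eq, hS _ _ h0]
  | 1 => rw [act_one_eq, actTerm_eq_zero _ _ _ _ hY0, hS _ _ h0, zero_add]
  | 2 =>
    -- With two arguments only `Y 1` inserted into `f` occurs: the square of the linear part.
    rw [act_add_two_eq 1 hY3, actTerm_eq_zero _ _ _ _ hY0]
    refine (congrArg₂ (· + ·) (zero_add _) (hS 2 2 h0)).trans ((add_zero _).trans ?_)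
    refine (hf' (k := 1) (N := 2) rfl).trans ?_
    refine (congrArg _ (Dist.ext_of_mem_deg fun s d hs => ?_)).trans (map_zero Ham.mk)
    rw [rotate_insertLast_one_one f (hY 1) s d hs]
    exact e2 _ _
  | 3 =>
    -- With three arguments, `Y 1` inserted into `g` and `Y 2` into `f`: the Leibniz rule.
    rw [act_add_two_eq 1 hY3, actTerm_eq_zero _ _ _ _ hY0]
    refine (congrArg₂ (· + ·) ((zero_add _).trans (hg' (k := 1) (N := 3) rfl))
      (hf' (k := 2) (N := 3) rfl)).trans ?_
    rw [← map_add]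
    refine (congrArg _ (Dist.ext_of_mem_deg fun s d hs => ?_)).trans (map_zero Ham.mk)
    have h1 := rotate_insertLast_two_one g (hY 1) s d hs
    refine (congrArg₂ (· + ·) (congrArg₂ (· + ·) h1.1 h1.2)
      (rotate_insertLast_one_two f (hY 2) s d hs)).trans ?_
    exact e3 _ _ _ _ (hs 0)
  | 4 =>
    -- With four arguments, `Y 2` inserted into `g`: associativity.
    rw [act_add_two_eq 1 hY3, actTerm_eq_zero _ _ _ _ hY0]
    refine (congrArg₂ (· + ·) ((zero_add _).trans (hS 1 4 (h3 0)))
      (hg' (k := 2) (N := 4) rfl)).trans ((zero_add _).trans ?_)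
    refine (congrArg _ (Dist.ext_of_mem_deg fun s d hs => ?_)).trans (map_zero Ham.mk)
    have h1 := rotate_insertLast_two_two g (hY 2) s d hs
    refine (congrArg₂ (· + ·) h1.1 h1.2).trans ?_
    exact e4 _ _ _ _ _ _ (hs 0) (hs 1)
  | N + 5 =>
    -- With five or more arguments only components of `S` in at least four arguments could
    -- contribute, and their cyclic sums are zero.
    rw [act_add_two_eq 1 hY3, actTerm_eq_zero _ _ _ _ hY0, hS _ _ (h3 (N + 1)), hS _ _ (h3 N),
      zero_add, zero_add]

end Quadratic

namespace TwistedLocalBimodule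

variable (bim : TwistedLocalBimodule alg V)

theorem gaugeAction_succ (k : ℕ) :
    bim.gaugeAction (k + 1) = Ham.mk (fibreDist (bim.gaugeComponent_local k)) := rfl

theorem gaugeAction_local : IsLocal bim.gaugeAction
  | 0 => ⟨0, IsLocalDistribution.zero, map_zero _⟩
  | k + 1 => ⟨fibreDist (bim.gaugeComponent_local k),
      fibreLinear_local (bim.gaugeComponent_local k), rfl⟩

theorem gaugeAction_isDegreeZero : IsDegreeZero bim.gaugeAction
  | 0 => ⟨0, fun _ _ _ _ => rfl, map_zero _⟩
  | k + 1 => ⟨fibreDist (bim.gaugeComponent_local k),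
      fibreDist_ofDegreeZero _ (bim.gaugeComponent_raisesDegree k), rfl⟩

theorem exists_gauge_hamiltonianField :
    ∃ Y, IsHamiltonianField bim.gaugeAction Y ∧ ∀ k s,
      fieldPart (ghostsFields U V) (Y k s) =
        bim.gaugeComponent k fun i => fieldPart (ghostsFields U V) (s i) :=
  exists_hamiltonianField bim.gaugeAction_local bim.gaugeComponent_local fun l s f =>
    cycSum_fibreDist_ofAntifield (bim.gaugeComponent_local l) s f

theorem cycSum_gaugeAction_eq_zero {m : ℕ} (h : bim.gaugeComponent m = 0) :
    cycSum m (bim.gaugeAction (m + 1)) = 0 := by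
  have h1 : fibreDist (bim.gaugeComponent_local m) = 0 := ContinuousMultilinearMap.ext fun s => by
    rw [fibreDist_apply, h]
    exact neg_eq_zero.2 (evalIntegral_zero_right _)
  rw [gaugeAction_succ, h1, map_zero, map_zero]

theorem fibreDist_gaugeDiff (x a : withAntifields (ghostsFields U V)) :
    fibreDist (bim.gaugeComponent_local 1)
        (Fin.cons (α := fun _ => withAntifields (ghostsFields U V)) x ![a]) =
      -evalIntegral (ghostsFields U V) (antifieldPart _ a) (bim.gaugeDiff (fieldPart _ x)) := rfl

theorem fibreDist_gaugeMul (x a b : withAntifields (ghostsFields U V)) :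
    fibreDist (bim.gaugeComponent_local 2)
        (Fin.cons (α := fun _ => withAntifields (ghostsFields U V)) x ![a, b]) =
      -evalIntegral (ghostsFields U V) (antifieldPart _ b)
        (bim.gaugeMul (fieldPart _ x) (fieldPart _ a)) := rfl

/-- The bracket of `S^gauge` with itself, restricted to the field components of its symplectic
vector field. -/
theorem act_gaugeAction_of_fields {Y : VectorField (withAntifields (ghostsFields U V))}
    (hY : ∀ k s, Y k s = ofField (ghostsFields U V)
      (bim.gaugeComponent k fun i => fieldPart (ghostsFields U V) (s i))) :
    act 1 Y bim.gaugeAction = 0 := by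
  -- The last slot of the functional reads antifield parts, while `Y` takes values in the fields.
  have hfib : ∀ {m k N : ℕ} (h : m + k = N),
      insertLast h (fibreDist (bim.gaugeComponent_local m)) 1 (Y k) = 0 := fun {m k N} h =>
    ContinuousMultilinearMap.ext fun s => by
      change fibreDist (bim.gaugeComponent_local m) (Fin.snoc (α := fun _ => _) _ _) = 0
      rw [fibreDist_apply, Fin.snoc_last, hY]
      exact neg_zero
  have hY1 : ∀ a, fieldPart _ (Y 1 ![a]) = bim.gaugeDiff (fieldPart _ a) := fun a => by
    rw [hY]
    rfl
  have hY2 : ∀ a b, fieldPart _ (Y 2 ![a, b]) =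
      bim.gaugeMul (fieldPart _ a) (fieldPart _ b) := fun a b => by
    rw [hY]
    rfl
  -- The remaining equations are d² = 0, the Leibniz rule and associativity for X^gauge, paired with
  -- the antifield part of the last argument.
  refine act_eq_zero_of_quadratic (bim.gaugeAction_succ 1) (bim.gaugeAction_succ 2)
    (bim.cycSum_gaugeAction_eq_zero rfl) (fun m => bim.cycSum_gaugeAction_eq_zero rfl)
    (fun s => (hY 0 s).trans (map_zero _)) (fun k s => (hY _ s).trans (map_zero _))
    (fun k w q hw => ?_) (fun h => hfib h) (fun h => hfib h) (fun x y => ?_)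
    (fun x y z i hx => ?_) fun x y z t i j hx hy => ?_
  · rw [hY]
    exact ofField_mem_deg (bim.gaugeComponent_raisesDegree k _ q fun i => fieldPart_mem_deg (hw i))
  · refine (bim.fibreDist_gaugeDiff _ _).trans ?_
    rw [hY1, gaugeDiff_gaugeDiff, evalIntegral_zero_right, neg_zero]
  · have h1 := congrArg (evalIntegral _ (antifieldPart _ z))
      (bim.gaugeDiff_gaugeMul (y := fieldPart _ y) (fieldPart_mem_deg hx))
    rw [evalIntegral_add_right, evalIntegral_add_right, evalIntegral_smul_right,
      evalIntegral_zero_right, ← hY1, ← hY1, ← hY2] at h1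
    refine (congrArg₂ (· + ·) (congrArg₂ (· + ·) (bim.fibreDist_gaugeMul _ _ _)
      (congrArg _ (bim.fibreDist_gaugeMul _ _ _))) (bim.fibreDist_gaugeDiff _ _)).trans ?_
    linear_combination -h1
  · have h1 := congrArg (evalIntegral _ (antifieldPart _ t))
      (bim.gaugeMul_gaugeMul (z := fieldPart _ z) (fieldPart_mem_deg hx) (fieldPart_mem_deg hy))
    rw [evalIntegral_add_right, evalIntegral_smul_right, evalIntegral_zero_right] at h1
    refine (congrArg₂ (· + ·) (bim.fibreDist_gaugeMul _ _ _)
      (congrArg _ (bim.fibreDist_gaugeMul _ _ _))).trans ?_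
    rw [hY2, hY2]
    linear_combination -h1

/-- The field and antifield components of Y contribute equally, by the same exchange of blocks that
makes the bracket symmetric. The contribution of the field component is already known to vanish, so
the explicit form of the antifield component is never needed. -/
theorem act_gaugeAction {Y : VectorField (withAntifields (ghostsFields U V))}
    (hY : IsHamiltonianField bim.gaugeAction Y)
    (hF : ∀ k s, fieldPart (ghostsFields U V) (Y k s) =
      bim.gaugeComponent k fun i => fieldPart (ghostsFields U V) (s i)) :
    act 1 Y bim.gaugeAction = 0 := by
  let Y₁ : VectorField (withAntifields (ghostsFields U V)) := fun k =>
    (toCLM (ofField (ghostsFields U V) ∘ₗ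
      fieldPart (ghostsFields U V))).compContinuousMultilinearMap (Y k)
  let Y₂ : VectorField (withAntifields (ghostsFields U V)) := fun k =>
    (toCLM (ofAntifield (ghostsFields U V) ∘ₗ LinearMap.snd (SmoothFn n 𝕂 M) (ghostsFields U V)
      (ghostsFields U V).dual)).compContinuousMultilinearMap (Y k)
  have h1 : ∀ k s, Y₁ k s = ofField (ghostsFields U V) (fieldPart (ghostsFields U V) (Y k s)) :=
    fun k s => rfl
  have h2 : ∀ k s, Y₂ k s =
      ofAntifield (ghostsFields U V) (antifieldPart (ghostsFields U V) (Y k s)) := fun k s => rfl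
  have h3 : ∀ k s, Y₁ k s = ofField (ghostsFields U V)
      (bim.gaugeComponent k fun i => fieldPart (ghostsFields U V) (s i)) := fun k s => by
    rw [h1, hF]
  -- ⟨Y(u), Y₂(w)⟩ and ⟨Y(w), Y₁(u)⟩ are both, up to opposite signs, the integral of the antifield
  -- part of Y(w) evaluated on the field part of Y(u).
  have h4 : act 1 Y₂ bim.gaugeAction = act 1 Y₁ bim.gaugeAction := by
    refine act_eq_of_swap fun {m k N} hN hN' =>
      Ham.mk_insertLast_comm hN hN' fun u w p q hu hw => ⟨?_, fun h0 => ?_⟩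
    · rw [hY.cycSum_snoc, hY.cycSum_snoc, pairing_apply, pairing_apply, h1]
      have h5 : fieldPart (ghostsFields U V) (Y₂ k w) = 0 := rfl
      have h6 : antifieldPart (ghostsFields U V) (Y₂ k w) =
          antifieldPart (ghostsFields U V) (Y k w) := rfl
      rw [h5, h6, antifieldPart_ofField, fieldPart_ofField, evalIntegral_zero_right,
        evalIntegral_zero_left, zero_sub, sub_zero]
    · by_contra hne
      refine h0 (bim.gaugeAction_isDegreeZero.cycSum k _
        -- The field component of Y is X^gauge, which raises the degree by one. Since S^gauge has
        -- degree zero, the value vanishes unless |w| + |u| + 1 = 0.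
        (Fin.snoc (α := fun _ => ℤ) q (∑ i, p i + 1)) (fun l => ?_) ?_)
      · induction l using Fin.lastCases with
        | last =>
          rw [Fin.snoc_last, Fin.snoc_last, h3]
          exact ofField_mem_deg
            (bim.gaugeComponent_raisesDegree m _ p fun i => fieldPart_mem_deg (hu i))
        | cast l => rw [Fin.snoc_castSucc, Fin.snoc_castSucc]; exact hw l
      · rw [Fin.sum_univ_castSucc]
        simp only [Fin.snoc_castSucc, Fin.snoc_last]
        omega
  rw [act_of_add 1 (Y' := Y₁) (Y'' := Y₂) (fun k s => (ofField_add_ofAntifield _).symm), h4,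
    bim.act_gaugeAction_of_fields h3]
  exact add_zero (0 : KontHam (withAntifields (ghostsFields U V)))

end TwistedLocalBimodule

end GaugeBracket

/-! ### The master equation for S^V and for S^gauge + S^V. -/

section MasterEquation

variable {n : ℕ} {𝕂 M : Type*} [RCLike 𝕂] [TopologicalSpace M]
  [ChartedSpace (EuclideanSpace ℝ (Fin n)) M] [CompactSpace M] [IsManifold (𝓡 n) ∞ M]

theorem act_eq_zero_of_eq_zero {X : GradedModule n 𝕂 M} (j : ℤ) {Y : VectorField X}
    (hY : ∀ k s, Y k s = 0) (h : KontHam X) : act j Y h = 0 := by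
  funext N
  rw [act_eq_sum_actTerm]
  exact Finset.sum_eq_zero fun k _ => actTerm_eq_zero j h _ _ (hY k)

theorem cycSum_add {X : GradedModule n 𝕂 M} {h h' : KontHam X} (m : ℕ) :
    cycSum m ((h + h') (m + 1)) = cycSum m (h (m + 1)) + cycSum m (h' (m + 1)) := map_add _ _ _

theorem IsLocal.add {X : GradedModule n 𝕂 M} {h h' : KontHam X} (hh : IsLocal h)
    (hh' : IsLocal h') : IsLocal (h + h') := fun N => by
  obtain ⟨f, hf, hfh⟩ := hh N
  obtain ⟨f', hf', hfh'⟩ := hh' N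
  exact ⟨f + f', hf.add hf', by rw [map_add, hfh, hfh', Pi.add_apply]⟩

/-- The master equation in terms of one given symplectic vector field. -/
theorem satisfiesCME_iff {W : GradedModule n 𝕂 M} {S : KontHam (withAntifields W)}
    (hS : IsDegreeZero S) {Y : VectorField (withAntifields W)} (hY : IsHamiltonianField S Y) :
    SatisfiesCME S ↔ act 1 Y S = 0 :=
  -- Symmetry of the bracket of `S` with itself shows that any two symplectic vector fields of `S`
  -- act on it in the same way; uniqueness of the field is not needed.
  ⟨fun ⟨_, _, hY', h0⟩ => (act_comm hS hS hY hY').trans h0, fun h => ⟨hS, Y, hY, h⟩⟩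

variable {U V : GradedModule n 𝕂 M} {alg : LocalAlgebra U}

theorem IsLocal.onAll {S : KontHam V} (hS : IsLocal S) : IsLocal (onAll U S) :=
  (hS.pullback (toFields_proj U V)).pullback (fieldPart_proj _)

theorem IsDegreeZero.onAll {S : KontHam V} (hS : IsDegreeZero S) : IsDegreeZero (onAll U S) :=
  (hS.pullback (toFields_proj U V)).pullback (fieldPart_proj _)

theorem cycSum_onAll_ofAntifield (S : KontHam V) (l : ℕ)
    (s : Fin l → withAntifields (ghostsFields U V)) (f : (ghostsFields U V).dual) :
    cycSum l (onAll U S (l + 1))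
      (Fin.snoc (α := fun _ => withAntifields (ghostsFields U V)) s (ofAntifield _ f)) = 0 := by
  rw [NCBV.onAll, cycSum_pullback]
  refine (cycSum l (onFields U S (l + 1))).map_coord_zero (Fin.last l) ?_
  exact (congrArg (fieldPart (ghostsFields U V)) (Fin.snoc_last _ _)).trans
    (fieldPart_ofAntifield f)

variable [T2Space M]

/-- The functional does not involve antifields, so it has a symplectic vector field with zero field
component. Such a field is related to the zero vector field by the projection onto the fields, hence
annihilates everything pulled back from there. -/
theorem satisfiesCME_onAll {S : KontHam V} (hS : IsLocal S) (hS' : IsDegreeZero S) :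
    SatisfiesCME (onAll U S) := by
  obtain ⟨Y, hY, hY'⟩ := exists_hamiltonianField (hS.onAll (U := U)) (F := fun _ => 0)
    (fun _ => IsLocalOperator.zero) fun l s f => by
      rw [cycSum_onAll_ofAntifield]
      exact (neg_eq_zero.2 (evalIntegral_zero_right f)).symm
  refine ⟨hS'.onAll, Y, hY, ?_⟩
  rw [NCBV.onAll, act_pullback (fieldPart_proj _) 1 (Q := fun _ => 0) hY',
    act_eq_zero_of_eq_zero 1 fun _ _ => rfl, KontHam.pullback_zero]

/-- The master equation for `S^gauge + S` amounts to the gauge invariance of `S`. -/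
theorem TwistedLocalBimodule.satisfiesCME_iff_act_gauge (bim : TwistedLocalBimodule alg V)
    {S : KontHam V} (hS : IsLocal S) (hS' : IsDegreeZero S) :
    SatisfiesCME (bim.gaugeAction + onAll U S) ↔ act 1 bim.gauge (onFields U S) = 0 := by
  have hd := bim.gaugeAction_isDegreeZero.add (hS'.onAll (U := U))
  obtain ⟨Y, hY, hYF⟩ := exists_hamiltonianField (bim.gaugeAction_local.add (hS.onAll (U := U)))
    bim.gaugeComponent_local fun l s f => by
      rw [cycSum_add, add_apply, cycSum_onAll_ofAntifield, add_zero]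
      exact cycSum_fibreDist_ofAntifield (bim.gaugeComponent_local l) s f
  obtain ⟨Z, hZ, hZF⟩ := bim.exists_gauge_hamiltonianField
  -- Any vector field with field component X^gauge is related to X^gauge by the projection, whatever
  -- its antifield component.
  have h1 : ∀ P : VectorField (withAntifields (ghostsFields U V)),
      (∀ k s, fieldPart (ghostsFields U V) (P k s) =
        bim.gaugeComponent k fun i => fieldPart (ghostsFields U V) (s i)) →
      act 1 P (onAll U S) =
        (act 1 bim.gauge (onFields U S)).pullback (fieldPart _) (fieldPart_proj _) :=
    fun P hP => act_pullback (fieldPart_proj _) 1 (Q := bim.gauge) hP _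
  -- Symmetry replaces the field `Y` of the sum acting on S^gauge by the field `Z` of S^gauge acting
  -- on the sum, where the contribution of S^gauge itself vanishes.
  have h2 : act 1 Y bim.gaugeAction =
      (act 1 bim.gauge (onFields U S)).pullback (fieldPart _) (fieldPart_proj _) := by
    rw [act_comm hd bim.gaugeAction_isDegreeZero hY hZ, act_add_right, bim.act_gaugeAction hZ hZF,
      h1 Z hZF]
    exact zero_add (_ : KontHam (withAntifields (ghostsFields U V)))
  rw [satisfiesCME_iff hd hY, act_add_right, h2, h1 Y hYF]
  constructor
  · intro h
    refine KontHam.pullback_eq_zero (fieldPart_proj _) ofField_proj fieldPart_ofField ?_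
    refine funext fun N => ?_
    have h3 := congrFun h N
    -- {S,S} is twice the pullback of X^gauge S^V, and 2 is invertible.
    rw [Pi.add_apply, ← two_smul 𝕂] at h3
    exact (smul_eq_zero.1 h3).resolve_left two_ne_zero
  · intro h
    rw [h, KontHam.pullback_zero]
    exact add_zero (0 : KontHam (withAntifields (ghostsFields U V)))

end MasterEquation

/-! ### Evaluation of insertions and rotations on separated arguments. -/

section Invariance

variable {n : ℕ} {𝕂 M : Type*} [RCLike 𝕂] [TopologicalSpace M]
  [ChartedSpace (EuclideanSpace ℝ (Fin n)) M] [CompactSpace M] [IsManifold (𝓡 n) ∞ M]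

variable {X Y : GradedModule n 𝕂 M}

theorem insertLast_snoc {m : ℕ} (f : Dist (m + 1) X) (j : ℤ)
    (P : ContinuousMultilinearMap 𝕂 (fun _ : Fin 1 => X) X) {w : Fin m → X} (x : X)
    {p : Fin m → ℤ} (hw : ∀ i, w i ∈ X.deg (p i)) :
    insertLast (m := m) (k := 1) (N := m + 1) rfl f j P (Fin.snoc (α := fun _ => X) w x) =
      (((j * ∑ i, p i).negOnePow : ℤ) : 𝕂) * f (Fin.snoc (α := fun _ => X) w (P ![x])) := by
  have h1 := insertLast_append (N := m + 1) rfl f j P ![x] hw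
  rw [Fin.append_right_eq_snoc] at h1
  exact h1

theorem insertLast_snoc_snoc {m : ℕ} (f : Dist (m + 1) X) (j : ℤ)
    (P : ContinuousMultilinearMap 𝕂 (fun _ : Fin 2 => X) X) {w : Fin m → X} (x y : X)
    {p : Fin m → ℤ} (hw : ∀ i, w i ∈ X.deg (p i)) :
    insertLast (m := m) (k := 2) (N := m + 2) rfl f j P
        (Fin.snoc (α := fun _ => X) (Fin.snoc (α := fun _ => X) w x) y) =
      (((j * ∑ i, p i).negOnePow : ℤ) : 𝕂) * f (Fin.snoc (α := fun _ => X) w (P ![x, y])) := by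
  have h1 := insertLast_append (N := m + 2) rfl f j P ![x, y] hw
  have h2 : (Fin.snoc (α := fun _ => X) (Fin.snoc (α := fun _ => X) w x) y : Fin (m + 2) → X) =
      fun i => Fin.append w ![x, y] (Fin.cast rfl i) := by
    funext i
    induction i using Fin.lastCases with
    | last =>
      rw [Fin.snoc_last]
      exact (Fin.append_right w ![x, y] 1).symm
    | cast i =>
      rw [Fin.snoc_castSucc]
      induction i using Fin.lastCases with
      | last =>
        rw [Fin.snoc_last]
        exact (Fin.append_right w ![x, y] 0).symm
      | cast i =>
        rw [Fin.snoc_castSucc]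
        exact (Fin.append_left w ![x, y] i).symm
  rw [h2]
  exact h1

theorem Dist.pullback_snoc {m : ℕ} (φ : X →ₗ[SmoothFn n 𝕂 M] Y) (f : Dist (m + 1) Y)
    (w : Fin m → X) (x : X) :
    Dist.pullback φ f (Fin.snoc (α := fun _ => X) w x) =
      f (Fin.snoc (α := fun _ => Y) (fun i => φ (w i)) (φ x)) := by
  rw [Dist.pullback_apply]
  congr 1
  funext i
  induction i using Fin.lastCases with
  | last => rw [Fin.snoc_last, Fin.snoc_last]
  | cast i => rw [Fin.snoc_castSucc, Fin.snoc_castSucc]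

theorem rotate_pow_snoc_cons {m : ℕ} (f : Dist (m + 2) X) {w : Fin m → X} {x y : X}
    {p : Fin m → ℤ} {q e : ℤ} (hw : ∀ i, w i ∈ X.deg (p i)) (hx : x ∈ X.deg e)
    (hy : y ∈ X.deg q) :
    (rotate (m + 2) ^ (m + 1)) f
        (Fin.snoc (α := fun _ => X) (Fin.cons (α := fun _ => X) y w) x) =
      (((((∑ i, p i + e) * q).negOnePow : ℤ)) : 𝕂) *
        f (Fin.snoc (α := fun _ => X) (Fin.snoc (α := fun _ => X) w x) y) := by
  have h1 := rotate_pow_append (m := m + 1) (k := 1) (N := m + 1) rfl f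
    (u := Fin.snoc (α := fun _ => X) w x) (p := Fin.snoc (α := fun _ => ℤ) p e) (w := ![y])
    (q := ![q]) (fun i => by
      induction i using Fin.lastCases with
      | last => rw [Fin.snoc_last, Fin.snoc_last]; exact hx
      | cast i => rw [Fin.snoc_castSucc, Fin.snoc_castSucc]; exact hw i)
    (fun i => by fin_cases i; exact hy)
  rw [Fin.sum_univ_castSucc, Fin.sum_univ_one] at h1
  simp only [Fin.snoc_castSucc, Fin.snoc_last] at h1
  rw [Fin.append_right_eq_snoc, Fin.append_left_eq_cons, Fin.cons_snoc_eq_snoc_cons] at h1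
  exact h1

/-- A functional that is trivial modulo cyclic permutations vanishes on homogeneous arguments all
of whose proper rotations it annihilates. -/
theorem Dist.apply_eq_zero_of_mk_eq_zero {m : ℕ} {f : Dist (m + 1) X} (hf : Ham.mk f = 0)
    {s : Fin (m + 1) → X} {d : Fin (m + 1) → ℤ} (hs : ∀ i, s i ∈ X.deg (d i))
    (h0 : ∀ k, k < m → f (fun i => s (i - Fin.ofNat (m + 1) (k + 1))) = 0) : f s = 0 := by
  -- The cyclic sum depends only on the class; by assumption just its unrotated term survives at
  -- `s`.
  have h1 : cycSum m (Ham.mk f) s = 0 := by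
    rw [hf, map_zero]
    rfl
  rw [cycSum_mk, _root_.sum_apply, Finset.sum_range_succ', Finset.sum_eq_zero fun j hj => ?_,
    zero_add] at h1
  · exact h1
  · rw [rotate_pow_apply m _ _ _ d fun i => hasParity_of_mem_deg (hs i),
      h0 j (Finset.mem_range.1 hj), mul_zero]

end Invariance

/-! ### X^gauge S^V with the ghost moved to the last slot. -/

section GaugeInvariance

variable {n : ℕ} {𝕂 M : Type*} [RCLike 𝕂] [TopologicalSpace M]
  [ChartedSpace (EuclideanSpace ℝ (Fin n)) M] [CompactSpace M] [IsManifold (𝓡 n) ∞ M]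

variable {U V : GradedModule n 𝕂 M} {alg : LocalAlgebra U}

namespace TwistedLocalBimodule

variable (bim : TwistedLocalBimodule alg V)

/-- The part of `X^gauge_2` given by the left action. -/
noncomputable def gaugeLeft :
    ContinuousMultilinearMap 𝕂 (fun _ : Fin 2 => ghostsFields U V) (ghostsFields U V) :=
  ((bim.left_local.comp_linear (-toGhosts U V) (toFields U V)
    (susp U V ∘ₗ inV U V)).ofBilinear).toCMM

/-- The part of `X^gauge_2` given by the right action. -/
noncomputable def gaugeRight :
    ContinuousMultilinearMap 𝕂 (fun _ : Fin 2 => ghostsFields U V) (ghostsFields U V) :=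
  ((bim.right_local.comp_linear (toFields U V ∘ₗ (ghostsFields U V).parity) (toGhosts U V)
    (susp U V ∘ₗ inV U V)).ofBilinear).toCMM

theorem toFields_gaugeLeft (x y : ghostsFields U V) :
    toFields U V (bim.gaugeLeft ![x, y]) = -bim.left (toGhosts U V x) (toFields U V y) := by
  change bim.left (-toGhosts U V x) (toFields U V y) = _
  rw [map_neg, LinearMap.neg_apply]

theorem toFields_gaugeRight {i : ℤ} {x : ghostsFields U V} (hx : x ∈ (ghostsFields U V).deg i)
    (y : ghostsFields U V) :
    toFields U V (bim.gaugeRight ![x, y]) =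
      ((i.negOnePow : ℤ) : 𝕂) • bim.right (toFields U V x) (toGhosts U V y) := by
  change bim.right (toFields U V ((ghostsFields U V).parity x)) (toGhosts U V y) = _
  rw [GradedModule.parity_of_mem_deg _ hx, LinearMap.map_smul_of_tower, map_smul,
    LinearMap.smul_apply]

theorem toFields_gauge_one (x : ghostsFields U V) :
    toFields U V (bim.gauge 1 ![x]) = bim.d (toGhosts U V x) := rfl

theorem toFields_gauge_two {i : ℤ} {x : ghostsFields U V} (hx : x ∈ (ghostsFields U V).deg i)
    (y : ghostsFields U V) :
    toFields U V (bim.gauge 2 ![x, y]) =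
      toFields U V (bim.gaugeLeft ![x, y]) + toFields U V (bim.gaugeRight ![x, y]) := by
  rw [toFields_gaugeLeft, bim.toFields_gaugeRight hx]
  exact congrArg (toFields U V) (bim.gaugeMul_apply hx y)

/-- The functional `X^gauge S` in `l + 2` arguments, cyclically permuted such that only the last
argument enters through its component in `ΣU`. -/
noncomputable def gaugeVariation (S : KontHam V) (l : ℕ) : Dist (l + 2) (ghostsFields U V) :=
  insertLast (m := l + 1) (k := 1) (N := l + 2) rfl
      (Dist.pullback (toFields U V) (cycSum (l + 1) (S (l + 2)))) 1 (bim.gauge 1) +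
    ((rotate (l + 2) ^ (l + 1)) (insertLast (m := l) (k := 2) (N := l + 2) rfl
        (Dist.pullback (toFields U V) (cycSum l (S (l + 1)))) 1 bim.gaugeLeft) +
      insertLast (m := l) (k := 2) (N := l + 2) rfl
        (Dist.pullback (toFields U V) (cycSum l (S (l + 1)))) 1 bim.gaugeRight)

/-- The functional reads only V-components, so the product of two ghosts in X^gauge_2 drops out and
the left and right actions remain. They are separated because their ghosts sit in different slots.
-/
theorem insertLast_gauge_two {m N : ℕ} (h : m + 2 = N) (f : Dist (m + 1) V) :
    insertLast h (Dist.pullback (toFields U V) f) 1 (bim.gauge 2) =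
      insertLast h (Dist.pullback (toFields U V) f) 1 bim.gaugeLeft +
        insertLast h (Dist.pullback (toFields U V) f) 1 bim.gaugeRight := by
  subst h
  refine Dist.ext_of_mem_deg fun s d hs => ?_
  have hs1 : s = Fin.snoc (α := fun _ => ghostsFields U V)
      (Fin.snoc (α := fun _ => ghostsFields U V) (Fin.init (Fin.init s))
        (Fin.init s (Fin.last m))) (s (Fin.last (m + 1))) := by
    rw [Fin.snoc_init_self, Fin.snoc_init_self]
  rw [add_apply, hs1]
  have hw : ∀ i, (Fin.init (Fin.init s) : Fin m → ghostsFields U V) i ∈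
      (ghostsFields U V).deg (d i.castSucc.castSucc) := fun i => hs _
  rw [insertLast_snoc_snoc _ _ _ _ _ hw, insertLast_snoc_snoc _ _ _ _ _ hw,
    insertLast_snoc_snoc _ _ _ _ _ hw, Dist.pullback_snoc, Dist.pullback_snoc,
    Dist.pullback_snoc, bim.toFields_gauge_two (x := Fin.init s (Fin.last m)) (hs _),
    Dist.snoc_add, mul_add]

theorem gauge_add_three (k : ℕ) (s : Fin (k + 3) → ghostsFields U V) :
    bim.gauge (k + 3) s = 0 := rfl

theorem gauge_zero (s : Fin 0 → ghostsFields U V) : bim.gauge 0 s = 0 := rfl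

theorem act_gauge_onFields_zero (S : KontHam V) : act 1 bim.gauge (onFields U S) 0 = 0 := by
  rw [act_zero_eq, actTerm_eq_zero _ _ _ _ bim.gauge_zero]

theorem act_gauge_onFields_one (S : KontHam V) : act 1 bim.gauge (onFields U S) 1 =
    Ham.mk (insertLast (m := 0) (k := 1) (N := 1) rfl
      (Dist.pullback (toFields U V) (cycSum 0 (S 1))) 1 (bim.gauge 1)) := by
  rw [act_one_eq, actTerm_eq_zero _ _ _ _ bim.gauge_zero, zero_add, actTerm_eq _ _ _ rfl,
    onFields, cycSum_pullback]

/-- X^gauge has only a linear and a quadratic component, which leaves two insertions. In the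
left-action term the ghost is the last but one argument, and rotating that term brings it to the
last slot without changing the class. -/
theorem act_gauge_onFields_add_two (S : KontHam V) (l : ℕ) :
    act 1 bim.gauge (onFields U S) (l + 2) = Ham.mk (bim.gaugeVariation S l) := by
  rw [act_add_two_eq 1 bim.gauge_add_three, actTerm_eq_zero _ _ _ _ bim.gauge_zero, zero_add,
    actTerm_eq (m := l + 1) (k := 1) (N := l + 2) _ _ _ rfl,
    actTerm_eq (m := l) (k := 2) (N := l + 2) _ _ _ rfl, onFields, cycSum_pullback,
    cycSum_pullback, insertLast_gauge_two, gaugeVariation, map_add, map_add, map_add,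
    Ham.mk_rotate_pow]

/-- Moving the inserted value to the front, except in the right-action term, leaves a common sign.
The degree `e` is taken in ΣU, so the element of U has degree e+1; this is why e+1 appears in the
relative sign of the right-action term. -/
theorem gaugeVariation_apply (S : KontHam V) {l : ℕ} {w : Fin (l + 1) → ghostsFields U V}
    {x : ghostsFields U V} {p : Fin (l + 1) → ℤ} {e : ℤ}
    (hw : ∀ i, w i ∈ (ghostsFields U V).deg (p i)) (hx : x ∈ (ghostsFields U V).deg e) :
    bim.gaugeVariation S l (Fin.snoc (α := fun _ => ghostsFields U V) w x) =
      (((e * ∑ i, p i).negOnePow : ℤ) : 𝕂) *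
        (cycSum (l + 1) (S (l + 2)) (Fin.cons (α := fun _ => V) (bim.d (toGhosts U V x))
            fun i => toFields U V (w i)) -
          (cycSum l (S (l + 1)) (Fin.cons (α := fun _ => V)
              (bim.left (toGhosts U V x) (toFields U V (w 0)))
              (Fin.tail fun i => toFields U V (w i))) -
            ((((e + 1) * ∑ i, p i).negOnePow : ℤ) : 𝕂) *
              cycSum l (S (l + 1)) (Fin.snoc (α := fun _ => V)
                (Fin.init fun i => toFields U V (w i))
                (bim.right (toFields U V (w (Fin.last l))) (toGhosts U V x))))) := by
  have ha := toGhosts_mem_deg hx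
  have hv := fun i => toFields_mem_deg (hw i)
  have h1 : insertLast (m := l + 1) (k := 1) (N := l + 2) rfl
      (Dist.pullback (toFields U V) (cycSum (l + 1) (S (l + 2)))) 1 (bim.gauge 1)
      (Fin.snoc (α := fun _ => ghostsFields U V) w x) =
      (((e * ∑ i, p i).negOnePow : ℤ) : 𝕂) * cycSum (l + 1) (S (l + 2))
        (Fin.cons (α := fun _ => V) (bim.d (toGhosts U V x)) fun i => toFields U V (w i)) := by
    rw [insertLast_snoc _ _ _ _ hw, Dist.pullback_snoc, toFields_gauge_one,
      cycSum_snoc _ hv (bim.d_deg ha), ← mul_assoc, ← negOnePow_add_cast]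
    congr 1
    -- The odd X^gauge_1 passing `w` gives ∑ p, and moving da, of degree e+1, to the front gives
    -- (e+1)∑ p; together they equal e∑ p modulo 2.
    refine negOnePow_congr ⟨∑ i, p i, ?_⟩
    ring
  have h2 : (rotate (l + 2) ^ (l + 1)) (insertLast (m := l) (k := 2) (N := l + 2) rfl
      (Dist.pullback (toFields U V) (cycSum l (S (l + 1)))) 1 bim.gaugeLeft)
      (Fin.snoc (α := fun _ => ghostsFields U V) w x) =
      -((((e * ∑ i, p i).negOnePow : ℤ) : 𝕂) * cycSum l (S (l + 1)) (Fin.cons (α := fun _ => V)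
        (bim.left (toGhosts U V x) (toFields U V (w 0)))
        (Fin.tail fun i => toFields U V (w i)))) := by
    have hw' : ∀ i, (Fin.tail w : Fin l → ghostsFields U V) i ∈
        (ghostsFields U V).deg (p i.succ) := fun i => hw _
    have hv' : ∀ i, toFields U V ((Fin.tail w : Fin l → ghostsFields U V) i) ∈
        V.deg (p i.succ) := fun i => hv _
    conv_lhs => rw [← Fin.cons_self_tail w]
    rw [rotate_pow_snoc_cons _ hw' hx (hw 0), insertLast_snoc_snoc _ _ _ _ _ hw',
      Dist.pullback_snoc, toFields_gaugeLeft, ← neg_one_smul 𝕂 (bim.left _ _), Dist.snoc_smul,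
      cycSum_snoc _ hv' (bim.left_deg ha (hv 0)), ← mul_assoc, mul_left_comm, ← mul_assoc,
      ← mul_assoc, neg_one_mul, neg_mul, neg_mul, neg_inj, ← negOnePow_add_cast, mul_assoc,
      ← mul_assoc, ← negOnePow_add_cast]
    congr 1
    refine negOnePow_congr ?_
    rw [Fin.sum_univ_succ]
    refine ⟨(∑ i : Fin l, p i.succ) * p 0 + ∑ i : Fin l, p i.succ, ?_⟩
    ring
  have h3 : insertLast (m := l) (k := 2) (N := l + 2) rfl
      (Dist.pullback (toFields U V) (cycSum l (S (l + 1)))) 1 bim.gaugeRight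
      (Fin.snoc (α := fun _ => ghostsFields U V) w x) =
      (((e * ∑ i, p i).negOnePow : ℤ) : 𝕂) * (((((e + 1) * ∑ i, p i).negOnePow : ℤ) : 𝕂) *
        cycSum l (S (l + 1)) (Fin.snoc (α := fun _ => V) (Fin.init fun i => toFields U V (w i))
          (bim.right (toFields U V (w (Fin.last l))) (toGhosts U V x)))) := by
    have hw' : ∀ i, (Fin.init w : Fin l → ghostsFields U V) i ∈
        (ghostsFields U V).deg (p i.castSucc) := fun i => hw _
    conv_lhs => rw [← Fin.snoc_init_self w]
    rw [insertLast_snoc_snoc _ _ _ _ _ hw', Dist.pullback_snoc,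
      bim.toFields_gaugeRight (hw _), Dist.snoc_smul, ← mul_assoc, ← mul_assoc,
      ← negOnePow_add_cast, ← negOnePow_add_cast]
    congr 1
    refine negOnePow_congr ?_
    rw [Fin.sum_univ_castSucc]
    refine ⟨-e * (∑ i : Fin l, p i.castSucc + p (Fin.last l)), ?_⟩
    ring
  rw [gaugeVariation, add_apply, add_apply, h1, h2, h3]
  ring

end TwistedLocalBimodule

end GaugeInvariance

/-! ### Gauge invariance as identities between components. -/

section GaugeInvarianceCriterion

variable {n : ℕ} {𝕂 M : Type*} [RCLike 𝕂] [TopologicalSpace M]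
  [ChartedSpace (EuclideanSpace ℝ (Fin n)) M] [CompactSpace M] [IsManifold (𝓡 n) ∞ M]

variable {U V : GradedModule n 𝕂 M} {alg : LocalAlgebra U}

namespace TwistedLocalBimodule

variable (bim : TwistedLocalBimodule alg V)

/-- Each of the three terms is linear in the ghost component a of the last argument, through da, av
or va. -/
theorem gaugeVariation_eq_zero_of_toGhosts (S : KontHam V) {l : ℕ}
    {s : Fin (l + 2) → ghostsFields U V} {d : Fin (l + 2) → ℤ}
    (hs : ∀ i, s i ∈ (ghostsFields U V).deg (d i)) (h0 : toGhosts U V (s (Fin.last _)) = 0) :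
    bim.gaugeVariation S l s = 0 := by
  rw [← Fin.snoc_init_self s, bim.gaugeVariation_apply S (w := Fin.init s)
    (p := fun i => d i.castSucc) (fun i => hs _) (hs _), h0, map_zero, map_zero, map_zero,
    LinearMap.zero_apply, Dist.snoc_zero,
    (cycSum (l + 1) (S (l + 2))).map_coord_zero 0 (Fin.cons_zero _ _),
    (cycSum l (S (l + 1))).map_coord_zero 0 (Fin.cons_zero _ _)]
  ring

/-- The infinitesimal gauge invariance of `S`, as an identity between its components. -/
theorem act_gauge_onFields_eq_zero_iff (S : KontHam V) :
    act 1 bim.gauge (onFields U S) = 0 ↔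
      ∀ (i : ℤ) (a : U), a ∈ U.deg i →
        cycSum 0 (S 1) (fun _ => bim.d a) = 0 ∧
        ∀ (l : ℕ) (v : Fin (l + 1) → V) (q : Fin (l + 1) → ℤ), (∀ k, v k ∈ V.deg (q k)) →
          cycSum (l + 1) (S (l + 2)) (Fin.cons (bim.d a) v) =
            cycSum l (S (l + 1)) (Fin.cons (bim.left a (v 0)) (Fin.tail v)) -
              (((i * ∑ k, q k).negOnePow : ℤ) : 𝕂) *
                cycSum l (S (l + 1)) (Fin.snoc (Fin.init v) (bim.right (v (Fin.last l)) a)) := by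
  have h1 : ∀ x : ghostsFields U V,
      insertLast (m := 0) (k := 1) (N := 1) rfl
        (Dist.pullback (toFields U V) (cycSum 0 (S 1))) 1 (bim.gauge 1)
        (Fin.snoc (α := fun _ => ghostsFields U V) Fin.elim0 x) =
        cycSum 0 (S 1) fun _ => bim.d (toGhosts U V x) := fun x => by
    rw [insertLast_snoc (p := Fin.elim0) _ _ _ _ fun i => i.elim0, Dist.pullback_snoc,
      toFields_gauge_one, Fin.sum_univ_zero, mul_zero, Int.negOnePow_zero, Units.val_one,
      Int.cast_one, one_mul]
    congr 1
  constructor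
  · intro h i a ha
    -- In ΣU the element `a` has degree i−1.
    have hx : (ghostPair a 0 : ghostsFields U V) ∈ (ghostsFields U V).deg (i - 1) :=
      ghostPair_mem_deg (by rwa [sub_add_cancel]) (zero_mem _)
    refine ⟨?_, fun l v q hv => ?_⟩
    · have h2 := (bim.act_gauge_onFields_one S).symm.trans (congrFun h 1)
      rw [← toGhosts_ghostPair a (0 : V), ← h1]
      exact Dist.apply_eq_zero_of_mk_eq_zero h2 (d := fun _ => i - 1) (fun j => by
        rw [Fin.snoc_zero]
        exact hx) fun k hk => absurd hk (Nat.not_lt_zero k)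
    · have h2 := (bim.act_gauge_onFields_add_two S l).symm.trans (congrFun h (l + 2))
      have hw : ∀ k, (ghostPair 0 (v k) : ghostsFields U V) ∈ (ghostsFields U V).deg (q k) :=
        fun k => ghostPair_mem_deg (zero_mem _) (hv k)
      have hs : ∀ k, (Fin.snoc (α := fun _ => ghostsFields U V) (fun k => ghostPair 0 (v k))
          (ghostPair a 0) k : ghostsFields U V) ∈
            (ghostsFields U V).deg (Fin.snoc (α := fun _ => ℤ) q (i - 1) k) := fun k => by
        induction k using Fin.lastCases with
        | last => rw [Fin.snoc_last, Fin.snoc_last]; exact hx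
        | cast k => rw [Fin.snoc_castSucc, Fin.snoc_castSucc]; exact hw k
      -- Any proper rotation puts one of the v_k, which has no ghost component, into the last slot,
      -- and the representative vanishes there. So the vanishing of the class gives the vanishing of
      -- the representative on these arguments.
      have h3 := Dist.apply_eq_zero_of_mk_eq_zero h2 hs fun k hk =>
        bim.gaugeVariation_eq_zero_of_toGhosts S (fun j => hs _) (by
          have h4 : Fin.last (l + 1) - Fin.ofNat (l + 1 + 1) (k + 1) =
              Fin.castSucc ⟨l - k, by omega⟩ := by
            refine Fin.ext ?_
            simp only [Fin.sub_def, Fin.val_ofNat, Fin.val_castSucc, Fin.val_last]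
            rw [Nat.mod_eq_of_lt (a := k + 1) (by omega),
              show l + 1 + 1 - (k + 1) + (l + 1) = l - k + (l + 1 + 1) by omega,
              Nat.add_mod_right, Nat.mod_eq_of_lt (by omega)]
          rw [h4, Fin.snoc_castSucc]
          exact toGhosts_ghostPair _ _)
      rw [bim.gaugeVariation_apply S hw hx, sub_add_cancel] at h3
      have h5 : ((((i - 1) * ∑ k, q k).negOnePow : ℤ) : 𝕂) ≠ 0 := fun h0 => by
        have := negOnePow_mul_self (𝕂 := 𝕂) ((i - 1) * ∑ k, q k)
        rw [h0, zero_mul] at this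
        exact zero_ne_one this
      exact sub_eq_zero.1 ((mul_eq_zero.1 h3).resolve_left h5)
  -- Conversely the representatives vanish outright: on homogeneous arguments they involve only the
  -- ghost component of the last argument and the V-components of the others.
  · intro h
    funext N
    rw [Pi.zero_apply]
    match N with
    | 0 => exact bim.act_gauge_onFields_zero S
    | 1 =>
      rw [act_gauge_onFields_one]
      refine (congrArg _ (Dist.ext_of_mem_deg fun s d hs => ?_)).trans (map_zero Ham.mk)
      have h2 : s = Fin.snoc (α := fun _ => ghostsFields U V) Fin.elim0 (s 0) := by
        funext i
        rw [Subsingleton.elim i 0, Fin.snoc_zero]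
      rw [h2, h1]
      exact (h _ _ (toGhosts_mem_deg (hs 0))).1
    | l + 2 =>
      rw [act_gauge_onFields_add_two]
      refine (congrArg _ (Dist.ext_of_mem_deg fun s d hs => ?_)).trans (map_zero Ham.mk)
      have hw : ∀ i, (Fin.init s : Fin (l + 1) → ghostsFields U V) i ∈
          (ghostsFields U V).deg (d i.castSucc) := fun i => hs _
      rw [← Fin.snoc_init_self s, bim.gaugeVariation_apply S hw (hs _)]
      have h2 := (h _ _ (toGhosts_mem_deg (hs (Fin.last _)))).2 l
        (fun i => toFields U V (Fin.init s i)) _ fun i => toFields_mem_deg (hw i)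
      exact mul_eq_zero_of_right _ (sub_eq_zero.2 h2)

end TwistedLocalBimodule

end GaugeInvarianceCriterion

/-! ### Invariance under the action of U. -/

section Symmetry

variable {n : ℕ} {𝕂 M : Type*} [RCLike 𝕂] [TopologicalSpace M]
  [ChartedSpace (EuclideanSpace ℝ (Fin n)) M] [CompactSpace M] [IsManifold (𝓡 n) ∞ M]

/-- The action of an affine vector field. -/
theorem act_add_one_eq {X : GradedModule n 𝕂 M} (j : ℤ) {Y : VectorField X}
    (hY : ∀ k s, Y (k + 2) s = 0) (h : KontHam X) (N : ℕ) :
    act j Y h (N + 1) = actTerm j Y h (N + 1) 0 (N + 1) + actTerm j Y h N 1 (N + 1) := by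
  rw [act_eq_sum_actTerm, Finset.sum_range_succ', Finset.sum_range_succ',
    Finset.sum_eq_zero fun k _ => actTerm_eq_zero j h _ _ (hY k), zero_add]
  simp only [Nat.zero_add, Nat.add_sub_cancel, Nat.sub_zero]
  exact add_comm _ _

theorem rotate_pow_cons {X : GradedModule n 𝕂 M} {m : ℕ} (f : Dist (m + 1) X) {w : Fin m → X}
    {y : X} {p : Fin m → ℤ} {q : ℤ} (hw : ∀ i, w i ∈ X.deg (p i)) (hy : y ∈ X.deg q) :
    (rotate (m + 1) ^ m) f (Fin.cons (α := fun _ => X) y w) =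
      ((((∑ i, p i) * q).negOnePow : ℤ) : 𝕂) * f (Fin.snoc (α := fun _ => X) w y) := by
  have h1 := rotate_pow_append (m := m) (k := 1) (N := m) rfl f hw (w := ![y]) (q := ![q])
    (fun i => by fin_cases i; exact hy)
  rw [Fin.sum_univ_one, Fin.append_right_eq_snoc, Fin.append_left_eq_cons] at h1
  exact h1

theorem insertLast_const {X : GradedModule n 𝕂 M} {m : ℕ} (f : Dist (m + 1) X) (j : ℤ)
    (P : ContinuousMultilinearMap 𝕂 (fun _ : Fin 0 => X) X) {s : Fin m → X} {p : Fin m → ℤ}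
    (hs : ∀ i, s i ∈ X.deg (p i)) :
    insertLast (m := m) (k := 0) (N := m) rfl f j P s =
      (((j * ∑ i, p i).negOnePow : ℤ) : 𝕂) *
        f (Fin.snoc (α := fun _ => X) s (P Fin.elim0)) := by
  have h1 := insertLast_append (N := m) rfl f j P Fin.elim0 hs
  rw [Fin.append_elim0] at h1
  exact h1

variable {U V : GradedModule n 𝕂 M} {alg : LocalAlgebra U}

namespace TwistedLocalBimodule

variable (bim : TwistedLocalBimodule alg V)

/-- Gauge invariance implies invariance under the action of `U`. -/
theorem isInvariant_of_act_gauge {S : KontHam V}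
    (h : act 1 bim.gauge (onFields U S) = 0) : bim.IsInvariant S := by
  intro i a ha
  obtain ⟨h0, h1⟩ := (bim.act_gauge_onFields_eq_zero_iff S).1 h i a ha
  have hY : ∀ k s, bim.symmetry i a (k + 2) s = 0 := fun k s => rfl
  have hd : bim.symmetry i a 0 Fin.elim0 = (-1 : 𝕂) • bim.d a := (neg_one_smul 𝕂 _).symm
  funext N
  rw [Pi.zero_apply]
  match N with
  | 0 =>
    rw [act_zero_eq, actTerm_eq (m := 0) (k := 0) (N := 0) _ _ _ rfl]
    refine (congrArg _ (Dist.ext_of_mem_deg fun s d hs => ?_)).trans (map_zero Ham.mk)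
    rw [insertLast_const _ _ _ hs, hd, Dist.snoc_smul]
    have h2 : (Fin.snoc (α := fun _ => V) s (bim.d a) : Fin 1 → V) = fun _ => bim.d a :=
      Fin.snoc_zero _ _
    rw [h2, h0, mul_zero, mul_zero]
    rfl
  | l + 1 =>
    -- The commutator is split because only its left half has to be rotated: after insertion in the
    -- last slot, av must be moved to the front, whereas va already stands where the identity wants
    -- it.
    let P : ContinuousMultilinearMap 𝕂 (fun _ : Fin 1 => V) V :=
      (bim.left_local.left a).ofLinear.toCMM
    let Q : ContinuousMultilinearMap 𝕂 (fun _ : Fin 1 => V) V :=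
      ((bim.right_local.right a).comp_linear (-V.koszul i) LinearMap.id).ofLinear.toCMM
    have hP : ∀ x, P ![x] = bim.left a x := fun x => rfl
    have hQ : ∀ {j : ℤ} {x : V}, x ∈ V.deg j →
        Q ![x] = (-(((i * j).negOnePow : ℤ) : 𝕂)) • bim.right x a := fun {j x} hx => by
      change bim.right (-V.koszul i x) a = _
      rw [V.koszul_of_mem_deg i hx, ← Int.cast_smul_eq_zsmul 𝕂, ← neg_smul, map_smul,
        LinearMap.smul_apply]
    have hPQ : ∀ s, bim.symmetry i a 1 s = P s + Q s := fun s => by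
      change bim.left a (s 0) - bim.right (V.koszul i (s 0)) a =
        bim.left a (s 0) + bim.right (-V.koszul i (s 0)) a
      rw [map_neg, LinearMap.neg_apply, sub_eq_add_neg]
    rw [act_add_one_eq i hY, actTerm_eq (m := l + 1) (k := 0) (N := l + 1) _ _ _ rfl,
      actTerm_eq (m := l) (k := 1) (N := l + 1) _ _ _ rfl, insertLast_of_add _ _ _ hPQ, map_add,
      ← Ham.mk_rotate_pow (insertLast (m := l) (k := 1) (N := l + 1) rfl _ i P) l, ← map_add,
      ← map_add]
    refine (congrArg _ (Dist.ext_of_mem_deg fun s d hs => ?_)).trans (map_zero Ham.mk)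
    have e1 : insertLast (m := l + 1) (k := 0) (N := l + 1) rfl (cycSum (l + 1) (S (l + 2))) i
        (bim.symmetry i a 0) s =
        -cycSum (l + 1) (S (l + 2)) (Fin.cons (α := fun _ => V) (bim.d a) s) := by
      rw [insertLast_const _ _ _ hs, hd, Dist.snoc_smul, cycSum_snoc _ hs (bim.d_deg ha),
        mul_left_comm, ← mul_assoc (((i * _).negOnePow : ℤ) : 𝕂), negOnePow_mul_self, one_mul,
        neg_one_mul]
    have e2 : (rotate (l + 1) ^ l)
        (insertLast (m := l) (k := 1) (N := l + 1) rfl (cycSum l (S (l + 1))) i P) s =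
        cycSum l (S (l + 1)) (Fin.cons (α := fun _ => V) (bim.left a (s 0)) (Fin.tail s)) := by
      have hw : ∀ j, (Fin.tail s : Fin l → V) j ∈ V.deg (d j.succ) := fun j => hs _
      conv_lhs => rw [← Fin.cons_self_tail s]
      rw [rotate_pow_cons _ hw (hs 0), insertLast_snoc _ _ _ _ hw, hP,
        cycSum_snoc _ hw (bim.left_deg ha (hs 0)), ← mul_assoc, ← mul_assoc,
        ← negOnePow_add_cast, ← negOnePow_add_cast, Int.negOnePow_even, Units.val_one,
        Int.cast_one, one_mul]
      -- With T the degree of the tail, the signs d₀T of the rotation, iT of the insertion and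
      -- (i+d₀)T of moving av to the front cancel.
      refine ⟨(i + d 0) * ∑ j : Fin l, d j.succ, ?_⟩
      ring
    have e3 : insertLast (m := l) (k := 1) (N := l + 1) rfl (cycSum l (S (l + 1))) i Q s =
        -((((i * ∑ k, d k).negOnePow : ℤ) : 𝕂) * cycSum l (S (l + 1))
          (Fin.snoc (α := fun _ => V) (Fin.init s) (bim.right (s (Fin.last l)) a))) := by
      have hw : ∀ j, (Fin.init s : Fin l → V) j ∈ V.deg (d j.castSucc) := fun j => hs _
      conv_lhs => rw [← Fin.snoc_init_self s]
      rw [insertLast_snoc _ _ _ _ hw, hQ (hs _), Dist.snoc_smul, neg_mul, mul_neg, ← mul_assoc,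
        ← negOnePow_add_cast, Fin.sum_univ_castSucc, mul_add]
    -- The sum is minus the difference of the two sides of the invariance identity for `a`.
    refine (congrArg₂ (· + ·) e1 (congrArg₂ (· + ·) e2 e3)).trans ?_
    have h2 := h1 l s d hs
    rw [h2]
    change _ = (0 : 𝕂)
    ring

end TwistedLocalBimodule

end Symmetry

end NCBV

theorem mainTheorem7 {n : ℕ} {𝕂 M : Type*} [RCLike 𝕂] [TopologicalSpace M]
    [ChartedSpace (EuclideanSpace ℝ (Fin n)) M] [CompactSpace M] [IsManifold (𝓡 n) ∞ M] [T2Space M]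
    (U V : NCBV.GradedBundle n 𝕂 M) (alg : NCBV.LocalAlgebra U.sections)
    (bim : NCBV.TwistedLocalBimodule alg V.sections) (SV : NCBV.KontHam V.sections)
    (hlocal : NCBV.IsLocal SV) (hdeg : NCBV.IsDegreeZero SV) :
    NCBV.SatisfiesCME (NCBV.onAll U.sections SV) ∧
    (NCBV.SatisfiesCME (bim.gaugeAction + NCBV.onAll U.sections SV) ↔
      NCBV.act 1 bim.gauge (NCBV.onFields U.sections SV) = 0) ∧
    (NCBV.act 1 bim.gauge (NCBV.onFields U.sections SV) = 0 ↔
      ∀ (i : ℤ) (a : U.sections), a ∈ U.sections.deg i →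
        NCBV.cycSum 0 (SV 1) (fun _ => bim.d a) = 0 ∧
        ∀ (l : ℕ) (v : Fin (l + 1) → V.sections) (q : Fin (l + 1) → ℤ),
          (∀ k, v k ∈ V.sections.deg (q k)) →
          NCBV.cycSum (l + 1) (SV (l + 2)) (Fin.cons (bim.d a) v) =
            NCBV.cycSum l (SV (l + 1)) (Fin.cons (bim.left a (v 0)) (Fin.tail v)) -
              (((i * ∑ k, q k).negOnePow : ℤ) : 𝕂) *
                NCBV.cycSum l (SV (l + 1))
                  (Fin.snoc (Fin.init v) (bim.right (v (Fin.last l)) a))) ∧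
    (NCBV.SatisfiesCME (bim.gaugeAction + NCBV.onAll U.sections SV) → bim.IsInvariant SV) := by
  exact ⟨NCBV.satisfiesCME_onAll hlocal hdeg, bim.satisfiesCME_iff_act_gauge hlocal hdeg,
    bim.act_gauge_onFields_eq_zero_iff SV, fun h => bim.isInvariant_of_act_gauge
      ((bim.satisfiesCME_iff_act_gauge hlocal hdeg).1 h)⟩
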